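/- Let $M$ be a smooth (Hausdorff) manifold of dimension $m+1$ with a smooth, symmetric, nonnegative (possibly degenerate) inner product $\langle\cdot,\cdot\rangle^*$ on $T^*M$ and a nowhere vanishing smooth $(m+1)$-form $dv_M$ (a subriemannian manifold with a background volume form), and let $p_0\in M$. Write $|\omega|_*=(\langle\omega,\omega\rangle^*)^{1/2}$, define $G:T^*M\to TM$ by $\omega(G(\eta))=\langle\omega,\eta\rangle^*$, put $\xi=\mathrm{Range}(G)$, and assume that $\dim\xi=m+1-l$ is constant near $p_0$. For a 1-form $\omega$ let $\omega\lrcorner dv_M$ be the $m$-form with $\eta\wedge(\omega\lrcorner dv_M)=\langle\eta,\omega\rangle^*dv_M$ for all 1-forms $\eta$. For $p\ge 0$ and a smooth function $\phi$ define $H_{\phi,p}$, wherever $|d\phi|_*\neq0$, by $$d\Big(\frac{d\phi}{|d\phi|_*^{1-p}}\lrcorner dv_M\Big)=H_{\phi,p}\,dv_M .$$ Suppose that $M$ has isometric translations near $p_0$: there are an open neighborhood $U$ of $p_0$, $\delta>0$ and a smooth one-parameter family of local diffeomorphisms $\Psi_a:U\to M$, $a\in(-\delta,\delta)$, with $\Psi_0=\mathrm{Id}$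 and $\Psi_{a+b}=\Psi_a\circ\Psi_b$ wherever defined, which on $U$ preserve $\langle\cdot,\cdot\rangle^*$ and $dv_M$. Let $\Sigma\ni p_0$ be a smooth hypersurface to which $\{\Psi_a\}$ is transversal in $U$, that is, $\frac{d}{da}\Psi_a(x)|_{a=0}\notin T_x\Sigma$ for $x\in\Sigma\cap U$. Let $x^1,\dots,x^{m+1}$ be translation-isometric coordinates on an open neighborhood $V\subset U$ of $p_0$: smooth coordinates in which $p_0$ is the origin and $\Sigma\cap V=\{x^{m+1}=0\}$, such that for all $q\in V$ and $a\in(-\delta,\delta)$ with $\Psi_a(q)\in V$ one has $x^j(\Psi_a(q))=x^j(q)$ for $1\le j\le m$, $x^{m+1}(\Psi_a(q))=x^{m+1}(q)+a$, and $A(\Psi_a(q))=A(q)$, where $dv_M=A\,dx^1\wedge\dots\wedge dx^{m+1}$. Let $u,v:\Sigma\cap V\to\mathbb R$ be smooth functions of $(x^1,\dots,x^m)$ whose graphs $\{x^{m+1}=u(x^1,\dots,x^m)\}$ and $\{x^{m+1}=v(x^1,\dots,x^m)\}$ over $\Sigma\cap V$ lie in $V$ and satisfy $|d(u-x^{m+1})|_*\ne0$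 and $|d(v-x^{m+1})|_*\neq 0$ along the respective graph. For $w\in\{u,v\}$ let $H_p(w)(x^1,\dots,x^m)$ be the value of $H_{\phi,p}$ with $\phi=w-x^{m+1}$ at the point $(x^1,\dots,x^m,w(x^1,\dots,x^m))$. Assume (1) $v\ge u$ on $\Sigma\cap V$ and $v(0)=u(0)=0$; (2) for some $p\ge0$, $H_p(v)\le H_p(u)$ on $\Sigma\cap V$; (3) (rank condition) there is a neighborhood $O$ of $p_0$ such that for any smooth sections $X_1,\dots,X_{m-l}$ of $\xi$ over an open set $W\subset O$ that are linearly independent at every point of $W$, the vectors $Z(x)$, $Z\in\pounds(X_1,\dots,X_{m-l})$, span a space of dimension at least $m$ at every $x\in W$; here $\pounds(X_1,\dots,X_{m-l})$ is the smallest $C^\infty(W)$-module of vector fields that contains $X_1,\dots,X_{m-l}$ and is closed under the Lie bracket. Then $v\equiv u$ in a neighborhood of $p_0$ in $\Sigma$. -/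

import Mathlib

open scoped Manifold ContDiff Topology

noncomputable section

namespace SubRiem

/-- The model space `ℝⁿ`. -/
abbrev Coord (n : ℕ) : Type := EuclideanSpace ℝ (Fin n)

section Pointwise

variable {m : ℕ} {M : Type*} [TopologicalSpace M] [ChartedSpace (Coord (m + 1)) M]

/-- The tangent space of the `(m+1)`-dimensional manifold `M` at `x`. -/
abbrev Tan (m : ℕ) {M : Type*} [TopologicalSpace M] [ChartedSpace (Coord (m + 1)) M] (x : M) :
    Type :=
  TangentSpace (𝓡 (m + 1)) x

/-- The cotangent space of `M` at `x`. -/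
abbrev Cotan (m : ℕ) {M : Type*} [TopologicalSpace M] [ChartedSpace (Coord (m + 1)) M] (x : M) :
    Type :=
  Tan m x →L[ℝ] ℝ

/-- Alternating `n`-covectors of `M` at `x`. -/
abbrev Alt (m n : ℕ) {M : Type*} [TopologicalSpace M] [ChartedSpace (Coord (m + 1)) M] (x : M) :
    Type :=
  Tan m x [⋀^Fin n]→L[ℝ] ℝ

/-- The differential of a real function, as a covector. -/
def dAt (m : ℕ) {M : Type*} [TopologicalSpace M] [ChartedSpace (Coord (m + 1)) M]
    (f : M → ℝ) (x : M) : Cotan m x :=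
  mfderiv (𝓡 (m + 1)) 𝓘(ℝ, ℝ) f x

/-- Smoothness of a real function on a set. -/
def SmoothFnOn (m : ℕ) {M : Type*} [TopologicalSpace M] [ChartedSpace (Coord (m + 1)) M]
    (f : M → ℝ) (W : Set M) : Prop :=
  ContMDiffOn (𝓡 (m + 1)) 𝓘(ℝ, ℝ) ∞ f W

/-- Smoothness of a vector field on a set. -/
def SmoothFieldOn [IsManifold (𝓡 (m + 1)) ∞ M] (X : ∀ x : M, Tan m x) (W : Set M) : Prop :=
  ContMDiffOn (𝓡 (m + 1)) (𝓡 (m + 1)).tangent ∞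
    (fun x => (⟨x, X x⟩ : TangentBundle (𝓡 (m + 1)) M)) W

/-- The basis vectors of the tangent space coming from its identification with `ℝ^{m+1}`. -/
def stdVec (x : M) (i : Fin (m + 1)) : Tan m x :=
  (EuclideanSpace.single i (1 : ℝ) : Coord (m + 1))

/-- The dual basis of `stdVec`. -/
def stdCovec (x : M) (i : Fin (m + 1)) : Cotan m x :=
  (EuclideanSpace.proj i : Coord (m + 1) →L[ℝ] ℝ)

end Pointwise

/-- A subriemannian structure: a smooth, symmetric, nonnegative (possibly degenerate) inner product
`⟨·,·⟩*` on the cotangent bundle. Smoothness is expressed by saying that `⟨df, dh⟩*` is smooth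
for all smooth local functions `f`, `h`; for coordinate functions these are the
coefficients `g^{ij}`. -/
structure CoMetric (m : ℕ) (M : Type*) [TopologicalSpace M] [ChartedSpace (Coord (m + 1)) M] where
  form : ∀ x : M, Cotan m x →ₗ[ℝ] Cotan m x →ₗ[ℝ] ℝ
  symm : ∀ (x : M) (θ η : Cotan m x), form x θ η = form x η θ
  nonneg : ∀ (x : M) (θ : Cotan m x), 0 ≤ form x θ θ
  smooth : ∀ (W : Set M), IsOpen W → ∀ f h : M → ℝ, SmoothFnOn m f W → SmoothFnOn m h W →
    SmoothFnOn m (fun x => form x (dAt m f x) (dAt m h x)) W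

/-- A background volume form: a smooth nowhere vanishing `(m+1)`-form. -/
structure VolumeForm (m : ℕ) (M : Type*) [TopologicalSpace M] [ChartedSpace (Coord (m + 1)) M]
    [IsManifold (𝓡 (m + 1)) ∞ M] where
  form : ∀ x : M, Alt m (m + 1) x
  ne_zero : ∀ x : M, form x ≠ 0
  smooth : ∀ (W : Set M), IsOpen W → ∀ X : Fin (m + 1) → ∀ x : M, Tan m x,
    (∀ i, SmoothFieldOn (X i) W) → SmoothFnOn m (fun x => form x (fun i => X i x)) W

section Curvature

variable {m : ℕ} {M : Type*} [TopologicalSpace M] [ChartedSpace (Coord (m + 1)) M]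

/-- The norm `|θ|_* = (⟨θ, θ⟩*)^{1/2}`. -/
def CoMetric.norm (g : CoMetric m M) (x : M) (θ : Cotan m x) : ℝ :=
  Real.sqrt (g.form x θ θ)

/-- The map `G : T*M → TM` with `θ (G η) = ⟨θ, η⟩*` (see `CoMetric.apply_sharp`). -/
def CoMetric.sharp (g : CoMetric m M) (x : M) : Cotan m x →ₗ[ℝ] Tan m x :=
  ∑ i : Fin (m + 1), (g.form x (stdCovec x i)).smulRight (stdVec x i)

theorem covec_eq_sum (x : M) (θ : Cotan m x) :
    θ = ∑ i : Fin (m + 1), θ (stdVec x i) • stdCovec x i := by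
  have key : ∀ (L : Coord (m + 1) →L[ℝ] ℝ), L = ∑ i : Fin (m + 1),
      L (EuclideanSpace.single i (1 : ℝ)) •
        (EuclideanSpace.proj i : Coord (m + 1) →L[ℝ] ℝ) := by
    intro L
    ext v
    have hv : v = ∑ i : Fin (m + 1), v i • EuclideanSpace.single i (1 : ℝ) := by
      ext j
      simp [Pi.single_apply]
    conv_lhs => rw [hv]
    simp [mul_comm]
  exact key θ

/-- The defining property of `G`. -/
theorem CoMetric.apply_sharp (g : CoMetric m M) (x : M) (θ η : Cotan m x) :
    θ (g.sharp x η) = g.form x θ η := by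
  conv_rhs => rw [covec_eq_sum x θ]
  simp [CoMetric.sharp, mul_comm]

/-- The horizontal space `ξ_x = Range G_x`. -/
def CoMetric.horizontal (g : CoMetric m M) (x : M) : Submodule ℝ (Tan m x) :=
  LinearMap.range (g.sharp x)

/-- Contraction of an alternating covector with a vector in the first slot. -/
def contract {n : ℕ} (x : M) (α : Alt m (n + 1) x) (w : Tan m x) : Alt m n x :=
  ContinuousAlternatingMap.curryLeft (E := Coord (m + 1)) (F := ℝ) α w

/-- The interior product `θ ⌟ dv` of a covector with the volume form, that is, the `m`-covector
with `η ∧ (θ ⌟ dv) = ⟨η, θ⟩* dv` for all covectors `η` (see `wedge_interiorProd`). -/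
def interiorProd [IsManifold (𝓡 (m + 1)) ∞ M] (g : CoMetric m M) (dv : VolumeForm m M)
    (x : M) (θ : Cotan m x) : Alt m m x :=
  contract x (dv.form x) (g.sharp x θ)

theorem wedge_contract_aux (n : ℕ) (η : Coord (n+1) →L[ℝ] ℝ)
   (α : Coord (n+1) [⋀^Fin (n+1)]→L[ℝ] ℝ)
   (w : Coord (n+1)) (z : Fin (n+1) → Coord (n+1)) :
   ∑ i : Fin (n+1), (-1 : ℝ) ^ (i : ℕ) * (η (z i) * α (Fin.cons w (i.removeNth z))) = η w * α z := by
  have key : ContinuousAlternatingMap.alternatizeUncurryFin (η.smulRight α) = 0 := by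
    ext y
    have := AlternatingMap.map_linearDependent (K := ℝ)
      (ContinuousAlternatingMap.alternatizeUncurryFin (η.smulRight α)).toAlternatingMap y
      (fun h => by have := h.fintype_card_le_finrank; simp at this)
    simpa using this
  have h := congrArg (fun f => f (Fin.cons w z : Fin (n+2) → Coord (n+1))) key
  simp only [ContinuousAlternatingMap.alternatizeUncurryFin_apply] at h
  rw [Fin.sum_univ_succ] at h
  have e : ∀ i : Fin (n+1), i.succ.removeNth (Fin.cons w z : Fin (n+2) → Coord (n+1)) =
      Fin.cons w (i.removeNth z) := by
    intro i
    ext1 j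
    refine Fin.cases ?_ (fun j => ?_) j <;> simp [Fin.removeNth, Fin.succ_succAbove_succ]
  simp only [e] at h
  have e0 : (0 : Fin (n+2)).removeNth (Fin.cons w z : Fin (n+2) → Coord (n+1)) = z := by
    ext1 j; simp [Fin.removeNth]
  simp [e0, pow_succ] at h
  linarith

/-- The defining property `η ∧ (θ ⌟ dv) = ⟨η, θ⟩* dv` of the interior product, with the wedge product
of a covector and an `m`-covector written out. -/
theorem wedge_interiorProd [IsManifold (𝓡 (m + 1)) ∞ M] (g : CoMetric m M) (dv : VolumeForm m M)
    (x : M) (η θ : Cotan m x) (z : Fin (m + 1) → Tan m x) :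
    ∑ i : Fin (m + 1), (-1 : ℝ) ^ (i : ℕ) * (η (z i) * interiorProd g dv x θ (i.removeNth z)) =
      g.form x η θ * dv.form x z := by
  rw [← g.apply_sharp]
  exact wedge_contract_aux m η (dv.form x) (g.sharp x θ) z

/-- The pull-back of a form on `M` under the inverse of the chart at `x`, a form on (an open subset
of) `ℝ^{m+1}`. -/
def chartForm {n : ℕ} (α : ∀ y : M, Alt m n y) (x : M) (z : Coord (m + 1)) :
    Coord (m + 1) [⋀^Fin n]→L[ℝ] ℝ :=
  (α ((extChartAt (𝓡 (m + 1)) x).symm z)).compContinuousLinearMap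
    (mfderiv 𝓘(ℝ, Coord (m + 1)) (𝓡 (m + 1)) (extChartAt (𝓡 (m + 1)) x).symm z)

/-- The exterior derivative of a form on `M`, computed at `x` in the chart at `x`. -/
def extDerivM {n : ℕ} (α : ∀ y : M, Alt m n y) (x : M) : Alt m (n + 1) x :=
  ContinuousAlternatingMap.compContinuousLinearMap
    (extDeriv (chartForm α x) (extChartAt (𝓡 (m + 1)) x x))
    (mfderiv (𝓡 (m + 1)) 𝓘(ℝ, Coord (m + 1)) (extChartAt (𝓡 (m + 1)) x) x)

/-- The area form `|dφ|_*^{-(1-p)} dφ ⌟ dv` of the level sets of `φ`. -/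
def areaForm [IsManifold (𝓡 (m + 1)) ∞ M] (g : CoMetric m M) (dv : VolumeForm m M)
    (φ : M → ℝ) (p : ℝ) (x : M) : Alt m m x :=
  interiorProd g dv x ((g.norm x (dAt m φ x) ^ (1 - p))⁻¹ • dAt m φ x)

/-- The function `H_{φ,p}` with `d (|dφ|_*^{-(1-p)} dφ ⌟ dv) = H_{φ,p} dv`. Both sides are top
degree forms, so `H_{φ,p}` is the quotient of their values on any basis. -/
def meanCurv [IsManifold (𝓡 (m + 1)) ∞ M] (g : CoMetric m M) (dv : VolumeForm m M)
    (φ : M → ℝ) (p : ℝ) (x : M) : ℝ :=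
  extDerivM (areaForm g dv φ p) x (stdVec x) / dv.form x (stdVec x)

end Curvature

section Translations

variable {m : ℕ} {M : Type*} [TopologicalSpace M] [ChartedSpace (Coord (m + 1)) M]

/-- The differential of a map `M → M`. -/
def tanMap (m : ℕ) {M : Type*} [TopologicalSpace M] [ChartedSpace (Coord (m + 1)) M]
    (F : M → M) (x : M) : Tan m x →L[ℝ] Tan m (F x) :=
  mfderiv (𝓡 (m + 1)) (𝓡 (m + 1)) F x

/-- `Ψ_a`, `|a| < δ`, are isometric translations on the neighbourhood `U` of `p₀`: a smooth
one-parameter family of local diffeomorphisms of `U` into `M` with the (local) group law, which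
preserves the inner product on covectors and the volume form. -/
structure IsIsometricTranslations [IsManifold (𝓡 (m + 1)) ∞ M] (g : CoMetric m M) (dv : VolumeForm m M)
    (p₀ : M) (U : Set M) (δ : ℝ) (Ψ : ℝ → M → M) : Prop where
  isOpen : IsOpen U
  mem : p₀ ∈ U
  pos : 0 < δ
  smooth : ContMDiffOn (𝓘(ℝ, ℝ).prod (𝓡 (m + 1))) (𝓡 (m + 1)) ∞
    (fun z : ℝ × M => Ψ z.1 z.2) (Set.Ioo (-δ) δ ×ˢ U)
  localDiffeo : ∀ a ∈ Set.Ioo (-δ) δ,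
    IsLocalDiffeomorphOn (𝓡 (m + 1)) (𝓡 (m + 1)) ∞ (Ψ a) U
  zero : ∀ x ∈ U, Ψ 0 x = x
  add : ∀ a ∈ Set.Ioo (-δ) δ, ∀ b ∈ Set.Ioo (-δ) δ, a + b ∈ Set.Ioo (-δ) δ →
    ∀ x ∈ U, Ψ b x ∈ U → Ψ (a + b) x = Ψ a (Ψ b x)
  isometry : ∀ a ∈ Set.Ioo (-δ) δ, ∀ x ∈ U, Ψ a x ∈ U → ∀ θ η : Cotan m (Ψ a x),
    g.form x (θ.comp (tanMap m (Ψ a) x)) (η.comp (tanMap m (Ψ a) x)) = g.form (Ψ a x) θ η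
  volume : ∀ a ∈ Set.Ioo (-δ) δ, ∀ x ∈ U, Ψ a x ∈ U →
    (dv.form (Ψ a x)).compContinuousLinearMap (tanMap m (Ψ a) x) = dv.form x

/-- `φ` is a defining function of `S` on the open set `W`. -/
def IsDefiningFn (m : ℕ) {M : Type*} [TopologicalSpace M] [ChartedSpace (Coord (m + 1)) M]
    (S W : Set M) (φ : M → ℝ) : Prop :=
  IsOpen W ∧ SmoothFnOn m φ W ∧ ∀ x ∈ W, dAt m φ x ≠ 0 ∧ (x ∈ S ↔ φ x = 0)

/-- A smooth (embedded) hypersurface. -/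
def IsHypersurface (m : ℕ) {M : Type*} [TopologicalSpace M] [ChartedSpace (Coord (m + 1)) M]
    (S : Set M) : Prop :=
  ∀ x ∈ S, ∃ (W : Set M) (φ : M → ℝ), x ∈ W ∧ IsDefiningFn m S W φ

/-- The tangent space `T_x S` of a hypersurface: the kernel of `dφ_x`, where `φ` is a local defining
function near `x` (the kernel is the same for all of them). -/
def hypersurfaceTangent (S : Set M) (x : M) : Set (Tan m x) :=
  {w | ∀ (W : Set M) (φ : M → ℝ), x ∈ W → IsDefiningFn m S W φ → dAt m φ x w = 0}

/-- The initial velocity of `a ↦ Ψ_a x`. -/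
def velocity (m : ℕ) {M : Type*} [TopologicalSpace M] [ChartedSpace (Coord (m + 1)) M]
    (Ψ : ℝ → M → M) (x : M) : Tan m (Ψ 0 x) :=
  mfderiv 𝓘(ℝ, ℝ) (𝓡 (m + 1)) (fun a : ℝ => Ψ a x) 0 (1 : ℝ)

/-- `Ψ` is transversal to `S` in `U` (on `U` one has `Ψ 0 x = x`). -/
def IsTransversal (m : ℕ) {M : Type*} [TopologicalSpace M] [ChartedSpace (Coord (m + 1)) M]
    (Ψ : ℝ → M → M) (S U : Set M) : Prop :=
  ∀ x ∈ S ∩ U, velocity m Ψ x ∉ hypersurfaceTangent S (Ψ 0 x)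

/-- The density `A(q)` in `dv = A dx¹ ∧ … ∧ dx^{m+1}` for the coordinates `e`. -/
def density [IsManifold (𝓡 (m + 1)) ∞ M] (dv : VolumeForm m M)
    (e : OpenPartialHomeomorph M (Coord (m + 1))) (q : M) : ℝ :=
  dv.form (e.symm (e q)) (fun i =>
    mfderiv 𝓘(ℝ, Coord (m + 1)) (𝓡 (m + 1)) e.symm (e q)
      (EuclideanSpace.single i (1 : ℝ) : Coord (m + 1)))

/-- `e = (x¹, …, x^{m+1})` is a system of translation-isometric coordinates on the neighbourhood
`V = e.source` of `p₀`, for translations `Ψ_a`, `|a| < δ`, on `U` and the hypersurface `S`. -/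
structure IsTranslationIsometricCoords [IsManifold (𝓡 (m + 1)) ∞ M] (dv : VolumeForm m M)
    (p₀ : M) (U : Set M) (δ : ℝ) (Ψ : ℝ → M → M) (S : Set M) (e : OpenPartialHomeomorph M (Coord (m + 1))) : Prop where
  mem_atlas : e ∈ IsManifold.maximalAtlas (𝓡 (m + 1)) ∞ M
  mem : p₀ ∈ e.source
  subset : e.source ⊆ U
  surface : ∀ q ∈ e.source, (q ∈ S ↔ e q (Fin.last m) = 0)
  origin : e p₀ = 0
  coord_castSucc : ∀ q ∈ e.source, ∀ a ∈ Set.Ioo (-δ) δ, Ψ a q ∈ e.source →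
    ∀ j : Fin m, e (Ψ a q) j.castSucc = e q j.castSucc
  coord_last : ∀ q ∈ e.source, ∀ a ∈ Set.Ioo (-δ) δ, Ψ a q ∈ e.source →
    e (Ψ a q) (Fin.last m) = e q (Fin.last m) + a
  density_eq : ∀ q ∈ e.source, ∀ a ∈ Set.Ioo (-δ) δ, Ψ a q ∈ e.source →
    density dv e (Ψ a q) = density dv e q

/-- The point `(x¹, …, x^m, t)` of `ℝ^{m+1}`. -/
def append {m : ℕ} (x : Coord m) (t : ℝ) : Coord (m + 1) :=
  WithLp.toLp 2 (Fin.snoc (α := fun _ => ℝ) x.ofLp t)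

/-- The projection `(x¹, …, x^{m+1}) ↦ (x¹, …, x^m)`. -/
def proj {m : ℕ} (z : Coord (m + 1)) : Coord m :=
  WithLp.toLp 2 (fun j : Fin m => z j.castSucc)

/-- The part `{x^{m+1} = 0}` of the coordinate domain, i.e. `S ∩ V` in the coordinates
`x¹, …, x^m`. -/
def baseDomain (e : OpenPartialHomeomorph M (Coord (m + 1))) : Set (Coord m) :=
  {x | append x 0 ∈ e.target}

/-- The point of `M` with coordinates `(x, u x)`. -/
def graphPoint (e : OpenPartialHomeomorph M (Coord (m + 1))) (u : Coord m → ℝ) (x : Coord m) : M :=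
  e.symm (append x (u x))

/-- The defining function `u(x¹, …, x^m) - x^{m+1}` of the graph of `u`. -/
def graphFn (e : OpenPartialHomeomorph M (Coord (m + 1))) (u : Coord m → ℝ) (q : M) : ℝ :=
  u (proj (e q)) - e q (Fin.last m)

/-- `u : S ∩ V → ℝ` is smooth and its graph lies in `V`. -/
def IsGraph (e : OpenPartialHomeomorph M (Coord (m + 1))) (u : Coord m → ℝ) : Prop :=
  ContDiffOn ℝ ∞ u (baseDomain e) ∧ ∀ x ∈ baseDomain e, append x (u x) ∈ e.target

/-- The graph of `u` has no singular points: `|d(u - x^{m+1})|_* ≠ 0` along the graph. -/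
def IsNonsingularGraph (g : CoMetric m M) (e : OpenPartialHomeomorph M (Coord (m + 1)))
    (u : Coord m → ℝ) : Prop :=
  ∀ x ∈ baseDomain e, g.norm (graphPoint e u x) (dAt m (graphFn e u) (graphPoint e u x)) ≠ 0

/-- `H_p(u)(x) = H_{φ,p}(x, u x)` with `φ = u - x^{m+1}`. -/
def graphCurv [IsManifold (𝓡 (m + 1)) ∞ M] (g : CoMetric m M) (dv : VolumeForm m M)
    (e : OpenPartialHomeomorph M (Coord (m + 1))) (p : ℝ) (u : Coord m → ℝ) (x : Coord m) : ℝ :=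
  meanCurv g dv (graphFn e u) p (graphPoint e u x)

end Translations

section Rank

variable {m : ℕ} {M : Type*} [TopologicalSpace M] [ChartedSpace (Coord (m + 1)) M]

/-- Membership in `£(X₁, …, X_k)` over the open set `W`: the smallest `C^∞(W)`-module of vector
fields that contains `X₁, …, X_k` and is closed under the Lie bracket. (Only the values on `W`
matter.) -/
inductive LieSpan (W : Set M) {k : ℕ} (X : Fin k → ∀ x : M, Tan m x) :
    (∀ x : M, Tan m x) → Prop
  | gen (i : Fin k) : LieSpan W X (X i)
  | zero : LieSpan W X (fun _ => 0)
  | add (Y Z : ∀ x : M, Tan m x) : LieSpan W X Y → LieSpan W X Z →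
      LieSpan W X (fun x => Y x + Z x)
  | smul (f : M → ℝ) (Z : ∀ x : M, Tan m x) : SmoothFnOn m f W → LieSpan W X Z →
      LieSpan W X (fun x => f x • Z x)
  | bracket (Y Z : ∀ x : M, Tan m x) : LieSpan W X Y → LieSpan W X Z →
      LieSpan W X (VectorField.mlieBracket (𝓡 (m + 1)) Y Z)

/-- The rank of `£(X₁, …, X_k)` at `x`. -/
def lieRank (W : Set M) {k : ℕ} (X : Fin k → ∀ x : M, Tan m x) (x : M) : ℕ :=
  Module.finrank ℝ (Submodule.span ℝ {w : Tan m x | ∃ Z, LieSpan W X Z ∧ Z x = w})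

/-- The degree of degeneracy is constant, equal to `l`, near `p₀`: `dim ξ = m + 1 - l`. -/
def HasDegeneracy (g : CoMetric m M) (p₀ : M) (l : ℕ) : Prop :=
  ∀ᶠ x in 𝓝 p₀, Module.finrank ℝ (g.horizontal x) + l = m + 1

/-- The rank condition near `p₀`: any `m - l` smooth local sections of `ξ` that are independent
wherever defined generate, under the Lie bracket, a space of dimension at least `m` at each point. -/
def RankCondition [IsManifold (𝓡 (m + 1)) ∞ M] (g : CoMetric m M) (p₀ : M) (l : ℕ) : Prop :=
  ∃ O : Set M, IsOpen O ∧ p₀ ∈ O ∧ ∀ W ⊆ O, IsOpen W →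
    ∀ X : Fin (m - l) → ∀ x : M, Tan m x,
      (∀ i, SmoothFieldOn (X i) W) → (∀ i, ∀ x ∈ W, X i x ∈ g.horizontal x) →
      (∀ x ∈ W, LinearIndependent ℝ (fun i => X i x)) →
      ∀ x ∈ W, m ≤ lieRank W X x

end Rank

end SubRiem

end

/-! The proof is Bony's strong maximum principle for a degenerate elliptic operator. In
translation-isometric coordinates the metric `G` and the density `A` do not depend on the last
coordinate near the origin. With `φ = u - x^{m+1}` the curvature is the weighted divergence `A⁻¹ div
(A |dφ|^{p-1} G dφ)`, which is then constant along vertical segments. Hence the curvatures of the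
two graphs, given at different points of a vertical line, can be compared at one and the same point
of `ℝ^{m+1}` (`eventually_graphCurv_proj`).

Subtracting the two divergences shows that `w = v - u ≥ 0`, viewed as a function on `ℝ^{m+1}`,
satisfies `tr (T D²w) ≤ C ‖dw‖` near the origin (`exists_linearized_inequality`). With `θ = d(v -
x^{m+1})`, the quadratic form of `T` is `|θ|^{p-1} (⟨η,η⟩ + (p-1)⟨θ,η⟩²/|θ|²)`. It is nonnegative
for `p ≥ 0`, and its null covectors annihilate every horizontal vector tangent to the level sets of
`v - x^{m+1}`.

A Hopf barrier shows that every exterior normal to the zero set `F` of `w` is null for `T`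
(`normal_characteristic`). So `F` is tangent to those horizontal fields, hence also to their
iterated brackets (`IsTangentOn.lieBracket`). By the rank condition they span at least `m`
dimensions, all inside the kernel of `d(v - x^{m+1})`. The vertical direction is outside this kernel
and `F` is tangent to it too, because `w` does not depend on `x^{m+1}`. Thus `F` has no nonzero
exterior normal near the origin, so it is a neighbourhood of the origin. -/

/-! ### Fields tangent to a closed set, and their Lie brackets. -/

section Tangency

open Set Filter Asymptotics

variable {E : Type*} [NormedAddCommGroup E] [InnerProductSpace ℝ E]

/-- A vector field `X` is tangent to `F` in `O`, in the sense of Bony: it is orthogonal to the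
exterior normals of `F`, that is to `c - y` whenever `y` is a point of `F` closest to `c`. -/
def IsTangentOn (F O : Set E) (X : E → E) : Prop :=
  ∀ y ∈ F ∩ O, ∀ c, (∀ z ∈ F, ‖c - y‖ ≤ ‖c - z‖) → inner ℝ (X y) (c - y) = 0

lemma IsTangentOn.neg {F O : Set E} {X : E → E} (h : IsTangentOn F O X) :
    IsTangentOn F O (fun x => -X x) := by
  intro y hy c hc
  rw [inner_neg_left, h y hy c hc, neg_zero]

/-- Gronwall's inequality for the squared distance to `F`. That function need not be differentiable,
but freezing a nearest point `y` of `γ s` gives the smooth majorant `‖γ t - y‖²`, which agrees with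
it at `t = s`; this bounds the lower right Dini derivative. -/
lemma infDist_sq_le_of_inner_deriv_le [ProperSpace E] {F : Set E} (hF : IsClosed F) {γ γ' : ℝ → E}
    {T ε L : ℝ} (hL : 0 ≤ L) (h0 : γ 0 ∈ F) (hγ : ∀ s, HasDerivAt γ (γ' s) s)
    (hin : ∀ s ∈ Ico 0 T, ∀ y ∈ F, Metric.infDist (γ s) F = dist (γ s) y →
      inner ℝ (γ' s) (γ s - y) ≤ (ε + L * ‖γ s - y‖) * ‖γ s - y‖) :
    ∀ t ∈ Icc 0 T, Metric.infDist (γ t) F ^ 2 ≤ ε ^ 2 * t * Real.exp ((1 + 2 * L) * t) := by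
  have hne : F.Nonempty := ⟨_, h0⟩
  choose P hPF hP using fun x => hF.exists_infDist_eq_dist hne x
  have hcont : Continuous γ := continuous_iff_continuousAt.2 fun s => (hγ s).continuousAt
  have key := le_gronwallBound_of_liminf_deriv_right_le (f := fun s => Metric.infDist (γ s) F ^ 2)
    (f' := fun s => 2 * inner ℝ (γ' s) (γ s - P (γ s))) (δ := 0) (K := 1 + 2 * L) (ε := ε ^ 2)
    (a := 0) (b := T)
    (((Metric.continuous_infDist_pt F).comp hcont).pow 2).continuousOn
    (by
      intro s hs r hr
      set y := P (γ s) with hy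
      have hd : HasDerivAt (fun t => ‖γ t - y‖ ^ 2) (2 * inner ℝ (γ' s) (γ s - y)) s := by
        have := ((hγ s).sub_const y).norm_sq
        rwa [real_inner_comm] at this
      have h1 := (hasDerivAt_iff_tendsto_slope.1 hd).mono_left
        (nhdsWithin_mono s (fun z (hz : s < z) => ne_of_gt hz))
      have h2 := h1.eventually (gt_mem_nhds hr)
      refine Eventually.frequently ?_
      filter_upwards [h2, self_mem_nhdsWithin] with z hz hsz
      refine lt_of_le_of_lt ?_ hz
      rw [slope_def_field, div_eq_inv_mul]
      have hpos : 0 < z - s := sub_pos.2 hsz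
      refine mul_le_mul_of_nonneg_left ?_ (inv_nonneg.2 hpos.le)
      have e1 : Metric.infDist (γ s) F = ‖γ s - y‖ := by rw [hP (γ s), dist_eq_norm]
      have e2 : Metric.infDist (γ z) F ≤ ‖γ z - y‖ := by
        rw [← dist_eq_norm]; exact Metric.infDist_le_dist_of_mem (hPF _)
      rw [e1]
      have := pow_le_pow_left₀ Metric.infDist_nonneg e2 2
      linarith)
    (by simp [Metric.infDist_zero_of_mem h0])
    (by
      intro s hs
      have h1 := hin s hs (P (γ s)) (hPF _) (hP _)
      rw [hP (γ s), dist_eq_norm]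
      -- With `d` the distance, `2(ε + L d) d ≤ ε² + (1 + 2L) d²`.
      nlinarith [sq_nonneg (ε - ‖γ s - P (γ s)‖)])
  intro t ht
  refine (key t ht).trans ?_
  have hK : (0:ℝ) < 1 + 2 * L := by linarith
  simp only [gronwallBound_of_K_ne_0 hK.ne', sub_zero, zero_mul, zero_add]
  set x := (1 + 2 * L) * t with hx
  -- This extracts the factor `t` that turns an error `ε = O(t²)` into a squared distance `O(t⁵)`.
  have h1 : Real.exp x - 1 ≤ x * Real.exp x := by
    have := Real.add_one_le_exp (-x)
    have h2 : Real.exp (-x) * Real.exp x = 1 := by rw [← Real.exp_add]; simp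
    nlinarith [Real.exp_pos x]
  calc ε ^ 2 / (1 + 2 * L) * (Real.exp x - 1) ≤ ε ^ 2 / (1 + 2 * L) * (x * Real.exp x) := by gcongr
    _ = ε ^ 2 * t * Real.exp x := by rw [hx]; field_simp

set_option maxHeartbeats 1000000 in
/-- The second order Taylor step along a field tangent to `F` leads back to `F` up to an error
`O(t^{5/2})`. -/
lemma IsTangentOn.exists_near_taylor_step [ProperSpace E] {F O : Set E} (hF : IsClosed F)
    (hO : IsOpen O) {X : E → E} (hX : ContDiffOn ℝ ∞ X O) (hT : IsTangentOn F O X) {y : E}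
    (hy : y ∈ O) :
    ∃ C > 0, ∃ t₀ > 0, ∃ r > 0, ∀ z ∈ F ∩ Metric.ball y r, ∀ t ∈ Ioo 0 t₀, ∃ z' ∈ F,
      ‖z' - (z + t • X z + (t ^ 2 / 2) • fderiv ℝ X z (X z))‖ ^ 2 ≤ C * t ^ 5 := by
  have hXy : ContDiffAt ℝ ∞ X y := hX.contDiffAt (hO.mem_nhds hy)
  obtain ⟨L, s1, hs1, hL⟩ := (hXy.of_le (m := 1) (by simp)).exists_lipschitzOnWith
  obtain ⟨L', s2, hs2, hL'⟩ :=
    (hXy.fderiv_right (m := 1) (by norm_cast)).exists_lipschitzOnWith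
  obtain ⟨r', hr', hball⟩ := Metric.mem_nhds_iff.1 (inter_mem (inter_mem hs1 hs2) (hO.mem_nhds hy))
  -- One third for the distance of `z` to `y`, one for that of the curve to `z`, and one for that of
  -- a nearest point of `F` to the curve.
  set r := r' / 3 with hr
  have hrpos : 0 < r := by positivity
  have hB1 : ∀ a ∈ Metric.ball y r', ∀ b ∈ Metric.ball y r', ‖X a - X b‖ ≤ L * ‖a - b‖ := by
    intro a ha b hb
    exact hL.norm_sub_le (hball ha).1.1 (hball hb).1.1
  have hB2 : ∀ a ∈ Metric.ball y r', ∀ b ∈ Metric.ball y r',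
      ‖fderiv ℝ X a - fderiv ℝ X b‖ ≤ L' * ‖a - b‖ := by
    intro a ha b hb
    exact hL'.norm_sub_le (hball ha).1.2 (hball hb).1.2
  have hyb : y ∈ Metric.ball y r' := Metric.mem_ball_self hr'
  set M : ℝ := ‖X y‖ + L * r' + ‖fderiv ℝ X y‖ + L' * r' with hM
  have hM0 : 0 ≤ M := by positivity
  have hMX : ∀ a ∈ Metric.ball y r', ‖X a‖ ≤ M := by
    intro a ha
    have h1 := hB1 a ha y hyb
    have h2 : ‖a - y‖ ≤ r' := by rw [← dist_eq_norm]; exact (Metric.mem_ball.1 ha).le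
    have h3 : ‖X a‖ ≤ ‖X a - X y‖ + ‖X y‖ := by simpa using norm_add_le (X a - X y) (X y)
    have h4 : (L:ℝ) * ‖a - y‖ ≤ L * r' := by gcongr
    have : 0 ≤ ‖fderiv ℝ X y‖ + L' * r' := by positivity
    linarith
  have hMX' : ∀ a ∈ Metric.ball y r', ‖fderiv ℝ X a‖ ≤ M := by
    intro a ha
    have h1 := hB2 a ha y hyb
    have h2 : ‖a - y‖ ≤ r' := by rw [← dist_eq_norm]; exact (Metric.mem_ball.1 ha).le
    have h3 : ‖fderiv ℝ X a‖ ≤ ‖fderiv ℝ X a - fderiv ℝ X y‖ + ‖fderiv ℝ X y‖ := by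
      simpa using norm_add_le (fderiv ℝ X a - fderiv ℝ X y) (fderiv ℝ X y)
    have h4 : (L':ℝ) * ‖a - y‖ ≤ L' * r' := by gcongr
    have : 0 ≤ ‖X y‖ + L * r' := by positivity
    linarith
  set N : ℝ := M + M * M with hN
  have hN0 : 0 ≤ N := by positivity
  set c : ℝ := L' * N ^ 2 + M * (M * M) with hc
  have hc0 : 0 ≤ c := by positivity
  clear_value r M
  clear_value N
  clear_value c
  obtain ⟨κ, hκ⟩ : ∃ κ : ℝ, Real.exp (1 + 2 * (L : ℝ)) = κ := ⟨_, rfl⟩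
  have hκ0 : 0 < κ := hκ ▸ Real.exp_pos _
  refine ⟨c ^ 2 * κ + 1, by positivity, min 1 (r / (N + 1)), by positivity,
    r, hrpos, ?_⟩
  rintro z ⟨hzF, hzr⟩ t ⟨ht0, ht⟩
  have ht1 : t < 1 := ht.trans_le (min_le_left _ _)
  have htr : t * (N + 1) < r := by
    have := ht.trans_le (min_le_right _ _)
    rwa [lt_div_iff₀ (by positivity)] at this
  have hzr' : z ∈ Metric.ball y r' := Metric.ball_subset_ball (by linarith) hzr
  set D := fderiv ℝ X z (X z) with hD
  have hDn : ‖D‖ ≤ M * M :=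
    (ContinuousLinearMap.le_opNorm _ _).trans
      (mul_le_mul (hMX' z hzr') (hMX z hzr') (norm_nonneg _) hM0)
  -- The Taylor polynomial replaces the integral curve of `X`: it solves `γ' = X γ` up to `O(t²)`,
  -- so no flow is needed.
  set γ : ℝ → E := fun s => z + s • X z + (s ^ 2 / 2) • D with hγ
  set γ' : ℝ → E := fun s => X z + s • D with hγ'
  have hder : ∀ s, HasDerivAt γ (γ' s) s := by
    intro s
    have h1 := (((hasDerivAt_id s).smul_const (X z)).const_add z).add
      ((((hasDerivAt_id s).pow 2).div_const 2).smul_const D)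
    refine h1.congr_deriv ?_
    simp [hγ']
  have hγz : ∀ s ∈ Icc 0 t, ‖γ s - z‖ ≤ s * N := by
    intro s hs
    have : γ s - z = s • X z + (s ^ 2 / 2) • D := by simp only [hγ]; abel
    rw [this]
    have hs2 : s ^ 2 / 2 ≤ s := by nlinarith [hs.1, hs.2]
    calc _ ≤ ‖s • X z‖ + ‖(s ^ 2 / 2) • D‖ := norm_add_le _ _
      _ = s * ‖X z‖ + (s ^ 2 / 2) * ‖D‖ := by
        rw [norm_smul, norm_smul, Real.norm_of_nonneg hs.1, Real.norm_of_nonneg (by positivity)]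
      _ ≤ s * M + s * (M * M) := by
        have := hMX z hzr'
        have := hs.1
        gcongr
      _ = s * N := by rw [hN]; ring
  have hγb : ∀ s ∈ Icc 0 t, ‖γ s - z‖ < r := by
    intro s hs
    refine (hγz s hs).trans_lt (lt_of_le_of_lt ?_ htr)
    exact mul_le_mul hs.2 (by linarith) hN0 ht0.le
  have hγin : ∀ s ∈ Icc 0 t, γ s ∈ Metric.ball y r' := by
    intro s hs
    rw [Metric.mem_ball]
    have := dist_triangle (γ s) z y
    rw [dist_eq_norm (γ s) z] at this
    have := hγb s hs
    have := Metric.mem_ball.1 hzr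
    linarith
  have herr : ∀ s ∈ Icc 0 t, ‖γ' s - X (γ s)‖ ≤ c * t ^ 2 := by
    intro s hs
    have hsub : Metric.closedBall z ‖γ s - z‖ ⊆ Metric.ball y r' := by
      intro a ha
      rw [Metric.mem_ball]
      have := dist_triangle a z y
      have := hγb s hs
      have := Metric.mem_ball.1 hzr
      have := Metric.mem_closedBall.1 ha
      linarith
    have hTay := Convex.norm_image_sub_le_of_norm_fderiv_le' (𝕜 := ℝ) (f := X)
      (φ := fderiv ℝ X z) (C := L' * ‖γ s - z‖) (s := Metric.closedBall z ‖γ s - z‖)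
      (x := z) (y := γ s)
      (fun a ha => (hX.contDiffAt (hO.mem_nhds (hball (hsub ha)).2)).differentiableAt (by simp))
      (fun a ha => (hB2 a (hsub ha) z hzr').trans (by
        have := Metric.mem_closedBall.1 ha
        rw [dist_eq_norm] at this
        gcongr))
      (convex_closedBall _ _) (Metric.mem_closedBall_self (norm_nonneg _))
      (by rw [Metric.mem_closedBall, dist_eq_norm])
    have hst : s ^ 2 ≤ t ^ 2 := pow_le_pow_left₀ hs.1 hs.2 2
    have h1 : γ' s - X (γ s) = -(X (γ s) - X z - fderiv ℝ X z (γ s - z))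
        - (s ^ 2 / 2) • fderiv ℝ X z D := by
      have : γ s - z = s • X z + (s ^ 2 / 2) • D := by simp only [hγ]; abel
      rw [this, map_add, map_smul, map_smul, ← hD]
      simp only [hγ']
      abel
    have h2 : ‖fderiv ℝ X z D‖ ≤ M * (M * M) :=
      (ContinuousLinearMap.le_opNorm _ _).trans
        (mul_le_mul (hMX' z hzr') hDn (norm_nonneg _) hM0)
    have h3 : L' * ‖γ s - z‖ * ‖γ s - z‖ ≤ L' * N ^ 2 * t ^ 2 := by
      have h4 : ‖γ s - z‖ ≤ N * t := by
        refine (hγz s hs).trans ?_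
        rw [mul_comm]
        exact mul_le_mul_of_nonneg_left hs.2 hN0
      calc L' * ‖γ s - z‖ * ‖γ s - z‖ ≤ L' * (N * t) * (N * t) := by gcongr
        _ = _ := by ring
    calc ‖γ' s - X (γ s)‖ ≤ ‖X (γ s) - X z - fderiv ℝ X z (γ s - z)‖
          + ‖(s ^ 2 / 2) • fderiv ℝ X z D‖ := by
          rw [h1]; exact (norm_sub_le _ _).trans (by rw [norm_neg])
      _ ≤ L' * N ^ 2 * t ^ 2 + t ^ 2 * (M * (M * M)) := by
          refine add_le_add (hTay.trans h3) ?_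
          rw [norm_smul, Real.norm_of_nonneg (by positivity)]
          have : s ^ 2 / 2 ≤ t ^ 2 := by linarith [sq_nonneg s]
          gcongr
      _ = c * t ^ 2 := by rw [hc]; ring
  have hfin := infDist_sq_le_of_inner_deriv_le hF (γ := γ) (γ' := γ') (T := t) (ε := c * t ^ 2)
    (L := L) L.2 (by simpa [hγ] using hzF) hder (by
      intro s hs a haF ha
      have hs' : s ∈ Icc 0 t := ⟨hs.1, hs.2.le⟩
      have hda : ‖γ s - a‖ ≤ ‖γ s - z‖ := by
        rw [← dist_eq_norm, ← ha, ← dist_eq_norm]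
        exact Metric.infDist_le_dist_of_mem hzF
      have haB : a ∈ Metric.ball y r' := by
        rw [Metric.mem_ball]
        have h1 := dist_triangle a (γ s) y
        have h2 := dist_triangle (γ s) z y
        rw [dist_comm a (γ s), dist_eq_norm (γ s) a] at h1
        rw [dist_eq_norm (γ s) z] at h2
        have := hγb s hs'
        have := Metric.mem_ball.1 hzr
        linarith
      -- Tangency at the nearest point `a` removes `X a`; what remains of `γ' s` is the Taylor error
      -- and the Lipschitz difference `X (γ s) - X a`.
      have h0 := hT a ⟨haF, (hball haB).2⟩ (γ s) (fun b hb => by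
        rw [← dist_eq_norm, ← ha, ← dist_eq_norm]
        exact Metric.infDist_le_dist_of_mem hb)
      have h1 : γ' s = (γ' s - X (γ s)) + (X (γ s) - X a) + X a := by abel
      rw [h1, inner_add_left, h0, add_zero]
      refine (real_inner_le_norm _ _).trans ?_
      refine mul_le_mul_of_nonneg_right ?_ (norm_nonneg _)
      exact (norm_add_le _ _).trans (add_le_add (herr s hs') (hB1 _ (hγin s hs') _ haB)))
    t ⟨ht0.le, le_rfl⟩
  obtain ⟨z', hz'F, hz'⟩ := hF.exists_infDist_eq_dist ⟨z, hzF⟩ (γ t)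
  refine ⟨z', hz'F, ?_⟩
  have e1 : ‖z' - (z + t • X z + (t ^ 2 / 2) • D)‖ = Metric.infDist (γ t) F := by
    rw [hz', dist_comm, dist_eq_norm]
  rw [e1]
  refine hfin.trans ?_
  have h5 : Real.exp ((1 + 2 * (L : ℝ)) * t) ≤ κ := by
    rw [← hκ]
    apply Real.exp_le_exp.2
    have : (0:ℝ) ≤ 1 + 2 * L := by positivity
    nlinarith
  have h6 : 0 ≤ (c * t ^ 2) ^ 2 * t := by positivity
  refine (mul_le_mul_of_nonneg_left h5 h6).trans ?_
  have h7 : (c * t ^ 2) ^ 2 * t * κ = c ^ 2 * κ * t ^ 5 := by ring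
  have h8 : 0 ≤ t ^ 5 := by positivity
  rw [h7, add_mul, one_mul]
  exact le_add_of_nonneg_right h8

end Tangency

section Tangency

open Set Filter Asymptotics

variable {E : Type*} [NormedAddCommGroup E] [InnerProductSpace ℝ E]

/-- Following `X` for time `t` from a point of `F` composes second order expansions, and the
correction back into `F` is `O(t^{5/2}) = o(t²)`. Hence steps along several tangent fields can be
chained without leaving `F`. The curve is not claimed continuous; only its expansion matters. -/
lemma IsTangentOn.exists_curve_step [ProperSpace E] {F O : Set E} (hF : IsClosed F)
    (hO : IsOpen O) {X : E → E} (hX : ContDiffOn ℝ ∞ X O) (hT : IsTangentOn F O X) {y : E}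
    (hy : y ∈ O) {z : ℝ → E} {a b : E} (hz : ∀ᶠ t in 𝓝[>] (0 : ℝ), z t ∈ F)
    (hexp : (fun t => z t - (y + t • a + t ^ 2 • b)) =o[𝓝[>] 0] fun t : ℝ => t ^ 2) :
    ∃ z' : ℝ → E, (∀ᶠ t in 𝓝[>] (0 : ℝ), z' t ∈ F) ∧
      (fun t => z' t - (y + t • (a + X y) +
        t ^ 2 • (b + fderiv ℝ X y a + (1 / 2 : ℝ) • fderiv ℝ X y (X y))))
        =o[𝓝[>] 0] fun t : ℝ => t ^ 2 := by
  obtain ⟨C, hC, t₀, ht₀, r, hr, hstep⟩ := hT.exists_near_taylor_step hF hO hX hy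
  have hXy : ContDiffAt ℝ ∞ X y := hX.contDiffAt (hO.mem_nhds hy)
  have hXd : HasFDerivAt X (fderiv ℝ X y) y := (hXy.differentiableAt (by simp)).hasFDerivAt
  have hid : Tendsto (fun t : ℝ => t) (𝓝[>] 0) (𝓝 0) := tendsto_id.mono_left nhdsWithin_le_nhds
  have ht2 : (fun t : ℝ => t ^ 2) =o[𝓝[>] 0] fun t : ℝ => t := by
    have h1 : (fun t : ℝ => t) =o[𝓝[>] 0] fun _ : ℝ => (1 : ℝ) := (isLittleO_one_iff ℝ).2 hid
    simpa [pow_two] using h1.mul_isBigO (isBigO_refl (fun t : ℝ => t) (𝓝[>] 0))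
  have hlin : (fun t => z t - y - t • a) =o[𝓝[>] 0] fun t : ℝ => t := by
    have h1 : (fun t : ℝ => t ^ 2 • b) =o[𝓝[>] 0] fun t : ℝ => t := by
      have := (ht2.smul_isBigO (isBigO_refl (fun _ : ℝ => b) (𝓝[>] 0)))
      refine this.trans_isBigO ?_
      refine IsBigO.of_bound ‖b‖ (Eventually.of_forall fun t => ?_)
      rw [norm_smul, mul_comm]
    refine ((hexp.trans ht2).add h1).congr_left fun t => ?_
    abel
  have hbig : (fun t => z t - y) =O[𝓝[>] 0] fun t : ℝ => t := by
    have h1 : (fun t : ℝ => t • a) =O[𝓝[>] 0] fun t : ℝ => t := by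
      refine IsBigO.of_bound ‖a‖ (Eventually.of_forall fun t => ?_)
      rw [norm_smul, mul_comm]
    refine (hlin.isBigO.add h1).congr_left fun t => ?_
    abel
  have hzy : Tendsto z (𝓝[>] 0) (𝓝 y) := by
    have h1 := hbig.trans_tendsto hid
    simpa using h1.add_const y
  have hex : ∀ᶠ t in 𝓝[>] (0 : ℝ), ∃ z' ∈ F,
      ‖z' - (z t + t • X (z t) + (t ^ 2 / 2) • fderiv ℝ X (z t) (X (z t)))‖ ^ 2 ≤ C * t ^ 5 := by
    filter_upwards [hz, hzy.eventually (Metric.ball_mem_nhds y hr), Ioo_mem_nhdsGT ht₀]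
      with t h1 h2 h3
    exact hstep (z t) ⟨h1, h2⟩ t h3
  classical
  let z' : ℝ → E := fun t => if h : ∃ z' ∈ F,
      ‖z' - (z t + t • X (z t) + (t ^ 2 / 2) • fderiv ℝ X (z t) (X (z t)))‖ ^ 2 ≤ C * t ^ 5
    then h.choose else y
  have hz' : ∀ᶠ t in 𝓝[>] (0 : ℝ), z' t ∈ F ∧
      ‖z' t - (z t + t • X (z t) + (t ^ 2 / 2) • fderiv ℝ X (z t) (X (z t)))‖ ^ 2 ≤ C * t ^ 5 := by
    filter_upwards [hex] with t ht
    simp only [z', dif_pos ht]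
    exact ht.choose_spec
  refine ⟨z', hz'.mono fun t ht => ht.1, ?_⟩
  have err1 : (fun t => z' t - (z t + t • X (z t) + (t ^ 2 / 2) • fderiv ℝ X (z t) (X (z t))))
      =o[𝓝[>] 0] fun t : ℝ => t ^ 2 := by
    refine IsLittleO.of_bound fun ε hε => ?_
    filter_upwards [hz', Ioo_mem_nhdsGT (show (0:ℝ) < ε ^ 2 / C by positivity)] with t ht ht'
    have h1 : C * t < ε ^ 2 := by
      have := ht'.2
      rwa [lt_div_iff₀ hC, mul_comm] at this
    refine le_of_sq_le_sq (ht.2.trans ?_) (by positivity)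
    have : 0 ≤ t ^ 4 := by positivity
    rw [Real.norm_of_nonneg (by positivity)]
    nlinarith
  have err2 : (fun t : ℝ => t • (X (z t) - X y - t • fderiv ℝ X y a))
      =o[𝓝[>] 0] fun t : ℝ => t ^ 2 := by
    have h1 : (fun t => X (z t) - X y - fderiv ℝ X y (z t - y)) =o[𝓝[>] 0] fun t : ℝ => t :=
      (hXd.isLittleO.comp_tendsto hzy).trans_isBigO hbig
    have h2 : (fun t => fderiv ℝ X y (z t - y - t • a)) =o[𝓝[>] 0] fun t : ℝ => t :=
      ((fderiv ℝ X y).isBigO_comp _ _).trans_isLittleO hlin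
    have h3 := (isBigO_refl (fun t : ℝ => t) (𝓝[>] 0)).smul_isLittleO (h1.add h2)
    refine (h3.congr_left fun t => ?_).congr_right fun t => by simp [pow_two]
    simp only [map_sub, map_smul]
    congr 1
    abel
  have err3 : (fun t : ℝ => (t ^ 2 / 2) •
      (fderiv ℝ X (z t) (X (z t)) - fderiv ℝ X y (X y))) =o[𝓝[>] 0] fun t : ℝ => t ^ 2 := by
    have hc : ContinuousAt (fun x => fderiv ℝ X x (X x)) y :=
      ((hXy.fderiv_right (m := 1) (by norm_cast)).continuousAt).clm_apply hXy.continuousAt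
    have h1 : Tendsto (fun t => fderiv ℝ X (z t) (X (z t)) - fderiv ℝ X y (X y)) (𝓝[>] 0)
        (𝓝 0) := by
      have h := (hc.tendsto.comp hzy).sub_const (fderiv ℝ X y (X y))
      rw [sub_self] at h
      exact h
    have h2 := (isLittleO_one_iff ℝ).2 h1
    have h3 : (fun t : ℝ => t ^ 2 / 2) =O[𝓝[>] 0] fun t : ℝ => t ^ 2 := by
      simp_rw [div_eq_inv_mul]
      exact isBigO_const_mul_self _ _ _
    simpa using h3.smul_isLittleO h2
  refine (((err1.add hexp).add err2).add err3).congr_left fun t => ?_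
  simp only [smul_add, smul_sub, smul_smul]
  have e1 : t ^ 2 * (1 / 2) = t ^ 2 / 2 := by ring
  have e2 : t * t = t ^ 2 := by ring
  rw [e1, e2]
  abel

/-- The fields tangent to a closed set are closed under the Lie bracket. -/
lemma IsTangentOn.lieBracket [ProperSpace E] {F O : Set E} (hF : IsClosed F)
    (hO : IsOpen O) {X Y : E → E} (hX : ContDiffOn ℝ ∞ X O) (hY : ContDiffOn ℝ ∞ Y O)
    (hTX : IsTangentOn F O X) (hTY : IsTangentOn F O Y) :
    IsTangentOn F O (VectorField.lieBracket ℝ X Y) := by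
  have key : ∀ {X Y : E → E}, ContDiffOn ℝ ∞ X O → ContDiffOn ℝ ∞ Y O → IsTangentOn F O X →
      IsTangentOn F O Y → ∀ y ∈ F ∩ O, ∀ c, (∀ z ∈ F, ‖c - y‖ ≤ ‖c - z‖) →
      inner ℝ (VectorField.lieBracket ℝ X Y y) (c - y) ≤ 0 := by
    intro X Y hX hY hTX hTY y hy c hc
    have hz0 : ∀ᶠ t in 𝓝[>] (0 : ℝ), (fun _ : ℝ => y) t ∈ F := Eventually.of_forall fun _ => hy.1
    obtain ⟨z1, hz1, e1⟩ := hTX.exists_curve_step hF hO hX hy.2 (a := 0) (b := 0) hz0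
      (by simp)
    obtain ⟨z2, hz2, e2⟩ := hTY.exists_curve_step hF hO hY hy.2 hz1 e1
    obtain ⟨z3, hz3, e3⟩ := hTX.neg.exists_curve_step hF hO hX.neg hy.2 hz2 e2
    obtain ⟨z4, hz4, e4⟩ := hTY.neg.exists_curve_step hF hO hY.neg hy.2 hz3 e3
    have fX : fderiv ℝ (fun x => -X x) y = -fderiv ℝ X y := fderiv_neg
    have fY : fderiv ℝ (fun x => -Y x) y = -fderiv ℝ Y y := fderiv_neg
    set B := VectorField.lieBracket ℝ X Y y with hB
    -- The steps along `X`, `Y`, `-X`, `-Y` cancel to first order and leave `t² (DY X - DX Y)`.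
    have e5 : (fun t => (z4 t - y) - t ^ 2 • B) =o[𝓝[>] 0] fun t : ℝ => t ^ 2 := by
      refine e4.congr_left fun t => ?_
      have ha : (0 + X y + Y y + -X y + -Y y) = 0 := by abel
      rw [ha, smul_zero, add_zero, sub_sub]
      congr 3
      rw [hB, VectorField.lieBracket_eq]
      simp only [fX, fY, map_add, map_neg, map_zero, zero_add, add_zero,
        neg_neg, neg_apply]
      module
    have e6 : Tendsto (fun t : ℝ => (t ^ 2)⁻¹ • (z4 t - y)) (𝓝[>] 0) (𝓝 B) := by
      have h1 := e5.tendsto_inv_smul_nhds_zero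
      · have h2 := h1.add_const B
        rw [zero_add] at h2
        refine h2.congr' ?_
        filter_upwards [self_mem_nhdsWithin] with t ht
        have : t ^ 2 ≠ 0 := pow_ne_zero _ (ne_of_gt ht)
        rw [smul_sub, smul_smul, inv_mul_cancel₀ this, one_smul, sub_add_cancel]
    have e7 : Tendsto (fun t : ℝ => t ^ 2 * ‖(t ^ 2)⁻¹ • (z4 t - y)‖ ^ 2) (𝓝[>] 0) (𝓝 0) := by
      have h1 : Tendsto (fun t : ℝ => t ^ 2) (𝓝[>] 0) (𝓝 0) := by
        have := ((continuous_pow (M := ℝ) 2).tendsto 0).mono_left (nhdsWithin_le_nhds (s := Ioi 0))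
        simpa using this
      simpa using h1.mul (e6.norm.pow 2)
    have e8 : Tendsto (fun t : ℝ => 2 * inner ℝ ((t ^ 2)⁻¹ • (z4 t - y)) (c - y)) (𝓝[>] 0)
        (𝓝 (2 * inner ℝ B (c - y))) :=
      (e6.inner tendsto_const_nhds).const_mul 2
    -- Since `y` is nearest to `c`, expanding `‖c - y‖² ≤ ‖c - z4 t‖²` gives `2⟨z4 t - y, c - y⟩ ≤
    -- ‖z4 t - y‖²`; divide by `t²`.
    have := le_of_tendsto_of_tendsto e8 e7 (by
      filter_upwards [hz4, self_mem_nhdsWithin] with t ht ht0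
      have ht2 : 0 < t ^ 2 := pow_pos ht0 2
      have h1 := pow_le_pow_left₀ (norm_nonneg _) (hc _ ht) 2
      have h2 : c - z4 t = (c - y) - (z4 t - y) := by abel
      rw [h2, norm_sub_sq_real (c - y) (z4 t - y), real_inner_comm] at h1
      rw [norm_smul, real_inner_smul_left, mul_pow, norm_inv, Real.norm_of_nonneg ht2.le]
      have h3 : t ^ 2 * ((t ^ 2)⁻¹ ^ 2 * ‖z4 t - y‖ ^ 2) = (t ^ 2)⁻¹ * ‖z4 t - y‖ ^ 2 := by
        field_simp
      rw [h3, mul_left_comm]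
      exact mul_le_mul_of_nonneg_left (by linarith) (inv_nonneg.2 ht2.le))
    linarith
  intro y hy c hc
  refine le_antisymm (key hX hY hTX hTY y hy c hc) ?_
  -- Exchanging the fields changes the sign of the bracket and gives the opposite inequality.
  have h := key hY hX hTY hTX y hy c hc
  rw [VectorField.lieBracket_swap, inner_neg_left] at h
  linarith

end Tangency

/-! ### A Hopf barrier for degenerate elliptic inequalities. -/

section Hopf

open Set Filter

variable {E : Type*} [NormedAddCommGroup E] [InnerProductSpace ℝ E]

/-- The covector `⟨x, ·⟩`. -/
noncomputable def innerCovec : E →L[ℝ] E →L[ℝ] ℝ :=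
  LinearMap.mkContinuous₂ (innerₗ E) 1 (fun x y => by
    simpa using norm_inner_le_norm (𝕜 := ℝ) x y)

@[simp] lemma innerCovec_apply (x y : E) : innerCovec x y = inner ℝ x y := rfl

lemma norm_innerCovec_le (x : E) : ‖innerCovec x‖ ≤ ‖x‖ :=
  ContinuousLinearMap.opNorm_le_bound _ (norm_nonneg _) fun y => norm_inner_le_norm (𝕜 := ℝ) x y

/-- In an orthonormal eigenbasis of the symmetric form `S` the trace is a sum of eigenvalues of `S`
times values of the quadratic form of `T`. Symmetry of `T` plays no role. -/
lemma trace_comp_nonneg [FiniteDimensional ℝ E] (T : (E →L[ℝ] ℝ) →L[ℝ] E)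
    (hT : ∀ η : E →L[ℝ] ℝ, 0 ≤ η (T η)) (S : E →L[ℝ] E →L[ℝ] ℝ)
    (hsymm : ∀ x y, S x y = S y x) (hS : ∀ x, 0 ≤ S x x) :
    0 ≤ LinearMap.trace ℝ E (T ∘L S : E →L[ℝ] E) := by
  let S' : E →ₗ[ℝ] E :=
    { toFun := fun x => (InnerProductSpace.toDual ℝ E).symm (S x)
      map_add' := by intro x y; simp
      map_smul' := by intro c x; simp }
  have hS' : ∀ x y, inner ℝ (S' x) y = S x y := fun x y => InnerProductSpace.toDual_symm_apply
  have hs : S'.IsSymmetric := by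
    intro x y
    rw [hS', real_inner_comm, hS', hsymm]
  let b := hs.eigenvectorBasis rfl
  have hb : ∀ i, S (b i) = hs.eigenvalues rfl i • innerCovec (b i) := by
    intro i
    ext y
    rw [← hS', hs.apply_eigenvectorBasis]
    simp [b, inner_smul_left]
  have hev : ∀ i, 0 ≤ hs.eigenvalues rfl i := by
    intro i
    have h1 := hS (b i)
    rw [hb] at h1
    simpa using h1
  rw [LinearMap.trace_eq_sum_inner _ b]
  refine Finset.sum_nonneg fun i _ => ?_
  have : inner ℝ (b i) ((T ∘L S : E →L[ℝ] E) (b i)) =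
      hs.eigenvalues rfl i * innerCovec (b i) (T (innerCovec (b i))) := by
    rw [ContinuousLinearMap.comp_apply, hb, map_smul, inner_smul_right]
    rfl
  exact this ▸ mul_nonneg (hev i) (hT _)

/-- A negative second derivative along a line would make the point also a local maximum there, hence
the restriction locally constant and its second derivative zero. -/
lemma IsLocalMin.fderiv_fderiv_apply_nonneg {E : Type*} [NormedAddCommGroup E] [NormedSpace ℝ E]
    {f : E → ℝ} {x : E} (h : IsLocalMin f x) (hf : ContDiffAt ℝ 2 f x) (η : E) :
    0 ≤ fderiv ℝ (fderiv ℝ f) x η η := by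
  by_contra hneg
  push Not at hneg
  let φ : ℝ → ℝ := fun t => f (x + t • η)
  have hline : ∀ t : ℝ, HasDerivAt (fun t : ℝ => x + t • η) η t := by
    intro t
    simpa using ((hasDerivAt_id t).smul_const η).const_add x
  have hl0 : Tendsto (fun t : ℝ => x + t • η) (𝓝 0) (𝓝 x) := by
    have := (hline 0).continuousAt.tendsto
    simpa using this
  have hev : ∀ᶠ t in 𝓝 (0 : ℝ), deriv φ t = fderiv ℝ f (x + t • η) η := by
    have h1 := hf.eventually (by simp)
    filter_upwards [hl0.eventually h1] with t ht
    exact ((ht.differentiableAt (by simp)).hasFDerivAt.comp_hasDerivAt t (hline t)).deriv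
  have hd2 : HasDerivAt (deriv φ) (fderiv ℝ (fderiv ℝ f) x η η) 0 := by
    have hdf : HasFDerivAt (fderiv ℝ f) (fderiv ℝ (fderiv ℝ f) x) (x + (0 : ℝ) • η) := by
      rw [zero_smul, add_zero]
      have h1 : ContDiffAt ℝ 1 (fderiv ℝ f) x := hf.fderiv_right (by norm_num)
      exact (h1.differentiableAt one_ne_zero).hasFDerivAt
    have h2 : HasDerivAt (fun t : ℝ => fderiv ℝ f (x + t • η)) (fderiv ℝ (fderiv ℝ f) x η) 0 :=
      HasFDerivAt.comp_hasDerivAt (f := fun t : ℝ => x + t • η) 0 hdf (hline 0)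
    have h3 : HasDerivAt (fun t : ℝ => fderiv ℝ f (x + t • η) η)
        (fderiv ℝ (fderiv ℝ f) x η η) 0 :=
      (ContinuousLinearMap.apply ℝ ℝ η).hasFDerivAt.comp_hasDerivAt 0 h2
    exact h3.congr_of_eventuallyEq hev
  have hmin : IsLocalMin φ 0 := by
    have := hl0.eventually h
    filter_upwards [this] with t ht
    simpa [φ] using ht
  have hcont : ContinuousAt φ 0 := by
    have : ContinuousAt f (x + (0 : ℝ) • η) := by simpa using hf.continuousAt
    exact this.comp (f := fun t : ℝ => x + t • η) (hline 0).continuousAt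
  have hmax := isLocalMax_of_deriv_deriv_neg (by rw [hd2.deriv]; exact hneg) hmin.deriv_eq_zero hcont
  have hconst : φ =ᶠ[𝓝 0] fun _ => φ 0 := by
    filter_upwards [hmin, hmax] with t h1 h2 using le_antisymm h2 h1
  have hd : deriv φ =ᶠ[𝓝 0] fun _ => 0 := by
    have := hconst.deriv
    simpa using this
  have := hd.deriv_eq
  rw [hd2.deriv] at this
  simp only [deriv_const] at this
  exact hneg.ne this

lemma hasFDerivAt_gaussian (α : ℝ) (c x : E) :
    HasFDerivAt (fun x => Real.exp (-α * ‖x - c‖ ^ 2))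
      ((-2 * α * Real.exp (-α * ‖x - c‖ ^ 2)) • innerCovec (x - c)) x := by
  have h1 : HasFDerivAt (fun x : E => ‖x - c‖ ^ 2) ((2 : ℝ) • innerCovec (x - c)) x := by
    have := ((hasFDerivAt_id x).sub_const c).norm_sq
    refine this.congr_fderiv ?_
    ext v
    simp
  refine ((h1.const_mul (-α)).exp).congr_fderiv ?_
  ext v
  simp
  ring

lemma fderiv_fderiv_gaussian (α : ℝ) (c x : E) :
    fderiv ℝ (fderiv ℝ (fun x => Real.exp (-α * ‖x - c‖ ^ 2))) x =
      Real.exp (-α * ‖x - c‖ ^ 2) • ((4 * α ^ 2) • (innerCovec (x - c)).smulRight (innerCovec (x - c))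
        - (2 * α) • innerCovec) := by
  have h0 : fderiv ℝ (fun x => Real.exp (-α * ‖x - c‖ ^ 2)) =
      fun x => (-2 * α * Real.exp (-α * ‖x - c‖ ^ 2)) • innerCovec (x - c) :=
    funext fun x => (hasFDerivAt_gaussian α c x).fderiv
  rw [h0]
  have h1 := ((hasFDerivAt_gaussian α c x).const_mul (-2 * α)).smul
    ((innerCovec (E := E)).hasFDerivAt.comp x ((hasFDerivAt_id x).sub_const c))
  refine (HasFDerivAt.fderiv h1).trans ?_
  ext v u
  simp
  ring

end Hopf

section Hopf

open Set Filter

variable {E : Type*} [NormedAddCommGroup E] [InnerProductSpace ℝ E]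

/-- The closed ball with diameter `[y, c]` meets the sphere about `c` through `y` only at `y`.
Passing to this smaller ball makes the contact with `F` strict. -/
lemma norm_sub_lt_of_mem_closedBall_midpoint {c y z : E}
    (hz : ‖z - (y + (1 / 2 : ℝ) • (c - y))‖ ≤ ‖(1 / 2 : ℝ) • (c - y)‖) (hzy : z ≠ y) :
    ‖c - z‖ < ‖c - y‖ := by
  set ν := c - y with hν
  set d := z - y with hd
  have e1 : z - (y + (1 / 2 : ℝ) • ν) = d - (1 / 2 : ℝ) • ν := by rw [hd]; abel
  have e2 : c - z = ν - d := by rw [hν, hd]; abel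
  have hd0 : 0 < ‖d‖ := norm_pos_iff.2 (sub_ne_zero.2 hzy)
  rw [e1] at hz
  have h1 := pow_le_pow_left₀ (norm_nonneg _) hz 2
  rw [norm_sub_sq_real, real_inner_smul_right] at h1
  rw [e2]
  refine lt_of_pow_lt_pow_left₀ 2 (norm_nonneg _) ?_
  rw [norm_sub_sq_real, real_inner_comm]
  nlinarith

/-- At a zero `y` of a nonnegative supersolution, every exterior normal to the zero set is
characteristic for the degenerate elliptic operator `tr (T D²·)`. -/
lemma normal_characteristic [FiniteDimensional ℝ E] {B F : Set E} (hB : IsOpen B) {w : E → ℝ}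
    (hw : ContDiffOn ℝ 2 w B) (hw0 : ∀ x ∈ B, 0 ≤ w x) {T : E → (E →L[ℝ] ℝ) →L[ℝ] E}
    (hTpos : ∀ x ∈ B, ∀ η : E →L[ℝ] ℝ, 0 ≤ η (T x η)) (hTc : ContinuousOn T B) {C : ℝ} (hC : 0 ≤ C)
    (hineq : ∀ x ∈ B, LinearMap.trace ℝ E (T x ∘L fderiv ℝ (fderiv ℝ w) x : E →L[ℝ] E) ≤
      C * ‖fderiv ℝ w x‖)
    (hF : ∀ x ∈ B, w x = 0 → x ∈ F) {y c : E} (hyB : y ∈ B) (hwy : w y = 0)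
    (hc : ∀ z ∈ F, ‖c - y‖ ≤ ‖c - z‖) :
    innerCovec (c - y) (T y (innerCovec (c - y))) = 0 := by
  by_contra hne
  have hq0 : 0 < innerCovec (c - y) (T y (innerCovec (c - y))) :=
    lt_of_le_of_ne (hTpos y hyB _) (Ne.symm hne)
  set c' : E := y + (1 / 2 : ℝ) • (c - y) with hc'
  have hyc' : y - c' = (-(1 / 2) : ℝ) • (c - y) := by
    rw [hc', neg_smul]; abel
  set r : ℝ := ‖(1 / 2 : ℝ) • (c - y)‖ with hr
  have hyr : ‖y - c'‖ = r := by rw [hyc', neg_smul, norm_neg]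
  let Q : E → ℝ := fun x => innerCovec (x - c') (T x (innerCovec (x - c')))
  have hQy : 0 < Q y := by
    simp only [Q, hyc', map_smul, smul_apply, smul_eq_mul]
    nlinarith
  let τ : E → ℝ := fun x => LinearMap.trace ℝ E (T x ∘L innerCovec : E →L[ℝ] E)
  have hTcy : ContinuousAt T y := hTc.continuousAt (hB.mem_nhds hyB)
  have hQc : ContinuousAt Q y := by
    have h1 : ContinuousAt (fun x : E => innerCovec (x - c')) y :=
      ((innerCovec (E := E)).continuous.comp (continuous_id.sub continuous_const)).continuousAt
    exact h1.clm_apply (hTcy.clm_apply h1)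
  have hτc : ContinuousAt τ y := by
    have h1 : ContinuousAt (fun x => (T x ∘L innerCovec : E →L[ℝ] E)) y :=
      hTcy.clm_comp continuousAt_const
    have h2 : Continuous fun A : E →L[ℝ] E => LinearMap.trace ℝ E (A : E →ₗ[ℝ] E) :=
      ((LinearMap.trace ℝ E).comp (ContinuousLinearMap.coeLM ℝ)).continuous_of_finiteDimensional
    exact h2.continuousAt.comp h1
  have hev : ∀ᶠ x in 𝓝 y, x ∈ B ∧ Q y / 2 < Q x ∧ τ x < τ y + 1 ∧ ‖x - c'‖ < r + 1 := by
    refine Eventually.and (hB.mem_nhds hyB) ((hQc.eventually (lt_mem_nhds (by linarith))).and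
      ((hτc.eventually (gt_mem_nhds (by linarith))).and ?_))
    have : ContinuousAt (fun x : E => ‖x - c'‖) y := by fun_prop
    exact this.eventually (gt_mem_nhds (show ‖y - c'‖ < r + 1 by rw [hyr]; linarith))
  obtain ⟨ρ, hρ, hρs⟩ := Metric.nhds_basis_closedBall.mem_iff.1 hev
  set q := Q y / 2 with hq
  have hqpos : 0 < q := by positivity
  obtain ⟨α, hα0, hα⟩ : ∃ α : ℝ, 0 < α ∧ (τ y + 1) + C * (r + 1) < 2 * α * q := by
    -- For `α` this large the `α²` term of `tr (T D²ψ)` dominates both its first order term in `α`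
    -- and `C ‖dψ‖` near `y`.
    refine ⟨(|τ y + 1| + C * (r + 1) + 1) / (2 * q), by positivity, ?_⟩
    have : 2 * ((|τ y + 1| + C * (r + 1) + 1) / (2 * q)) * q = |τ y + 1| + C * (r + 1) + 1 := by
      field_simp
    rw [this]
    linarith [le_abs_self (τ y + 1)]
  let ψ : E → ℝ := fun x => Real.exp (-α * ‖x - c'‖ ^ 2)
  have hψpos : ∀ x, 0 < ψ x := fun x => Real.exp_pos _
  have hψc : ContDiff ℝ 2 ψ := by
    have : ContDiff ℝ 2 fun x : E => ‖x - c'‖ ^ 2 := (contDiff_id.sub contDiff_const).norm_sq ℝ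
    exact (contDiff_const.mul this).exp
  have hψy : ∀ x, r ≤ ‖x - c'‖ → ψ x ≤ ψ y := by
    intro x hx
    refine Real.exp_le_exp.2 ?_
    rw [hyr]
    have := pow_le_pow_left₀ (norm_nonneg _) hx 2
    nlinarith
  have hwc : ContinuousOn w (Metric.closedBall y ρ) :=
    hw.continuousOn.mono fun x hx => (hρs hx).1
  -- On this compact cap `w` has no zero, because a zero would be a point of `F` closer to `c` than
  -- `y`.
  obtain ⟨ε, hε0, hε⟩ : ∃ ε, 0 < ε ∧ ∀ x ∈ Metric.sphere y ρ ∩ Metric.closedBall c' r, ε ≤ w x := by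
    refine IsCompact.exists_forall_le' ((isCompact_sphere y ρ).inter_right Metric.isClosed_closedBall)
      (hwc.mono (inter_subset_left.trans Metric.sphere_subset_closedBall)) ?_
    rintro x ⟨hx1, hx2⟩
    have hxB := (hρs (Metric.sphere_subset_closedBall hx1)).1
    refine lt_of_le_of_ne (hw0 x hxB) fun h0 => ?_
    have hxy : x ≠ y := by
      rintro rfl
      simp at hx1
      exact hρ.ne hx1
    rw [Metric.mem_closedBall, dist_eq_norm] at hx2
    exact absurd (hc x (hF x hxB h0.symm))
      (not_le.2 (norm_sub_lt_of_mem_closedBall_midpoint hx2 hxy))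
  let f : E → ℝ := fun x => w x - ε * ψ x
  have hfy : f y = -ε * ψ y := by simp [f, hwy]
  -- Inside the ball about `c'`, `w ≥ ε ≥ ε ψ`; outside it, `ψ ≤ ψ y` and `w ≥ 0`.
  have hsph : ∀ x ∈ Metric.sphere y ρ, f y ≤ f x := by
    intro x hx
    rw [hfy]
    by_cases hxr : ‖x - c'‖ ≤ r
    · have h1 := hε x ⟨hx, by rwa [Metric.mem_closedBall, dist_eq_norm]⟩
      have h2 : ψ x ≤ 1 := by
        refine Real.exp_le_one_iff.2 ?_
        have := sq_nonneg ‖x - c'‖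
        nlinarith
      have := hψpos y
      simp only [f]
      nlinarith
    · have h1 := hψy x (not_le.1 hxr).le
      have h2 := hw0 x (hρs (Metric.sphere_subset_closedBall hx)).1
      simp only [f]
      nlinarith
  have hfc : ContinuousOn f (Metric.closedBall y ρ) :=
    hwc.sub (continuousOn_const.mul hψc.continuous.continuousOn)
  obtain ⟨x₁, hx₁, hmin₁⟩ := (isCompact_closedBall y ρ).exists_isMinOn
    ⟨y, Metric.mem_closedBall_self hρ.le⟩ hfc
  -- If the minimum lies on the sphere, then by `hsph` the centre `y` is a minimum as well.
  obtain ⟨x, hx, hmin⟩ : ∃ x ∈ Metric.ball y ρ, IsMinOn f (Metric.closedBall y ρ) x := by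
    by_cases h : x₁ ∈ Metric.ball y ρ
    · exact ⟨x₁, h, hmin₁⟩
    · have hs : x₁ ∈ Metric.sphere y ρ := by
        rw [Metric.mem_sphere]
        exact le_antisymm hx₁ (not_lt.1 h)
      exact ⟨y, Metric.mem_ball_self hρ, fun z hz => (hsph x₁ hs).trans (hmin₁ hz)⟩
  have hloc : IsLocalMin f x :=
    hmin.isLocalMin (mem_of_superset (Metric.isOpen_ball.mem_nhds hx) Metric.ball_subset_closedBall)
  obtain ⟨hxB, hxQ, hxτ, hxr⟩ := hρs (Metric.ball_subset_closedBall hx)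
  have hwx : ContDiffAt ℝ 2 w x := hw.contDiffAt (hB.mem_nhds hxB)
  have hψx : ContDiffAt ℝ 2 (fun z => ε * ψ z) x := contDiffAt_const.mul hψc.contDiffAt
  have hfx : ContDiffAt ℝ 2 f x := hwx.sub hψx
  have hd1 : ∀ᶠ z in 𝓝 x, fderiv ℝ f z = fderiv ℝ w z - ε • fderiv ℝ ψ z := by
    filter_upwards [hB.mem_nhds hxB] with z hz
    have h1 := (hw.contDiffAt (hB.mem_nhds hz)).differentiableAt (by simp)
    have h2 : DifferentiableAt ℝ ψ z := (hψc.differentiable (by simp)) z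
    have h3 := h1.hasFDerivAt.sub (h2.hasFDerivAt.const_mul ε)
    exact h3.fderiv
  have hfw : fderiv ℝ w x = ε • fderiv ℝ ψ x := by
    have := hd1.self_of_nhds
    rw [hloc.fderiv_eq_zero] at this
    exact (sub_eq_zero.1 this.symm)
  have hd2 : fderiv ℝ (fderiv ℝ f) x =
      fderiv ℝ (fderiv ℝ w) x - ε • fderiv ℝ (fderiv ℝ ψ) x := by
    have hw1 : ContDiffAt ℝ 1 (fderiv ℝ w) x := hwx.fderiv_right (by norm_num)
    have hψ1 : ContDiffAt ℝ 1 (fderiv ℝ ψ) x := hψc.contDiffAt.fderiv_right (by norm_num)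
    have h3 := (hw1.differentiableAt one_ne_zero).hasFDerivAt.sub
      ((hψ1.differentiableAt one_ne_zero).hasFDerivAt.const_smul ε)
    rw [Filter.EventuallyEq.fderiv_eq hd1]
    exact h3.fderiv
  -- At the interior minimum `dw = ε dψ` and `tr (T D²w) ≥ ε tr (T D²ψ)`, which exceeds `C ε ‖dψ‖ =
  -- C ‖dw‖` by the choice of `α`.
  have htr := trace_comp_nonneg (T x) (hTpos x hxB) (fderiv ℝ (fderiv ℝ f) x)
    (fun a b => (hfx.isSymmSndFDerivAt (by simp)) a b)
    (fun a => hloc.fderiv_fderiv_apply_nonneg hfx a)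
  have hψ2 : LinearMap.trace ℝ E (T x ∘L fderiv ℝ (fderiv ℝ ψ) x : E →L[ℝ] E) =
      ψ x * (4 * α ^ 2 * Q x - 2 * α * τ x) := by
    have e1 : (T x ∘L fderiv ℝ (fderiv ℝ ψ) x : E →L[ℝ] E) =
        ψ x • ((4 * α ^ 2) • (innerCovec (x - c')).smulRight (T x (innerCovec (x - c')))
          - (2 * α) • (T x ∘L innerCovec)) := by
      rw [fderiv_fderiv_gaussian]
      ext v
      simp [ψ]
    have e2 : LinearMap.trace ℝ E
        ((innerCovec (x - c')).smulRight (T x (innerCovec (x - c'))) : E →L[ℝ] E) = Q x :=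
      LinearMap.trace_smulRight _ _
    rw [e1, ContinuousLinearMap.toLinearMap_smul, ContinuousLinearMap.toLinearMap_sub,
      ContinuousLinearMap.toLinearMap_smul, ContinuousLinearMap.toLinearMap_smul, map_smul, map_sub,
      map_smul, map_smul, e2]
    rfl
  have hsplit : LinearMap.trace ℝ E (T x ∘L fderiv ℝ (fderiv ℝ f) x : E →L[ℝ] E) =
      LinearMap.trace ℝ E (T x ∘L fderiv ℝ (fderiv ℝ w) x : E →L[ℝ] E) -
        ε * (ψ x * (4 * α ^ 2 * Q x - 2 * α * τ x)) := by
    rw [← hψ2, hd2, ← smul_eq_mul, ← map_smul, ← map_sub]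
    congr 1
    ext v
    simp
  have hfin := hineq x hxB
  have hnorm : ‖fderiv ℝ w x‖ ≤ ε * (2 * α * ψ x * (r + 1)) := by
    rw [hfw, (hasFDerivAt_gaussian α c' x).fderiv, norm_smul, norm_smul,
      Real.norm_of_nonneg hε0.le]
    have h1 : ‖-2 * α * Real.exp (-α * ‖x - c'‖ ^ 2)‖ = 2 * α * ψ x := by
      rw [Real.norm_eq_abs, abs_mul, abs_of_pos (Real.exp_pos _), abs_mul, abs_of_pos hα0]
      simp [ψ]
    rw [h1]
    have := hψpos x
    have := (norm_innerCovec_le (x - c')).trans hxr.le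
    gcongr
  rw [hsplit] at htr
  have h1 : C * ‖fderiv ℝ w x‖ ≤ C * (ε * (2 * α * ψ x * (r + 1))) := by gcongr
  have hk : 0 < ε * ψ x * (2 * α) := by have := hψpos x; positivity
  have h2 : ε * ψ x * (2 * α) * (2 * α * Q x - τ x - C * (r + 1)) ≤ 0 := by
    nlinarith
  have h3 : 0 < 2 * α * Q x - τ x - C * (r + 1) := by nlinarith
  exact absurd h2 (not_le.2 (mul_pos hk h3))

end Hopf

/-! ### Linearization of the difference of two weighted divergences. -/

section Linearization

open Set Filter

variable {E : Type*} [NormedAddCommGroup E] [InnerProductSpace ℝ E]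

/-- The difference of two functions whose weighted divergences `A⁻¹ div K(z, dφ)` are ordered
is a supersolution of a linear inequality. -/
lemma exists_linearized_inequality [FiniteDimensional ℝ E] {x₀ : E} {K : E × (E →L[ℝ] ℝ) → E}
    {A : E → ℝ} {φ ψ : E → ℝ} (hφ : ContDiffAt ℝ ∞ φ x₀) (hψ : ContDiffAt ℝ ∞ ψ x₀)
    (hd : fderiv ℝ φ x₀ = fderiv ℝ ψ x₀) (hK : ContDiffAt ℝ ∞ K (x₀, fderiv ℝ ψ x₀))
    (hA : ContDiffAt ℝ ∞ A x₀) (hA0 : A x₀ ≠ 0)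
    (hle : ∀ᶠ z in 𝓝 x₀,
      (A z)⁻¹ * LinearMap.trace ℝ E (fderiv ℝ (fun z => K (z, fderiv ℝ φ z)) z : E →L[ℝ] E) ≤
      (A z)⁻¹ * LinearMap.trace ℝ E (fderiv ℝ (fun z => K (z, fderiv ℝ ψ z)) z : E →L[ℝ] E)) :
    ∃ C, 0 ≤ C ∧ ∀ᶠ z in 𝓝 x₀, LinearMap.trace ℝ E
      (((A z)⁻¹ • (fderiv ℝ K (z, fderiv ℝ φ z) ∘L ContinuousLinearMap.inr ℝ E (E →L[ℝ] ℝ))) ∘L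
        fderiv ℝ (fderiv ℝ (fun z => φ z - ψ z)) z : E →L[ℝ] E) ≤
      C * ‖fderiv ℝ (fun z => φ z - ψ z) z‖ := by
  let trL : (E →L[ℝ] E) →L[ℝ] ℝ :=
    LinearMap.toContinuousLinearMap ((LinearMap.trace ℝ E).comp (ContinuousLinearMap.coeLM ℝ))
  have htrL : ∀ L : E →L[ℝ] E, trL L = LinearMap.trace ℝ E (L : E →ₗ[ℝ] E) := fun L => rfl
  -- The weighted divergence as a function of the 2-jet, affine in the Hessian slot. Only the change
  -- of the covector at the fixed Hessian `D²ψ` has to be estimated, by a local Lipschitz bound.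
  let Q : E × (E →L[ℝ] ℝ) × (E →L[ℝ] E →L[ℝ] ℝ) → ℝ := fun p =>
    (A p.1)⁻¹ * trL (fderiv ℝ K (p.1, p.2.1) ∘L (ContinuousLinearMap.id ℝ E).prod p.2.2)
  have hφ1 : ContDiffAt ℝ ∞ (fderiv ℝ φ) x₀ := hφ.fderiv_right (by norm_cast)
  have hψ1 : ContDiffAt ℝ ∞ (fderiv ℝ ψ) x₀ := hψ.fderiv_right (by norm_cast)
  have hψ2 : ContDiffAt ℝ ∞ (fderiv ℝ (fderiv ℝ ψ)) x₀ := hψ1.fderiv_right (by norm_cast)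
  have hK1 : ContDiffAt ℝ ∞ (fderiv ℝ K) (x₀, fderiv ℝ ψ x₀) := hK.fderiv_right (by norm_cast)
  have hQ : ContDiffAt ℝ 1 Q (x₀, fderiv ℝ ψ x₀, fderiv ℝ (fderiv ℝ ψ) x₀) := by
    have h1 : ContDiffAt ℝ 1 (fun p : E × (E →L[ℝ] ℝ) × (E →L[ℝ] E →L[ℝ] ℝ) => (A p.1)⁻¹)
        (x₀, fderiv ℝ ψ x₀, fderiv ℝ (fderiv ℝ ψ) x₀) :=
      ((hA.of_le (by simp)).comp _ contDiffAt_fst).inv hA0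
    have h2 : ContDiffAt ℝ 1
        (fun p : E × (E →L[ℝ] ℝ) × (E →L[ℝ] E →L[ℝ] ℝ) => fderiv ℝ K (p.1, p.2.1))
        (x₀, fderiv ℝ ψ x₀, fderiv ℝ (fderiv ℝ ψ) x₀) :=
      ContDiffAt.comp (g := fderiv ℝ K)
        (f := fun p : E × (E →L[ℝ] ℝ) × (E →L[ℝ] E →L[ℝ] ℝ) => (p.1, p.2.1)) _
        (hK1.of_le (by simp)) (by fun_prop)
    have h3 : ContDiff ℝ 1 (fun p : E × (E →L[ℝ] ℝ) × (E →L[ℝ] E →L[ℝ] ℝ) =>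
        (ContinuousLinearMap.id ℝ E).prod p.2.2) := by
      have : ContDiff ℝ 1 (fun S : E →L[ℝ] E →L[ℝ] ℝ => ContinuousLinearMap.inl ℝ E (E →L[ℝ] ℝ) +
          ContinuousLinearMap.inr ℝ E (E →L[ℝ] ℝ) ∘L S) :=
        contDiff_const.add (contDiff_const.clm_comp contDiff_id)
      have h : (fun S : E →L[ℝ] E →L[ℝ] ℝ => ContinuousLinearMap.inl ℝ E (E →L[ℝ] ℝ) +
          ContinuousLinearMap.inr ℝ E (E →L[ℝ] ℝ) ∘L S) =
          fun S => (ContinuousLinearMap.id ℝ E).prod S := by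
        funext S
        ext v <;> simp
      rw [h] at this
      exact this.comp (contDiff_snd.comp contDiff_snd)
    exact h1.mul (trL.contDiff.contDiffAt.comp _ (h2.clm_comp h3.contDiffAt))
  obtain ⟨L, t, ht, hL⟩ := hQ.exists_lipschitzOnWith
  refine ⟨L, L.2, ?_⟩
  -- Equality of the differentials at `x₀` puts this mixed jet in the same Lipschitz neighbourhood
  -- as the jet of `ψ`.
  have ht1 : ∀ᶠ z in 𝓝 x₀, (z, fderiv ℝ φ z, fderiv ℝ (fderiv ℝ ψ) z) ∈ t := by
    have : ContinuousAt (fun z => (z, fderiv ℝ φ z, fderiv ℝ (fderiv ℝ ψ) z)) x₀ :=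
      continuousAt_id.prodMk (hφ1.continuousAt.prodMk hψ2.continuousAt)
    exact this.eventually (show ∀ᶠ y in 𝓝 (x₀, fderiv ℝ φ x₀, _), y ∈ t by rw [hd]; exact ht)
  have ht2 : ∀ᶠ z in 𝓝 x₀, (z, fderiv ℝ ψ z, fderiv ℝ (fderiv ℝ ψ) z) ∈ t := by
    have : ContinuousAt (fun z => (z, fderiv ℝ ψ z, fderiv ℝ (fderiv ℝ ψ) z)) x₀ :=
      continuousAt_id.prodMk (hψ1.continuousAt.prodMk hψ2.continuousAt)
    exact this.eventually ht
  have hKev := (hK.of_le (show (1 : ℕ∞ω) ≤ ∞ by simp)).eventually (by simp)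
  have hKφ : ∀ᶠ z in 𝓝 x₀, ContDiffAt ℝ 1 K (z, fderiv ℝ φ z) := by
    have : ContinuousAt (fun z => (z, fderiv ℝ φ z)) x₀ := continuousAt_id.prodMk hφ1.continuousAt
    exact this.eventually (by simpa only [hd] using hKev)
  have hKψ : ∀ᶠ z in 𝓝 x₀, ContDiffAt ℝ 1 K (z, fderiv ℝ ψ z) := by
    have : ContinuousAt (fun z => (z, fderiv ℝ ψ z)) x₀ := continuousAt_id.prodMk hψ1.continuousAt
    exact this.eventually hKev
  have chain : ∀ (f : E → ℝ) (z : E), ContDiffAt ℝ 2 f z → ContDiffAt ℝ 1 K (z, fderiv ℝ f z) →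
      fderiv ℝ (fun z => K (z, fderiv ℝ f z)) z = fderiv ℝ K (z, fderiv ℝ f z) ∘L
        (ContinuousLinearMap.id ℝ E).prod (fderiv ℝ (fderiv ℝ f) z) := by
    intro f z hf hKz
    have hf1 : ContDiffAt ℝ 1 (fderiv ℝ f) z := hf.fderiv_right (by norm_num)
    exact (HasFDerivAt.comp (f := fun z => (z, fderiv ℝ f z)) z
      (hKz.differentiableAt one_ne_zero).hasFDerivAt
      ((hasFDerivAt_id z).prodMk (hf1.differentiableAt one_ne_zero).hasFDerivAt)).fderiv
  have hφev := (hφ.of_le (show (2 : ℕ∞ω) ≤ ∞ from WithTop.coe_le_coe.2 le_top)).eventually (by simp)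
  have hψev := (hψ.of_le (show (2 : ℕ∞ω) ≤ ∞ from WithTop.coe_le_coe.2 le_top)).eventually (by simp)
  filter_upwards [hle, ht1, ht2, hKφ, hKψ, hφev, hψev, hφev.eventually_nhds, hψev.eventually_nhds]
    with z hz h1 h2 h3 h4 h5 h6 h5' h6'
  rw [chain φ z h5 h3, chain ψ z h6 h4] at hz
  have e1 : fderiv ℝ (fun z => φ z - ψ z) =ᶠ[𝓝 z] fun z => fderiv ℝ φ z - fderiv ℝ ψ z := by
    filter_upwards [h5', h6'] with y hy1 hy2
    exact ((hy1.differentiableAt (by simp)).hasFDerivAt.sub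
      (hy2.differentiableAt (by simp)).hasFDerivAt).fderiv
  have e2 : fderiv ℝ (fderiv ℝ (fun z => φ z - ψ z)) z =
      fderiv ℝ (fderiv ℝ φ) z - fderiv ℝ (fderiv ℝ ψ) z := by
    have h5a : ContDiffAt ℝ 1 (fderiv ℝ φ) z := h5.fderiv_right (by norm_num)
    have h6a : ContDiffAt ℝ 1 (fderiv ℝ ψ) z := h6.fderiv_right (by norm_num)
    rw [e1.fderiv_eq]
    exact ((h5a.differentiableAt one_ne_zero).hasFDerivAt.sub
      (h6a.differentiableAt one_ne_zero).hasFDerivAt).fderiv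
  rw [e1.self_of_nhds, e2]
  have hdist := hL.dist_le_mul _ h1 _ h2
  have e3 : dist (z, fderiv ℝ φ z, fderiv ℝ (fderiv ℝ ψ) z)
      (z, fderiv ℝ ψ z, fderiv ℝ (fderiv ℝ ψ) z) = ‖fderiv ℝ φ z - fderiv ℝ ψ z‖ := by
    simp [Prod.dist_eq, dist_eq_norm]
  rw [e3, Real.dist_eq] at hdist
  have hab := neg_le_of_abs_le hdist
  -- Affinity in the Hessian makes the second order part of the difference exact, with coefficients
  -- at `dφ`.
  have e4 : (((A z)⁻¹ • (fderiv ℝ K (z, fderiv ℝ φ z) ∘L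
      ContinuousLinearMap.inr ℝ E (E →L[ℝ] ℝ))) ∘L
        (fderiv ℝ (fderiv ℝ φ) z - fderiv ℝ (fderiv ℝ ψ) z) : E →L[ℝ] E) =
      (A z)⁻¹ • (fderiv ℝ K (z, fderiv ℝ φ z) ∘L
        (ContinuousLinearMap.id ℝ E).prod (fderiv ℝ (fderiv ℝ φ) z)) -
      (A z)⁻¹ • (fderiv ℝ K (z, fderiv ℝ φ z) ∘L
        (ContinuousLinearMap.id ℝ E).prod (fderiv ℝ (fderiv ℝ ψ) z)) := by
    ext v
    simp only [ContinuousLinearMap.comp_apply, smul_apply, sub_apply,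
      ContinuousLinearMap.inr_apply, ContinuousLinearMap.prod_apply, ContinuousLinearMap.id_apply]
    rw [← smul_sub, ← map_sub]
    simp
  rw [e4, ← htrL, map_sub, map_smul, map_smul, smul_eq_mul, smul_eq_mul]
  rw [← htrL, ← htrL] at hz
  simp only [Q] at hab
  linarith

end Linearization

/-! ### The flux and its symbol. -/

section Flux

variable {E : Type*} [NormedAddCommGroup E] [NormedSpace ℝ E]

/-- Cauchy–Schwarz for a possibly degenerate form, from the discriminant of the square of `θ + t η`.
-/
lemma sq_apply_le_of_nonneg {G : (E →L[ℝ] ℝ) →L[ℝ] E} (hs : ∀ θ η : E →L[ℝ] ℝ, θ (G η) = η (G θ))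
    (hp : ∀ θ : E →L[ℝ] ℝ, 0 ≤ θ (G θ)) (θ η : E →L[ℝ] ℝ) :
    θ (G η) ^ 2 ≤ θ (G θ) * η (G η) := by
  have h := discrim_le_zero (a := η (G η)) (b := 2 * θ (G η)) (c := θ (G θ)) (fun t => by
    have := hp (θ + t • η)
    simp only [map_add, map_smul, add_apply, smul_apply, smul_eq_mul, hs η θ] at this
    linarith)
  rw [discrim] at h
  linarith

/-- The flux `A |θ|^{p-1} G θ`, where `|θ|² = θ (G θ)`. -/
noncomputable def flux (A : E → ℝ) (G : E → (E →L[ℝ] ℝ) →L[ℝ] E) (p : ℝ) (q : E × (E →L[ℝ] ℝ)) : E :=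
  (A q.1 * (Real.sqrt (q.2 (G q.1 q.2)) ^ (1 - p))⁻¹) • G q.1 q.2

lemma contDiffAt_flux {A : E → ℝ} {G : E → (E →L[ℝ] ℝ) →L[ℝ] E} {p : ℝ} {x : E} {θ : E →L[ℝ] ℝ}
    (hA : ContDiffAt ℝ ∞ A x) (hG : ContDiffAt ℝ ∞ G x) (hθ : 0 < θ (G x θ)) :
    ContDiffAt ℝ ∞ (flux A G p) (x, θ) := by
  have h1 : ContDiffAt ℝ ∞ (fun q : E × (E →L[ℝ] ℝ) => A q.1) (x, θ) := hA.comp _ contDiffAt_fst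
  have h2 : ContDiffAt ℝ ∞ (fun q : E × (E →L[ℝ] ℝ) => G q.1) (x, θ) := hG.comp _ contDiffAt_fst
  have h3 : ContDiffAt ℝ ∞ (fun q : E × (E →L[ℝ] ℝ) => G q.1 q.2) (x, θ) :=
    h2.clm_apply contDiffAt_snd
  have h4 : ContDiffAt ℝ ∞ (fun q : E × (E →L[ℝ] ℝ) => q.2 (G q.1 q.2)) (x, θ) :=
    contDiffAt_snd.clm_apply h3
  have hs : Real.sqrt (θ (G x θ)) ≠ 0 := (Real.sqrt_pos.2 hθ).ne'
  have h5 := (h4.sqrt hθ.ne').rpow_const_of_ne (p := 1 - p) hs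
  exact (h1.mul (h5.inv (Real.rpow_pos_of_pos (Real.sqrt_pos.2 hθ) _).ne')).smul h3

/-- The quadratic form of the principal symbol, found by differentiating along the line `θ + t η`,
where everything is explicit in one real variable. -/
lemma apply_fderiv_flux {A : E → ℝ} {G : E → (E →L[ℝ] ℝ) →L[ℝ] E} {p : ℝ} {x : E} {θ : E →L[ℝ] ℝ}
    (hA : ContDiffAt ℝ ∞ A x) (hA0 : A x ≠ 0) (hG : ContDiffAt ℝ ∞ G x)
    (hs : ∀ θ η : E →L[ℝ] ℝ, θ (G x η) = η (G x θ)) (hθ : 0 < θ (G x θ)) (η : E →L[ℝ] ℝ) :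
    η (((A x)⁻¹ • (fderiv ℝ (flux A G p) (x, θ) ∘L ContinuousLinearMap.inr ℝ E (E →L[ℝ] ℝ))) η) =
      (Real.sqrt (θ (G x θ)) ^ (1 - p))⁻¹ *
        (η (G x η) + (p - 1) * θ (G x η) ^ 2 / θ (G x θ)) := by
  set s := θ (G x θ) with hsdef
  have hd := ((contDiffAt_flux (p := p) hA hG hθ).differentiableAt (by simp)).hasFDerivAt
  have hline : HasDerivAt (fun t : ℝ => (x, θ + t • η)) ((0 : E), η) 0 := by
    have := ((hasDerivAt_id (0 : ℝ)).smul_const η).const_add θ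
    simpa using (hasDerivAt_const (0 : ℝ) x).prodMk this
  have hd' : HasFDerivAt (flux A G p) (fderiv ℝ (flux A G p) (x, θ)) (x, θ + (0 : ℝ) • η) := by
    simpa using hd
  have h1 : HasDerivAt (fun t : ℝ => flux A G p (x, θ + t • η))
      (fderiv ℝ (flux A G p) (x, θ) (0, η)) 0 :=
    HasFDerivAt.comp_hasDerivAt (f := fun t : ℝ => (x, θ + t • η)) 0 hd' hline
  have h2 : HasDerivAt (fun t : ℝ => η (flux A G p (x, θ + t • η)))
      (η (fderiv ℝ (flux A G p) (x, θ) (0, η))) 0 := η.hasFDerivAt.comp_hasDerivAt 0 h1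
  have hq : HasDerivAt (fun t : ℝ => s + 2 * θ (G x η) * t + η (G x η) * t ^ 2)
      (2 * θ (G x η)) 0 := by
    have h3 := (((hasDerivAt_id (0 : ℝ)).const_mul (2 * θ (G x η))).const_add s).add
      (((hasDerivAt_id (0 : ℝ)).pow 2).const_mul (η (G x η)))
    refine h3.congr_deriv ?_
    simp
  have hsq : 0 < Real.sqrt s := Real.sqrt_pos.2 hθ
  have hN := ((hq.sqrt (by simpa using hθ.ne')).rpow_const (p := 1 - p)
    (Or.inl (by simpa using hsq.ne'))).inv (by simpa using (Real.rpow_pos_of_pos hsq _).ne')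
  have hM : HasDerivAt (fun t : ℝ => θ (G x η) + t * η (G x η)) (η (G x η)) 0 := by
    simpa using ((hasDerivAt_id (0 : ℝ)).mul_const (η (G x η))).const_add (θ (G x η))
  have h4 := ((hN.const_mul (A x)).mul hM)
  have h5 : (fun t : ℝ => η (flux A G p (x, θ + t • η))) = fun t : ℝ =>
      A x * (Real.sqrt (s + 2 * θ (G x η) * t + η (G x η) * t ^ 2) ^ (1 - p))⁻¹ *
        (θ (G x η) + t * η (G x η)) := by
    funext t
    have e1 : (θ + t • η) (G x (θ + t • η)) = s + 2 * θ (G x η) * t + η (G x η) * t ^ 2 := by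
      simp only [map_add, map_smul, add_apply, smul_apply, smul_eq_mul, hs η θ, hsdef]
      ring
    simp only [flux]
    rw [e1]
    simp only [map_add, map_smul, smul_eq_mul, hs η θ]
  rw [h5] at h2
  have h6 := h2.unique h4
  simp only [smul_apply, ContinuousLinearMap.comp_apply, ContinuousLinearMap.inr_apply, map_smul,
    smul_eq_mul, h6]
  simp only [Pi.inv_apply, mul_zero, add_zero, ne_eq, OfNat.ofNat_ne_zero, not_false_eq_true, zero_pow, zero_mul]
  have hNs : Real.sqrt s ^ (1 - p - 1) = Real.sqrt s ^ (1 - p) / Real.sqrt s := by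
    rw [Real.rpow_sub_one hsq.ne']
  rw [hNs]
  have hNpos := Real.rpow_pos_of_pos hsq (1 - p)
  set N := Real.sqrt s ^ (1 - p) with hNdef
  have hss : s = Real.sqrt s ^ 2 := (Real.sq_sqrt hθ.le).symm
  set σ := Real.sqrt s
  clear_value N σ
  rw [hss]
  field_simp
  ring

end Flux

section Flux

variable {E : Type*} [NormedAddCommGroup E] [NormedSpace ℝ E]

/-- By Cauchy–Schwarz the bracket is at least `p ⟨θ,η⟩² / |θ|²`; this is where `p ≥ 0` enters. -/
lemma apply_fderiv_flux_nonneg {A : E → ℝ} {G : E → (E →L[ℝ] ℝ) →L[ℝ] E} {p : ℝ} (hp : 0 ≤ p)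
    {x : E} {θ : E →L[ℝ] ℝ} (hA : ContDiffAt ℝ ∞ A x) (hA0 : A x ≠ 0) (hG : ContDiffAt ℝ ∞ G x)
    (hs : ∀ θ η : E →L[ℝ] ℝ, θ (G x η) = η (G x θ)) (hpos : ∀ θ : E →L[ℝ] ℝ, 0 ≤ θ (G x θ))
    (hθ : 0 < θ (G x θ)) (η : E →L[ℝ] ℝ) :
    0 ≤ η (((A x)⁻¹ • (fderiv ℝ (flux A G p) (x, θ) ∘L
      ContinuousLinearMap.inr ℝ E (E →L[ℝ] ℝ))) η) := by
  rw [apply_fderiv_flux hA hA0 hG hs hθ]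
  have hcs := sq_apply_le_of_nonneg hs hpos θ η
  refine mul_nonneg (inv_nonneg.2 (Real.rpow_nonneg (Real.sqrt_nonneg _) _)) ?_
  have h1 : θ (G x η) ^ 2 / θ (G x θ) ≤ η (G x η) := by
    rw [div_le_iff₀ hθ]; linarith
  have h2 : 0 ≤ θ (G x η) ^ 2 / θ (G x θ) := by positivity
  rw [mul_div_assoc]
  nlinarith

/-- A null covector `η` of the symbol differs from a multiple of `θ` by a null covector of `G`: the
part `η'` orthogonal to `θ` has square at most zero. So `G η` is proportional to `G θ`, on which `ζ`
vanishes. This holds even for `p = 0`, where `θ` itself is null for the symbol. -/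
lemma apply_eq_zero_of_apply_fderiv_flux_eq_zero {A : E → ℝ} {G : E → (E →L[ℝ] ℝ) →L[ℝ] E} {p : ℝ}
    (hp : 0 ≤ p) {x : E} {θ : E →L[ℝ] ℝ} (hA : ContDiffAt ℝ ∞ A x) (hA0 : A x ≠ 0)
    (hG : ContDiffAt ℝ ∞ G x) (hs : ∀ θ η : E →L[ℝ] ℝ, θ (G x η) = η (G x θ))
    (hpos : ∀ θ : E →L[ℝ] ℝ, 0 ≤ θ (G x θ)) (hθ : 0 < θ (G x θ)) {η ζ : E →L[ℝ] ℝ}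
    (h : η (((A x)⁻¹ • (fderiv ℝ (flux A G p) (x, θ) ∘L
      ContinuousLinearMap.inr ℝ E (E →L[ℝ] ℝ))) η) = 0) (hζ : ζ (G x θ) = 0) :
    η (G x ζ) = 0 := by
  rw [apply_fderiv_flux hA hA0 hG hs hθ] at h
  have hN : (Real.sqrt (θ (G x θ)) ^ (1 - p))⁻¹ ≠ 0 :=
    (inv_pos.2 (Real.rpow_pos_of_pos (Real.sqrt_pos.2 hθ) _)).ne'
  have h0 := (mul_eq_zero.1 h).resolve_left hN
  rw [mul_div_assoc] at h0
  set s := θ (G x θ) with hsd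
  set b := θ (G x η) with hb
  have h2 : 0 ≤ b ^ 2 / s := by positivity
  set η' := η - (b / s) • θ with hη'
  have e1 : η' (G x η') = η (G x η) - b ^ 2 / s := by
    simp only [hη', map_sub, map_smul, sub_apply, smul_apply, smul_eq_mul, hs η θ, ← hsd, ← hb]
    field_simp
    ring
  have e2 : η' (G x η') = 0 := le_antisymm (by rw [e1]; nlinarith) (hpos _)
  have hcs := sq_apply_le_of_nonneg hs hpos ζ η'
  rw [e2, mul_zero] at hcs
  have e3 : ζ (G x η') = 0 := by
    have := le_antisymm hcs (sq_nonneg _)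
    exact pow_eq_zero_iff (two_ne_zero) |>.1 this
  rw [hη', map_sub, map_smul, map_sub, map_smul, hζ, smul_zero, sub_zero] at e3
  rw [hs]
  exact e3

end Flux

lemma contDiffOn_smul_const {E F : Type*} [NormedAddCommGroup E] [NormedSpace ℝ E]
    [NormedAddCommGroup F] [NormedSpace ℝ F] {f : E → ℝ} {s : Set E} (hf : ContDiffOn ℝ ∞ f s)
    (y : F) : ContDiffOn ℝ ∞ (fun z => f z • y) s :=
  hf.smul contDiffOn_const

/-! ### The metric in coordinates. -/

noncomputable section

namespace SubRiem

section Coordinates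

variable {m : ℕ} {M : Type*} [TopologicalSpace M] [ChartedSpace (Coord (m + 1)) M]

/-- The differential of the coordinates `e`. -/
def coordDeriv (e : OpenPartialHomeomorph M (Coord (m + 1))) (q : M) : Tan m q →L[ℝ] Coord (m + 1) :=
  mfderiv (𝓡 (m + 1)) (𝓡 (m + 1)) e q

/-- The differential of the parametrization `e.symm`. -/
def coordInv (e : OpenPartialHomeomorph M (Coord (m + 1))) (z : Coord (m + 1)) :
    Coord (m + 1) →L[ℝ] Tan m (e.symm z) :=
  mfderiv (𝓡 (m + 1)) (𝓡 (m + 1)) e.symm z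

/-- The inner product `⟨·,·⟩*` in the coordinates `e`, as a map from covectors to vectors. -/
def coordMetric (g : CoMetric m M) (e : OpenPartialHomeomorph M (Coord (m + 1)))
    (z : Coord (m + 1)) : (Coord (m + 1) →L[ℝ] ℝ) →L[ℝ] Coord (m + 1) :=
  ∑ i : Fin (m + 1), ∑ j : Fin (m + 1),
    g.form (e.symm z) (dAt m (fun q => e q i) (e.symm z)) (dAt m (fun q => e q j) (e.symm z)) •
      (ContinuousLinearMap.apply ℝ ℝ (EuclideanSpace.single j (1 : ℝ) : Coord (m + 1))).smulRight
        (EuclideanSpace.single i (1 : ℝ) : Coord (m + 1))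

/-- The density of the volume form in the coordinates `e`. -/
def coordDensity [IsManifold (𝓡 (m + 1)) ∞ M] (dv : VolumeForm m M)
    (e : OpenPartialHomeomorph M (Coord (m + 1))) (z : Coord (m + 1)) : ℝ :=
  dv.form (e.symm z) (fun i => coordInv e z (EuclideanSpace.single i (1 : ℝ)))

variable {e : OpenPartialHomeomorph M (Coord (m + 1))}

lemma mdifferentiable_of_mem_maximalAtlas (he : e ∈ IsManifold.maximalAtlas (𝓡 (m + 1)) ∞ M) :
    e.MDifferentiable (𝓡 (m + 1)) (𝓡 (m + 1)) :=
  ⟨(contMDiffOn_of_mem_maximalAtlas he).mdifferentiableOn (by simp),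
    (contMDiffOn_symm_of_mem_maximalAtlas he).mdifferentiableOn (by simp)⟩

lemma coordDeriv_coordInv (he : e ∈ IsManifold.maximalAtlas (𝓡 (m + 1)) ∞ M) {z : Coord (m + 1)}
    (hz : z ∈ e.target) (v : Coord (m + 1)) : coordDeriv e (e.symm z) (coordInv e z v) = v := by
  have h := (mdifferentiable_of_mem_maximalAtlas he).comp_symm_deriv hz
  exact congrArg (fun L : Coord (m + 1) →L[ℝ] Coord (m + 1) => L v) h

lemma coordInv_coordDeriv (he : e ∈ IsManifold.maximalAtlas (𝓡 (m + 1)) ∞ M) {z : Coord (m + 1)}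
    (hz : z ∈ e.target) (v : Tan m (e.symm z)) :
    coordInv e z (coordDeriv e (e.symm z) v) = v := by
  have h := (mdifferentiable_of_mem_maximalAtlas he).symm_comp_deriv (e.map_target hz)
  rw [e.right_inv hz] at h
  exact congrArg (fun L : Coord (m + 1) →L[ℝ] Coord (m + 1) => L v) h

lemma dAt_coord (he : e ∈ IsManifold.maximalAtlas (𝓡 (m + 1)) ∞ M) {q : M} (hq : q ∈ e.source)
    (i : Fin (m + 1)) : dAt m (fun q => e q i) q =
      (EuclideanSpace.proj i : Coord (m + 1) →L[ℝ] ℝ) ∘L coordDeriv e q := by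
  have h1 := ((mdifferentiable_of_mem_maximalAtlas he).mdifferentiableAt hq).hasMFDerivAt
  have h2 : HasMFDerivAt 𝓘(ℝ, Coord (m + 1)) 𝓘(ℝ, ℝ)
      (EuclideanSpace.proj i : Coord (m + 1) →L[ℝ] ℝ) (e q) (EuclideanSpace.proj i) :=
    (EuclideanSpace.proj i : Coord (m + 1) →L[ℝ] ℝ).hasFDerivAt.hasMFDerivAt
  exact (h2.comp q h1).mfderiv

lemma dAt_symm_eq (he : e ∈ IsManifold.maximalAtlas (𝓡 (m + 1)) ∞ M) {z : Coord (m + 1)}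
    (hz : z ∈ e.target) {φ : M → ℝ}
    (hφ : MDifferentiableAt (𝓡 (m + 1)) 𝓘(ℝ, ℝ) φ (e.symm z)) :
    dAt m φ (e.symm z) = (fderiv ℝ (fun z => φ (e.symm z)) z : Coord (m + 1) →L[ℝ] ℝ) ∘L
      coordDeriv e (e.symm z) := by
  have h1 := ((mdifferentiable_of_mem_maximalAtlas he).mdifferentiableAt_symm hz).hasMFDerivAt
  have h2 : HasFDerivAt (fun z => φ (e.symm z))
      ((dAt m φ (e.symm z)) ∘L coordInv e z : Coord (m + 1) →L[ℝ] ℝ) z :=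
    (hφ.hasMFDerivAt.comp z h1).hasFDerivAt
  rw [h2.fderiv]
  ext v
  exact congrArg (dAt m φ (e.symm z)) (coordInv_coordDeriv he hz v).symm

lemma covec_coord_eq_sum (L : Coord (m + 1) →L[ℝ] ℝ) : L = ∑ i : Fin (m + 1),
    L (EuclideanSpace.single i (1 : ℝ)) • (EuclideanSpace.proj i : Coord (m + 1) →L[ℝ] ℝ) := by
  ext v
  have hv : v = ∑ i : Fin (m + 1), v i • EuclideanSpace.single i (1 : ℝ) := by
    ext j
    simp [Pi.single_apply]
  conv_lhs => rw [hv]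
  simp [mul_comm]

lemma apply_coordMetric (he : e ∈ IsManifold.maximalAtlas (𝓡 (m + 1)) ∞ M) (g : CoMetric m M)
    {z : Coord (m + 1)} (hz : z ∈ e.target) (θ η : Coord (m + 1) →L[ℝ] ℝ) :
    θ (coordMetric g e z η) = g.form (e.symm z) (θ ∘L coordDeriv e (e.symm z))
      (η ∘L coordDeriv e (e.symm z)) := by
  have key : ∀ L : Coord (m + 1) →L[ℝ] ℝ, (L ∘L coordDeriv e (e.symm z) : Cotan m (e.symm z)) =
      ∑ i : Fin (m + 1), L (EuclideanSpace.single i (1 : ℝ)) •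
        dAt m (fun q => e q i) (e.symm z) := by
    intro L
    conv_lhs => rw [covec_coord_eq_sum L]
    ext v
    simp [dAt_coord he (e.map_target hz)]
  rw [key θ, key η]
  simp only [coordMetric, map_sum, map_smul, LinearMap.sum_apply, LinearMap.smul_apply,
    sum_apply, smul_apply, ContinuousLinearMap.smulRight_apply,
    ContinuousLinearMap.apply_apply, smul_eq_mul]
  rw [Finset.sum_comm]
  refine Finset.sum_congr rfl fun j _ => ?_
  rw [Finset.mul_sum]
  refine Finset.sum_congr rfl fun i _ => ?_
  ring

lemma coordDeriv_sharp (he : e ∈ IsManifold.maximalAtlas (𝓡 (m + 1)) ∞ M) (g : CoMetric m M)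
    {z : Coord (m + 1)} (hz : z ∈ e.target) (η : Coord (m + 1) →L[ℝ] ℝ) :
    coordDeriv e (e.symm z) (g.sharp (e.symm z) (η ∘L coordDeriv e (e.symm z))) =
      coordMetric g e z η := by
  ext i
  have h := apply_coordMetric he g hz (EuclideanSpace.proj i) η
  rw [← g.apply_sharp] at h
  exact h.symm

lemma coordMetric_symm (he : e ∈ IsManifold.maximalAtlas (𝓡 (m + 1)) ∞ M) (g : CoMetric m M)
    {z : Coord (m + 1)} (hz : z ∈ e.target) (θ η : Coord (m + 1) →L[ℝ] ℝ) :
    θ (coordMetric g e z η) = η (coordMetric g e z θ) := by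
  rw [apply_coordMetric he g hz, apply_coordMetric he g hz, g.symm]

lemma coordMetric_nonneg (he : e ∈ IsManifold.maximalAtlas (𝓡 (m + 1)) ∞ M) (g : CoMetric m M)
    {z : Coord (m + 1)} (hz : z ∈ e.target) (θ : Coord (m + 1) →L[ℝ] ℝ) :
    0 ≤ θ (coordMetric g e z θ) := by
  rw [apply_coordMetric he g hz]
  exact g.nonneg _ _

lemma smoothFnOn_coord (he : e ∈ IsManifold.maximalAtlas (𝓡 (m + 1)) ∞ M) (i : Fin (m + 1)) :
    SmoothFnOn m (fun q => e q i) e.source :=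
  (EuclideanSpace.proj i : Coord (m + 1) →L[ℝ] ℝ).contDiff.contMDiff.comp_contMDiffOn
    (contMDiffOn_of_mem_maximalAtlas he)

lemma SmoothFnOn.contDiffOn_comp_symm (he : e ∈ IsManifold.maximalAtlas (𝓡 (m + 1)) ∞ M) {f : M → ℝ}
    {W : Set M} (hf : SmoothFnOn m f W) :
    ContDiffOn ℝ ∞ (fun z => f (e.symm z)) (e.target ∩ e.symm ⁻¹' W) := by
  rw [← contMDiffOn_iff_contDiffOn]
  exact ContMDiffOn.comp hf ((contMDiffOn_symm_of_mem_maximalAtlas he).mono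
    Set.inter_subset_left) (fun z hz => hz.2)

lemma contDiffOn_coordMetric (he : e ∈ IsManifold.maximalAtlas (𝓡 (m + 1)) ∞ M) (g : CoMetric m M) :
    ContDiffOn ℝ ∞ (coordMetric g e) e.target := by
  have h : ∀ i j : Fin (m + 1), ContDiffOn ℝ ∞ (fun z => g.form (e.symm z)
      (dAt m (fun q => e q i) (e.symm z)) (dAt m (fun q => e q j) (e.symm z))) e.target := by
    intro i j
    have h := (g.smooth e.source e.open_source _ _ (smoothFnOn_coord he i)
      (smoothFnOn_coord he j)).contDiffOn_comp_symm he
    exact h.mono fun z hz => ⟨hz, e.map_target hz⟩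
  unfold coordMetric
  exact ContDiffOn.sum fun i _ => ContDiffOn.sum fun j _ =>
    contDiffOn_smul_const (h i j) _

end Coordinates

end SubRiem

end

/-! ### Curvature as a weighted divergence in coordinates. -/

noncomputable section

namespace SubRiem

section Curvature

open Filter

variable {m : ℕ} {M : Type*} [TopologicalSpace M] [ChartedSpace (Coord (m + 1)) M]
  {e : OpenPartialHomeomorph M (Coord (m + 1))}

lemma topForm_apply (Ω : Coord (m + 1) [⋀^Fin (m + 1)]→L[ℝ] ℝ) (w : Fin (m + 1) → Coord (m + 1)) :
    Ω w = Ω (fun i => EuclideanSpace.single i (1 : ℝ)) *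
      (EuclideanSpace.basisFun (Fin (m + 1)) ℝ).toBasis.det w := by
  have h := AlternatingMap.eq_smul_basis_det (EuclideanSpace.basisFun (Fin (m + 1)) ℝ).toBasis
    Ω.toAlternatingMap
  have h2 := congrArg (fun f => f w) h
  have h3 : (fun i => EuclideanSpace.single i (1 : ℝ)) =
      ⇑(EuclideanSpace.basisFun (Fin (m + 1)) ℝ) := by
    funext i
    simp
  rw [h3]
  simpa using h2

/-- The identity `d (V ⌟ D) = (div V) D` for constant `D`. In each summand `wedge_contract_aux` with
`η = dx^i` leaves only the diagonal entry of `DV`. -/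
lemma extDeriv_curryLeft_apply (D : Coord (m + 1) [⋀^Fin (m + 1)]→L[ℝ] ℝ)
    {V : Coord (m + 1) → Coord (m + 1)} {z : Coord (m + 1)} (hV : DifferentiableAt ℝ V z) :
    extDeriv (fun z => D.curryLeft (V z)) z (fun i => EuclideanSpace.single i (1 : ℝ)) =
      LinearMap.trace ℝ (Coord (m + 1)) (fderiv ℝ V z : Coord (m + 1) →L[ℝ] Coord (m + 1)) *
        D (fun i => EuclideanSpace.single i (1 : ℝ)) := by
  have h1 : fderiv ℝ (fun z => D.curryLeft (V z)) z = D.curryLeft ∘L fderiv ℝ V z :=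
    (D.curryLeft.hasFDerivAt.comp z hV.hasFDerivAt).fderiv
  rw [extDeriv, h1, ContinuousAlternatingMap.alternatizeUncurryFin_apply,
    LinearMap.trace_eq_sum_inner _ (EuclideanSpace.basisFun (Fin (m + 1)) ℝ), Finset.sum_mul]
  refine Finset.sum_congr rfl fun i _ => ?_
  set w := fderiv ℝ V z (EuclideanSpace.single i (1 : ℝ)) with hw
  have h2 := wedge_contract_aux m (EuclideanSpace.proj i) D w
    (fun i => EuclideanSpace.single i (1 : ℝ))
  rw [Finset.sum_eq_single i] at h2
  · have e1 : inner ℝ (EuclideanSpace.basisFun (Fin (m + 1)) ℝ i)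
        ((fderiv ℝ V z : Coord (m + 1) →ₗ[ℝ] Coord (m + 1))
          (EuclideanSpace.basisFun (Fin (m + 1)) ℝ i)) = (EuclideanSpace.proj i) w := by
      simp [hw, EuclideanSpace.inner_single_left]
    rw [e1, ← h2]
    simp [Matrix.vecCons, hw]
  · intro k _ hk
    simp [hk.symm]
  · simp

/-- The pull-back of a form under the parametrization `e.symm`. -/
def coordForm (e : OpenPartialHomeomorph M (Coord (m + 1))) {n : ℕ} (α : ∀ y : M, Alt m n y)
    (z : Coord (m + 1)) : Coord (m + 1) [⋀^Fin n]→L[ℝ] ℝ :=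
  (α (e.symm z)).compContinuousLinearMap (coordInv e z)

lemma coordForm_coordDeriv (he : e ∈ IsManifold.maximalAtlas (𝓡 (m + 1)) ∞ M) {n : ℕ}
    (α : ∀ y : M, Alt m n y) {q : M} (hq : q ∈ e.source) (w : Fin n → Tan m q) :
    coordForm e α (e q) (fun i => coordDeriv e q (w i)) = α q w := by
  have hP : ∀ w : Fin n → Coord (m + 1),
      coordForm e α (e q) (fun i => coordDeriv e (e.symm (e q)) (w i)) = α (e.symm (e q)) w := by
    intro w
    refine congrArg (α (e.symm (e q))) (funext fun i => ?_)
    exact coordInv_coordDeriv he (e.map_source hq) (w i)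
  -- The tangent spaces at `e.symm (e q)` and at `q` are different types with the same model;
  -- quantifying over model vectors allows transport along `e.left_inv`.
  exact Eq.subst (motive := fun q' => ∀ w : Fin n → Coord (m + 1),
    coordForm e α (e q) (fun i => coordDeriv e q' (w i)) = α q' w) (e.left_inv hq) hP w

/-- The exterior derivative may be computed in arbitrary coordinates. -/
lemma extDerivM_eq [IsManifold (𝓡 (m + 1)) ∞ M] (he : e ∈ IsManifold.maximalAtlas (𝓡 (m + 1)) ∞ M)
    {n : ℕ} (α : ∀ y : M, Alt m n y) {q : M} (hq : q ∈ e.source)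
    (hα : DifferentiableAt ℝ (coordForm e α) (e q)) (w : Fin (n + 1) → Tan m q) :
    extDerivM α q w = extDeriv (coordForm e α) (e q) (fun i => coordDeriv e q (w i)) := by
  set c := chartAt (Coord (m + 1)) q with hc
  have hcm : c ∈ IsManifold.maximalAtlas (𝓡 (m + 1)) ∞ M := IsManifold.chart_mem_maximalAtlas q
  have hqc : q ∈ c.source := mem_chart_source _ q
  let τ : Coord (m + 1) → Coord (m + 1) := fun z => e (c.symm z)
  have hτq : τ (c q) = e q := by simp only [τ, c.left_inv hqc]
  have hnear : ∀ᶠ z in 𝓝 (c q), z ∈ c.target ∧ c.symm z ∈ e.source := by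
    have h1 : c.target ∈ 𝓝 (c q) := c.open_target.mem_nhds (c.map_source hqc)
    have h2 : ContinuousAt c.symm (c q) := c.continuousAt_symm (c.map_source hqc)
    refine Eventually.and h1 (h2.eventually ?_)
    rw [c.left_inv hqc]
    exact e.open_source.mem_nhds hq
  have hτd : ∀ z, z ∈ c.target → c.symm z ∈ e.source →
      HasFDerivAt τ ((coordDeriv e (c.symm z)) ∘L coordInv c z : Coord (m + 1) →L[ℝ] Coord (m + 1))
        z := by
    intro z hz hz'
    exact ((((mdifferentiable_of_mem_maximalAtlas he).mdifferentiableAt hz').hasMFDerivAt).comp z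
      ((mdifferentiable_of_mem_maximalAtlas hcm).mdifferentiableAt_symm hz).hasMFDerivAt).hasFDerivAt
  have hτs : ContDiffAt ℝ ∞ τ (c q) := by
    rw [← contMDiffAt_iff_contDiffAt]
    refine ContMDiffAt.comp (I' := 𝓡 (m + 1)) (c q) (g := e) (f := c.symm) ?_ ?_
    · rw [c.left_inv hqc]
      exact contMDiffAt_of_mem_maximalAtlas he hq
    · exact contMDiffAt_symm_of_mem_maximalAtlas hcm (c.map_source hqc)
  -- The two coordinate expressions differ by pull-back under the transition map `τ`, and `extDeriv`
  -- commutes with pull-backs.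
  have hpull : chartForm α q =ᶠ[𝓝 (c q)]
      fun z => (coordForm e α (τ z)).compContinuousLinearMap (fderiv ℝ τ z) := by
    filter_upwards [hnear] with z hz
    ext w
    rw [(hτd z hz.1 hz.2).fderiv]
    exact (coordForm_coordDeriv he α hz.2 (fun i => coordInv c z (w i))).symm
  have hex : extDeriv (chartForm α q) (c q) =
      (extDeriv (coordForm e α) (τ (c q))).compContinuousLinearMap (fderiv ℝ τ (c q)) := by
    rw [hpull.extDeriv_eq]
    exact extDeriv_pullback (r := ∞) (by rw [hτq]; exact hα) hτs
      (by rw [minSmoothness_of_isRCLikeNormedField]; exact WithTop.coe_le_coe.2 le_top)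
  have h1 : extDerivM α q w = extDeriv (chartForm α q) (c q) (fun i => coordDeriv c q (w i)) := rfl
  rw [h1, hex, hτq]
  refine congrArg (extDeriv (coordForm e α) (e q)) (funext fun i => ?_)
  have h2 := hτd (c q) (c.map_source hqc) (by rw [c.left_inv hqc]; exact hq)
  have h3 : ∀ v : Coord (m + 1),
      coordDeriv e (c.symm (c q)) (coordInv c (c q) (coordDeriv c (c.symm (c q)) v)) =
        coordDeriv e (c.symm (c q)) v := by
    intro v
    exact congrArg _ (coordInv_coordDeriv hcm (c.map_source hqc) v)
  show fderiv ℝ τ (c q) (coordDeriv c q (w i)) = _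
  rw [h2.fderiv]
  exact Eq.subst (motive := fun q' => ∀ v : Coord (m + 1),
    coordDeriv e (c.symm (c q)) (coordInv c (c q) (coordDeriv c q' v)) =
        coordDeriv e q' v) (c.left_inv hqc) h3 (w i)

lemma coordDensity_ne_zero [IsManifold (𝓡 (m + 1)) ∞ M]
    (he : e ∈ IsManifold.maximalAtlas (𝓡 (m + 1)) ∞ M) (dv : VolumeForm m M) {z : Coord (m + 1)}
    (hz : z ∈ e.target) : coordDensity dv e z ≠ 0 := by
  intro h0
  apply dv.ne_zero (e.symm z)
  ext w
  have h1 := coordForm_coordDeriv he dv.form (e.map_target hz) w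
  rw [← h1, e.right_inv hz, topForm_apply]
  have h2 : coordForm e dv.form z (fun i => EuclideanSpace.single i (1 : ℝ)) = 0 := h0
  rw [h2, zero_mul]
  rfl

end Curvature

end SubRiem

end

noncomputable section

namespace SubRiem

section Curvature

open Filter

variable {m : ℕ} {M : Type*} [TopologicalSpace M] [ChartedSpace (Coord (m + 1)) M]
  {e : OpenPartialHomeomorph M (Coord (m + 1))}

lemma mdifferentiableAt_of_comp_symm (he : e ∈ IsManifold.maximalAtlas (𝓡 (m + 1)) ∞ M) {φ : M → ℝ}
    {z : Coord (m + 1)} (hz : z ∈ e.target)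
    (hφ : DifferentiableAt ℝ (fun z => φ (e.symm z)) z) :
    MDifferentiableAt (𝓡 (m + 1)) 𝓘(ℝ, ℝ) φ (e.symm z) := by
  have h1 := (mdifferentiable_of_mem_maximalAtlas he).mdifferentiableAt (e.map_target hz)
  have h2 : MDifferentiableAt 𝓘(ℝ, Coord (m + 1)) 𝓘(ℝ, ℝ) (fun z => φ (e.symm z))
      (e (e.symm z)) := by
    rw [e.right_inv hz]
    exact hφ.mdifferentiableAt
  refine (h2.comp (e.symm z) h1).congr_of_eventuallyEq ?_
  filter_upwards [e.open_source.mem_nhds (e.map_target hz)] with q hq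
  simp [e.left_inv hq]

/-- The density of `dv` is absorbed into the flux, so the volume form contracted with it may be
constant, normalized on the coordinate frame. -/
lemma coordForm_areaForm [IsManifold (𝓡 (m + 1)) ∞ M]
    (he : e ∈ IsManifold.maximalAtlas (𝓡 (m + 1)) ∞ M) (g : CoMetric m M) (dv : VolumeForm m M)
    {φ : M → ℝ} {p : ℝ} {z : Coord (m + 1)} (hz : z ∈ e.target)
    (hφ : DifferentiableAt ℝ (fun z => φ (e.symm z)) z)
    {D : Coord (m + 1) [⋀^Fin (m + 1)]→L[ℝ] ℝ}
    (hD : D (fun i => EuclideanSpace.single i (1 : ℝ)) = 1) :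
    coordForm e (areaForm g dv φ p) z = D.curryLeft
      (flux (coordDensity dv e) (coordMetric g e) p (z, fderiv ℝ (fun z => φ (e.symm z)) z)) := by
  have hd := dAt_symm_eq he hz (mdifferentiableAt_of_comp_symm he hz hφ)
  set θ : Coord (m + 1) →L[ℝ] ℝ := fderiv ℝ (fun z => φ (e.symm z)) z with hθ
  have hnorm : g.norm (e.symm z) (dAt m φ (e.symm z)) = Real.sqrt (θ (coordMetric g e z θ)) := by
    rw [CoMetric.norm, hd, ← apply_coordMetric he g hz]
  have hsharp : g.sharp (e.symm z) (dAt m φ (e.symm z)) = coordInv e z (coordMetric g e z θ) := by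
    rw [← coordDeriv_sharp he g hz, coordInv_coordDeriv he hz, hd]
  ext w
  set r : ℝ := (Real.sqrt (θ (coordMetric g e z θ)) ^ (1 - p))⁻¹ with hr
  set k := coordMetric g e z θ with hk
  have h1 : coordForm e (areaForm g dv φ p) z w =
      coordForm e dv.form z (Fin.cons (r • k) w : Fin (m + 1) → Coord (m + 1)) := by
    show dv.form (e.symm z) (Fin.cons (g.sharp (e.symm z)
      ((g.norm (e.symm z) (dAt m φ (e.symm z)) ^ (1 - p))⁻¹ • dAt m φ (e.symm z)))
        (fun i => coordInv e z (w i)) : Fin (m + 1) → Tan m (e.symm z)) =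
      dv.form (e.symm z) (fun i => coordInv e z
        ((Fin.cons (r • k) w : Fin (m + 1) → Coord (m + 1)) i))
    congr 1
    funext i
    refine Fin.cases ?_ (fun i => ?_) i
    · simp only [Fin.cons_zero, map_smul, hsharp, hnorm, hr]
    · simp only [Fin.cons_succ]
  have h2 : D.curryLeft (flux (coordDensity dv e) (coordMetric g e) p (z, θ)) w =
      coordDensity dv e z * D (Fin.cons (r • k) w : Fin (m + 1) → Coord (m + 1)) := by
    simp only [flux, ← hk, ← hr]
    rw [mul_smul, map_smul]
    rfl
  rw [h1, h2, topForm_apply, topForm_apply D, hD, one_mul]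
  rfl

/-- The mean curvature is a weighted divergence in coordinates. -/
lemma meanCurv_symm [IsManifold (𝓡 (m + 1)) ∞ M]
    (he : e ∈ IsManifold.maximalAtlas (𝓡 (m + 1)) ∞ M) (g : CoMetric m M) (dv : VolumeForm m M)
    {φ : M → ℝ} {p : ℝ} {z : Coord (m + 1)} (hz : z ∈ e.target)
    (hφ : ContDiffAt ℝ ∞ (fun z => φ (e.symm z)) z)
    (hV : DifferentiableAt ℝ (fun z => flux (coordDensity dv e) (coordMetric g e) p
      (z, fderiv ℝ (fun z => φ (e.symm z)) z)) z) :
    meanCurv g dv φ p (e.symm z) = (coordDensity dv e z)⁻¹ * LinearMap.trace ℝ (Coord (m + 1))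
      (fderiv ℝ (fun z => flux (coordDensity dv e) (coordMetric g e) p
        (z, fderiv ℝ (fun z => φ (e.symm z)) z)) z : Coord (m + 1) →L[ℝ] Coord (m + 1)) := by
  have hA0 := coordDensity_ne_zero he dv hz
  let D : Coord (m + 1) [⋀^Fin (m + 1)]→L[ℝ] ℝ :=
    (coordDensity dv e z)⁻¹ • coordForm e dv.form z
  have hD : D (fun i => EuclideanSpace.single i (1 : ℝ)) = 1 := inv_mul_cancel₀ hA0
  set V := fun z => flux (coordDensity dv e) (coordMetric g e) p
      (z, fderiv ℝ (fun z => φ (e.symm z)) z) with hVdef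
  have hev : coordForm e (areaForm g dv φ p) =ᶠ[𝓝 z] fun z => D.curryLeft (V z) := by
    have h1 := (hφ.of_le (show (1 : ℕ∞ω) ≤ ∞ by simp)).eventually (by simp)
    filter_upwards [e.open_target.mem_nhds hz, h1] with y hy hy1
    exact coordForm_areaForm he g dv hy (hy1.differentiableAt one_ne_zero) hD
  have hdiff : DifferentiableAt ℝ (coordForm e (areaForm g dv φ p)) z :=
    (D.curryLeft.differentiableAt.comp z hV).congr_of_eventuallyEq hev
  have hsrc := e.map_target hz
  have h1 := extDerivM_eq he (areaForm g dv φ p) hsrc (by rw [e.right_inv hz]; exact hdiff)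
    (stdVec (e.symm z))
  have h2 := coordForm_coordDeriv he dv.form hsrc (stdVec (e.symm z))
  rw [e.right_inv hz] at h1 h2
  have hne : dv.form (e.symm z) (stdVec (e.symm z)) ≠ 0 := by
    intro h0
    apply dv.ne_zero (e.symm z)
    ext w
    have := topForm_apply (dv.form (e.symm z)) w
    exact this.trans (by erw [h0]; exact zero_mul _)
  rw [meanCurv, h1, ← h2, hev.extDeriv_eq, topForm_apply, topForm_apply (coordForm e dv.form z),
    extDeriv_curryLeft_apply D hV, hD, mul_one]
  have h3 : coordForm e dv.form z (fun i => EuclideanSpace.single i (1 : ℝ)) =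
    coordDensity dv e z := rfl
  rw [← h2, topForm_apply, h3] at hne
  rw [h3]
  -- Numerator and denominator carry the same determinant of the frame `stdVec`, which cancels.
  have hdet := right_ne_zero_of_mul hne
  field_simp

end Curvature

end SubRiem

end

/-! ### Vector fields and densities in coordinates. -/

noncomputable section

namespace SubRiem

section Fields

open Filter VectorField

variable {m : ℕ} {M : Type*} [TopologicalSpace M] [ChartedSpace (Coord (m + 1)) M]
  {e : OpenPartialHomeomorph M (Coord (m + 1))}

/-- A vector field in the coordinates `e`. -/
def coordField (e : OpenPartialHomeomorph M (Coord (m + 1))) (Z : ∀ x : M, Tan m x)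
    (z : Coord (m + 1)) : Coord (m + 1) :=
  coordDeriv e (e.symm z) (Z (e.symm z))

/-- The vector field on `M` with the coordinate expression `Y`. -/
def fieldOfCoord (e : OpenPartialHomeomorph M (Coord (m + 1))) (Y : Coord (m + 1) → Coord (m + 1))
    (q : M) : Tan m q :=
  mpullback (𝓡 (m + 1)) (𝓡 (m + 1)) e Y q

lemma inverse_coordDeriv (he : e ∈ IsManifold.maximalAtlas (𝓡 (m + 1)) ∞ M) {z : Coord (m + 1)}
    (hz : z ∈ e.target) : (coordDeriv e (e.symm z)).inverse = coordInv e z :=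
  ContinuousLinearMap.inverse_eq (by ext1 v; exact coordDeriv_coordInv he hz v)
    (by ext1 v; exact coordInv_coordDeriv he hz v)

lemma inverse_coordInv (he : e ∈ IsManifold.maximalAtlas (𝓡 (m + 1)) ∞ M) {z : Coord (m + 1)}
    (hz : z ∈ e.target) : (coordInv e z).inverse = coordDeriv e (e.symm z) :=
  ContinuousLinearMap.inverse_eq (by ext1 v; exact coordInv_coordDeriv he hz v)
    (by ext1 v; exact coordDeriv_coordInv he hz v)

lemma isInvertible_coordDeriv (he : e ∈ IsManifold.maximalAtlas (𝓡 (m + 1)) ∞ M) {z : Coord (m + 1)}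
    (hz : z ∈ e.target) : (coordDeriv e (e.symm z)).IsInvertible :=
  ContinuousLinearMap.IsInvertible.of_inverse (by ext1 v; exact coordDeriv_coordInv he hz v)
    (by ext1 v; exact coordInv_coordDeriv he hz v)

lemma isInvertible_coordInv (he : e ∈ IsManifold.maximalAtlas (𝓡 (m + 1)) ∞ M) {z : Coord (m + 1)}
    (hz : z ∈ e.target) : (coordInv e z).IsInvertible :=
  ContinuousLinearMap.IsInvertible.of_inverse (by ext1 v; exact coordInv_coordDeriv he hz v)
    (by ext1 v; exact coordDeriv_coordInv he hz v)

lemma fieldOfCoord_symm (he : e ∈ IsManifold.maximalAtlas (𝓡 (m + 1)) ∞ M)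
    (Y : Coord (m + 1) → Coord (m + 1)) {z : Coord (m + 1)} (hz : z ∈ e.target) :
    fieldOfCoord e Y (e.symm z) = coordInv e z (Y z) := by
  have h1 : fieldOfCoord e Y (e.symm z) = (coordDeriv e (e.symm z)).inverse (Y (e (e.symm z))) := rfl
  rw [h1, inverse_coordDeriv he hz, e.right_inv hz]

lemma coordField_fieldOfCoord (he : e ∈ IsManifold.maximalAtlas (𝓡 (m + 1)) ∞ M)
    (Y : Coord (m + 1) → Coord (m + 1)) {z : Coord (m + 1)} (hz : z ∈ e.target) :
    coordField e (fieldOfCoord e Y) z = Y z := by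
  rw [coordField, fieldOfCoord_symm he Y hz, coordDeriv_coordInv he hz]

lemma mpullback_symm_eq (he : e ∈ IsManifold.maximalAtlas (𝓡 (m + 1)) ∞ M) (Z : ∀ x : M, Tan m x)
    {z : Coord (m + 1)} (hz : z ∈ e.target) :
    mpullback (𝓡 (m + 1)) (𝓡 (m + 1)) e.symm Z z = coordField e Z z := by
  have h1 : mpullback (𝓡 (m + 1)) (𝓡 (m + 1)) e.symm Z z = (coordInv e z).inverse (Z (e.symm z)) :=
    rfl
  rw [h1, inverse_coordInv he hz, coordField]

variable [IsManifold (𝓡 (m + 1)) ∞ M]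

lemma smoothFieldOn_fieldOfCoord (he : e ∈ IsManifold.maximalAtlas (𝓡 (m + 1)) ∞ M)
    {Y : Coord (m + 1) → Coord (m + 1)} {N : Set (Coord (m + 1))} (hN : IsOpen N)
    (hY : ContDiffOn ℝ ∞ Y N) {W : Set M} (hW : W ⊆ e.source) (hWN : ∀ q ∈ W, e q ∈ N) :
    SmoothFieldOn (fieldOfCoord e Y) W := by
  intro q hq
  refine ContMDiffAt.contMDiffWithinAt ?_
  refine ContMDiffAt.mpullback_vectorField_preimage (n := ∞) ?_
    (contMDiffAt_of_mem_maximalAtlas he (hW hq)) ?_ (by norm_cast)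
  · exact contMDiffAt_vectorSpace_iff_contDiffAt.2 (hY.contDiffAt (hN.mem_nhds (hWN q hq)))
  · have h := isInvertible_coordDeriv he (e.map_source (hW hq))
    rw [e.left_inv (hW hq)] at h
    exact h

lemma SmoothFieldOn.contDiffOn_coordField (he : e ∈ IsManifold.maximalAtlas (𝓡 (m + 1)) ∞ M)
    {Z : ∀ x : M, Tan m x} {W : Set M} (hW : IsOpen W) (hZ : SmoothFieldOn Z W) :
    ContDiffOn ℝ ∞ (coordField e Z) (e.target ∩ e.symm ⁻¹' W) := by
  intro z hz
  refine ContDiffAt.contDiffWithinAt ?_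
  have h1 : ContMDiffAt (𝓡 (m + 1)) (𝓡 (m + 1)).tangent ∞
      (fun x => (⟨x, Z x⟩ : TangentBundle (𝓡 (m + 1)) M)) (e.symm z) :=
    hZ.contMDiffAt (hW.mem_nhds hz.2)
  have h2 := ContMDiffAt.mpullback_vectorField_preimage (n := ∞) h1
    (contMDiffAt_symm_of_mem_maximalAtlas he hz.1) (isInvertible_coordInv he hz.1) (by norm_cast)
  refine (contMDiffAt_vectorSpace_iff_contDiffAt.1 h2).congr_of_eventuallyEq ?_
  filter_upwards [e.open_target.mem_nhds hz.1] with y hy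
  exact (mpullback_symm_eq he Z hy).symm

/-- The Lie bracket is natural under pull-back by the parametrization `e.symm`. -/
lemma coordField_mlieBracket (he : e ∈ IsManifold.maximalAtlas (𝓡 (m + 1)) ∞ M)
    {Y Z : ∀ x : M, Tan m x} {W : Set M} (hW : IsOpen W) (hY : SmoothFieldOn Y W)
    (hZ : SmoothFieldOn Z W) {z : Coord (m + 1)} (hz : z ∈ e.target) (hzW : e.symm z ∈ W) :
    coordField e (mlieBracket (𝓡 (m + 1)) Y Z) z =
      lieBracket ℝ (coordField e Y) (coordField e Z) z := by
  have hev : ∀ V : ∀ x : M, Tan m x,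
      mpullback (𝓡 (m + 1)) (𝓡 (m + 1)) e.symm V =ᶠ[𝓝 z] coordField e V := by
    intro V
    filter_upwards [e.open_target.mem_nhds hz] with y hy
    exact mpullback_symm_eq he V hy
  have hman : IsManifold (𝓡 (m + 1)) (minSmoothness ℝ 2) M := by
    rw [minSmoothness_of_isRCLikeNormedField]; infer_instance
  have hman' : IsManifold (𝓡 (m + 1)) (minSmoothness ℝ 2) (Coord (m + 1)) := by
    rw [minSmoothness_of_isRCLikeNormedField]; infer_instance
  have h := mpullback_mlieBracket (I := 𝓡 (m + 1)) (I' := 𝓡 (m + 1)) (n := ∞) (f := e.symm)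
    (V := Y) (W := Z) (x₀ := z)
    ((hY.contMDiffAt (hW.mem_nhds hzW)).mdifferentiableAt (by simp))
    ((hZ.contMDiffAt (hW.mem_nhds hzW)).mdifferentiableAt (by simp))
    (contMDiffAt_symm_of_mem_maximalAtlas he hz)
    (by rw [minSmoothness_of_isRCLikeNormedField]; exact WithTop.coe_le_coe.2 le_top)
  rw [← mpullback_symm_eq he _ hz, h, ← mlieBracketWithin_univ,
    mlieBracketWithin_eq_lieBracketWithin]
  exact (congrFun (lieBracketWithin_univ (𝕜 := ℝ) (E := Coord (m + 1))) z).trans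
    ((hev Y).lieBracket_vectorField_eq (hev Z))

lemma SmoothFieldOn.mlieBracket {Y Z : ∀ x : M, Tan m x} {W : Set M} (hW : IsOpen W)
    (hY : SmoothFieldOn Y W) (hZ : SmoothFieldOn Z W) :
    SmoothFieldOn (mlieBracket (𝓡 (m + 1)) Y Z) W := by
  intro q hq
  have hman : IsManifold (𝓡 (m + 1)) (minSmoothness ℝ 2) M := by
    rw [minSmoothness_of_isRCLikeNormedField]; infer_instance
  have hman' : IsManifold (𝓡 (m + 1)) (((⊤ : ℕ∞) : ℕ∞ω) + 1) M :=
    inferInstanceAs (IsManifold (𝓡 (m + 1)) ∞ M)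
  exact (ContMDiffAt.mlieBracket_vectorField (m := ⊤) (n := ⊤) (hY.contMDiffAt (hW.mem_nhds hq))
    (hZ.contMDiffAt (hW.mem_nhds hq))
    (by rw [minSmoothness_of_isRCLikeNormedField]; norm_cast)).contMDiffWithinAt

lemma contDiffOn_coordDensity (he : e ∈ IsManifold.maximalAtlas (𝓡 (m + 1)) ∞ M)
    (dv : VolumeForm m M) : ContDiffOn ℝ ∞ (coordDensity dv e) e.target := by
  have h := (dv.smooth e.source e.open_source
    (fun i => fieldOfCoord e (fun _ => EuclideanSpace.single i (1 : ℝ)))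
    (fun i => smoothFieldOn_fieldOfCoord he isOpen_univ contDiffOn_const subset_rfl
      (fun _ _ => Set.mem_univ _))).contDiffOn_comp_symm he
  refine (h.mono fun z hz => ⟨hz, e.map_target hz⟩).congr fun z hz => ?_
  refine congrArg (dv.form (e.symm z)) (funext fun i => ?_)
  exact (fieldOfCoord_symm he (fun _ => EuclideanSpace.single i (1 : ℝ)) hz).symm

end Fields

end SubRiem

end

/-! ### Vertical translations in coordinates. -/

noncomputable section

namespace SubRiem

section Append

variable {m : ℕ}

/-- The last basis vector of `ℝ^{m+1}`. -/
abbrev lastVec (m : ℕ) : Coord (m + 1) := EuclideanSpace.single (Fin.last m) (1 : ℝ)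

/-- The projection to the first `m` coordinates as a continuous linear map. -/
def projL (m : ℕ) : Coord (m + 1) →L[ℝ] Coord m :=
  LinearMap.toContinuousLinearMap
    { toFun := proj
      map_add' := fun x y => by ext; simp [proj]
      map_smul' := fun c x => by ext; simp [proj] }

lemma contDiff_proj : ContDiff ℝ ∞ (proj : Coord (m + 1) → Coord m) := (projL m).contDiff

lemma proj_zero : proj (0 : Coord (m + 1)) = 0 := by ext; simp [proj]

lemma proj_add_smul_lastVec (z : Coord (m + 1)) (t : ℝ) : proj (z + t • lastVec m) = proj z := by
  ext j
  simp [proj, lastVec]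

lemma append_proj (z : Coord (m + 1)) (s : ℝ) :
    append (proj z) s = z + (s - z (Fin.last m)) • lastVec m := by
  ext j
  refine Fin.lastCases ?_ (fun j => ?_) j
  · simp [append, proj, lastVec]
  · simp [append, proj, lastVec]

lemma proj_append (x : Coord m) (s : ℝ) : proj (append x s) = x := by
  ext j
  simp [append, proj]

lemma continuous_append_zero : Continuous (fun x : Coord m => append x 0) := by
  refine (PiLp.continuous_toLp 2 _).comp (continuous_pi fun j => ?_)
  refine Fin.lastCases ?_ (fun j => ?_) j
  · simpa using continuous_const
  · simp only [Fin.snoc_castSucc]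
    fun_prop

lemma append_zero_zero : append (0 : Coord m) 0 = 0 := by
  ext j
  refine Fin.lastCases ?_ (fun j => ?_) j <;> simp [append]

/-- The defining function `u - x^{m+1}` of a graph in coordinates. -/
def coordGraphFn (u : Coord m → ℝ) (z : Coord (m + 1)) : ℝ := u (proj z) - z (Fin.last m)

lemma fderiv_coordGraphFn_add (u : Coord m → ℝ) (z : Coord (m + 1)) (t : ℝ) :
    fderiv ℝ (coordGraphFn u) (z + t • lastVec m) = fderiv ℝ (coordGraphFn u) z := by
  rw [← fderiv_comp_add_right]
  have : (fun y => coordGraphFn u (y + t • lastVec m)) = fun y => coordGraphFn u y - t := by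
    funext y
    simp only [coordGraphFn, proj_add_smul_lastVec]
    simp [lastVec]
    ring
  rw [this, fderiv_sub_const]

lemma fderiv_coordGraphFn_lastVec {u : Coord m → ℝ} {z : Coord (m + 1)}
    (hu : DifferentiableAt ℝ (coordGraphFn u) z) :
    fderiv ℝ (coordGraphFn u) z (lastVec m) = -1 := by
  have h1 : HasDerivAt (fun t : ℝ => z + t • lastVec m) (lastVec m) 0 := by
    simpa using ((hasDerivAt_id (0 : ℝ)).smul_const (lastVec m)).const_add z
  have h0 : HasFDerivAt (coordGraphFn u) (fderiv ℝ (coordGraphFn u) z) (z + (0 : ℝ) • lastVec m) := by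
    simpa using hu.hasFDerivAt
  have h2 : HasDerivAt (fun t : ℝ => coordGraphFn u (z + t • lastVec m))
      (fderiv ℝ (coordGraphFn u) z (lastVec m)) 0 :=
    HasFDerivAt.comp_hasDerivAt (f := fun t : ℝ => z + t • lastVec m) 0 h0 h1
  have h3 : (fun t : ℝ => coordGraphFn u (z + t • lastVec m)) = fun t => coordGraphFn u z - t := by
    funext t
    simp only [coordGraphFn, proj_add_smul_lastVec]
    simp [lastVec]
    ring
  rw [h3] at h2
  exact h2.unique ((hasDerivAt_id (0 : ℝ)).const_sub _)

end Append

section Translations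

open Filter

variable {m : ℕ} {M : Type*} [TopologicalSpace M] [ChartedSpace (Coord (m + 1)) M]
  [IsManifold (𝓡 (m + 1)) ∞ M] {e : OpenPartialHomeomorph M (Coord (m + 1))}
  {g : CoMetric m M} {dv : VolumeForm m M} {p₀ : M} {U : Set M} {δ : ℝ} {Ψ : ℝ → M → M} {S : Set M}

lemma eventually_translation_mem (hΨ : IsIsometricTranslations g dv p₀ U δ Ψ)
    (he : IsTranslationIsometricCoords dv p₀ U δ Ψ S e) :
    ∀ᶠ a : Coord (m + 1) × ℝ in 𝓝 (0, 0),
      a.1 ∈ e.target ∧ a.2 ∈ Set.Ioo (-δ) δ ∧ Ψ a.2 (e.symm a.1) ∈ e.source := by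
  have h0t : (0 : Coord (m + 1)) ∈ e.target := he.origin ▸ e.map_source he.mem
  have hs0 : e.symm 0 = p₀ := by rw [← he.origin, e.left_inv he.mem]
  have h1 : ∀ᶠ a : Coord (m + 1) × ℝ in 𝓝 (0, 0), a.1 ∈ e.target :=
    continuousAt_fst.eventually (e.open_target.mem_nhds h0t)
  have h2 : ∀ᶠ a : Coord (m + 1) × ℝ in 𝓝 (0, 0), a.2 ∈ Set.Ioo (-δ) δ :=
    continuousAt_snd.eventually (Ioo_mem_nhds (by simpa using hΨ.pos) (by simpa using hΨ.pos))
  have hc : ContinuousAt (fun z : ℝ × M => Ψ z.1 z.2) (0, p₀) :=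
    hΨ.smooth.continuousOn.continuousAt
      (prod_mem_nhds (Ioo_mem_nhds (by simpa using hΨ.pos) (by simpa using hΨ.pos))
        (hΨ.isOpen.mem_nhds hΨ.mem))
  have hc2 : ContinuousAt (fun a : Coord (m + 1) × ℝ => (a.2, e.symm a.1)) (0, 0) := by
    refine continuousAt_snd.prodMk ?_
    exact ContinuousAt.comp (g := e.symm) (f := Prod.fst) (e.continuousAt_symm h0t) continuousAt_fst
  have hc3 : Tendsto (fun a : Coord (m + 1) × ℝ => Ψ a.2 (e.symm a.1)) (𝓝 (0, 0)) (𝓝 p₀) := by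
    have hc' : Tendsto (fun z : ℝ × M => Ψ z.1 z.2) (𝓝 (0, p₀)) (𝓝 p₀) := by
      have := hc.tendsto
      simpa only [hΨ.zero p₀ hΨ.mem] using this
    refine Tendsto.comp (g := fun z : ℝ × M => Ψ z.1 z.2)
      (f := fun a : Coord (m + 1) × ℝ => (a.2, e.symm a.1)) hc' ?_
    have := hc2.tendsto
    simpa only [hs0] using this
  have h3 := hc3.eventually (e.open_source.mem_nhds he.mem)
  filter_upwards [h1, h2, h3] with a ha1 ha2 ha3 using ⟨ha1, ha2, ha3⟩

lemma coord_translation (he : IsTranslationIsometricCoords dv p₀ U δ Ψ S e) {q : M}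
    (hq : q ∈ e.source) {t : ℝ} (ht : t ∈ Set.Ioo (-δ) δ) (h : Ψ t q ∈ e.source) :
    e (Ψ t q) = e q + t • lastVec m := by
  ext j
  refine Fin.lastCases ?_ (fun j => ?_) j
  · rw [he.coord_last q hq t ht h]
    simp [lastVec]
  · rw [he.coord_castSucc q hq t ht h]
    simp [lastVec]

/-- `Ψ t` changes each coordinate by a constant, so it pulls each coordinate differential back to
itself; the isometry property then applies. -/
lemma form_coord_translation (hΨ : IsIsometricTranslations g dv p₀ U δ Ψ)
    (he : IsTranslationIsometricCoords dv p₀ U δ Ψ S e) {q : M} (hq : q ∈ e.source) {t : ℝ}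
    (ht : t ∈ Set.Ioo (-δ) δ) (h : Ψ t q ∈ e.source) (i j : Fin (m + 1)) :
    g.form (Ψ t q) (dAt m (fun q => e q i) (Ψ t q)) (dAt m (fun q => e q j) (Ψ t q)) =
      g.form q (dAt m (fun q => e q i) q) (dAt m (fun q => e q j) q) := by
  have hUq : q ∈ U := he.subset hq
  have hmd : MDifferentiableAt (𝓡 (m + 1)) (𝓡 (m + 1)) (Ψ t) q :=
    (hΨ.localDiffeo t ht ⟨q, hUq⟩).mdifferentiableAt (by simp)
  have key : ∀ k : Fin (m + 1), (dAt m (fun q => e q k) (Ψ t q)).comp (tanMap m (Ψ t) q) =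
      dAt m (fun q => e q k) q := by
    intro k
    have hk : ∀ q' ∈ e.source, MDifferentiableAt (𝓡 (m + 1)) 𝓘(ℝ, ℝ) (fun q => e q k) q' :=
      fun q' hq' => ((smoothFnOn_coord he.mem_atlas k).contMDiffAt
        (e.open_source.mem_nhds hq')).mdifferentiableAt (by simp)
    have h1 : HasMFDerivAt (𝓡 (m + 1)) 𝓘(ℝ, ℝ) (fun q' => e (Ψ t q') k) q
        ((dAt m (fun q => e q k) (Ψ t q)).comp (tanMap m (Ψ t) q)) :=
      (hk _ h).hasMFDerivAt.comp q hmd.hasMFDerivAt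
    have h2 : HasMFDerivAt (𝓡 (m + 1)) 𝓘(ℝ, ℝ) (fun q' => e q' k + (t • lastVec m) k) q
        (dAt m (fun q => e q k) q) := by
      have := (hk q hq).hasMFDerivAt.add
        (hasMFDerivAt_const (I := 𝓡 (m + 1)) (I' := 𝓘(ℝ, ℝ)) ((t • lastVec m) k) q)
      exact this.congr_mfderiv (add_zero (dAt m (fun q => e q k) q))
    refine hasMFDerivAt_unique h1 (h2.congr_of_eventuallyEq ?_)
    filter_upwards [e.open_source.mem_nhds hq,
      hmd.continuousAt.eventually (e.open_source.mem_nhds h)] with q' h3 h4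
    rw [coord_translation he h3 ht h4]
    rfl
  have := hΨ.isometry t ht q hUq (he.subset h) (dAt m (fun q => e q i) (Ψ t q))
    (dAt m (fun q => e q j) (Ψ t q))
  rw [key, key] at this
  exact this.symm

/-- In translation-isometric coordinates the metric and the density do not depend on the last
coordinate. -/
lemma exists_translation_invariant (hΨ : IsIsometricTranslations g dv p₀ U δ Ψ)
    (he : IsTranslationIsometricCoords dv p₀ U δ Ψ S e) :
    ∃ ε > 0, ∀ z ∈ Metric.ball (0 : Coord (m + 1)) ε, ∀ t : ℝ, |t| < ε →
      z + t • lastVec m ∈ e.target ∧ coordMetric g e (z + t • lastVec m) = coordMetric g e z ∧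
        coordDensity dv e (z + t • lastVec m) = coordDensity dv e z := by
  obtain ⟨ε, hε, hball⟩ := Metric.mem_nhds_iff.1 (eventually_translation_mem hΨ he)
  refine ⟨ε, hε, fun z hz t ht => ?_⟩
  obtain ⟨hzt, htδ, hsrc⟩ : z ∈ e.target ∧ t ∈ Set.Ioo (-δ) δ ∧ Ψ t (e.symm z) ∈ e.source := by
    refine hball (a := (z, t)) ?_
    rw [← ball_prod_same]
    exact ⟨hz, by simpa [Real.dist_eq] using ht⟩
  have hq := e.map_target hzt
  have hcoord := coord_translation he hq htδ hsrc
  rw [e.right_inv hzt] at hcoord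
  have hsymm : e.symm (z + t • lastVec m) = Ψ t (e.symm z) := by
    rw [← hcoord, e.left_inv hsrc]
  refine ⟨hcoord ▸ e.map_source hsrc, ?_, ?_⟩
  · simp only [coordMetric]
    refine Finset.sum_congr rfl fun i _ => Finset.sum_congr rfl fun j _ => ?_
    congr 1
    rw [hsymm]
    exact form_coord_translation hΨ he hq htδ hsrc i j
  · have h := he.density_eq _ hq t htδ hsrc
    have e1 : ∀ q, density dv e q = coordDensity dv e (e q) := fun q => rfl
    rw [e1, e1, hcoord, e.right_inv hzt] at h
    exact h

end Translations

end SubRiem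

end

/-! ### Curvature of graphs, extended along vertical lines. -/

section FluxAlong

open Filter

variable {E : Type*} [NormedAddCommGroup E] [InnerProductSpace ℝ E]

lemma contDiffAt_flux_fderiv {A : E → ℝ} {G : E → (E →L[ℝ] ℝ) →L[ℝ] E} {p : ℝ} {φ : E → ℝ} {x : E}
    (hA : ContDiffAt ℝ ∞ A x) (hG : ContDiffAt ℝ ∞ G x) (hφ : ContDiffAt ℝ ∞ φ x)
    (hθ : 0 < fderiv ℝ φ x (G x (fderiv ℝ φ x))) :
    ContDiffAt ℝ ∞ (fun z => flux A G p (z, fderiv ℝ φ z)) x := by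
  have h1 : ContDiffAt ℝ ∞ (fderiv ℝ φ) x := hφ.fderiv_right (by norm_cast)
  have h2 : ContDiffAt ℝ ∞ (fun z => (z, fderiv ℝ φ z)) x := contDiffAt_id.prodMk h1
  exact ContDiffAt.comp (g := flux A G p) (f := fun z => (z, fderiv ℝ φ z)) x
    (contDiffAt_flux hA hG hθ) h2

lemma fderiv_flux_translate {A : E → ℝ} {G : E → (E →L[ℝ] ℝ) →L[ℝ] E} {p : ℝ} {φ : E → ℝ} {x a : E}
    (hA : ∀ᶠ z in 𝓝 x, A (z + a) = A z) (hG : ∀ᶠ z in 𝓝 x, G (z + a) = G z)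
    (hφ : ∀ z, fderiv ℝ φ (z + a) = fderiv ℝ φ z) :
    fderiv ℝ (fun z => flux A G p (z, fderiv ℝ φ z)) (x + a) =
      fderiv ℝ (fun z => flux A G p (z, fderiv ℝ φ z)) x := by
  rw [← fderiv_comp_add_right]
  refine Filter.EventuallyEq.fderiv_eq ?_
  filter_upwards [hA, hG] with z h1 h2
  simp only [flux, h1, h2, hφ]

end FluxAlong

noncomputable section

namespace SubRiem

section Graphs

open Filter

variable {m : ℕ} {M : Type*} [TopologicalSpace M] [ChartedSpace (Coord (m + 1)) M]
  {e : OpenPartialHomeomorph M (Coord (m + 1))} {u : Coord m → ℝ}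

lemma isOpen_baseDomain (e : OpenPartialHomeomorph M (Coord (m + 1))) : IsOpen (baseDomain e) :=
  e.open_target.preimage continuous_append_zero

lemma IsGraph.contDiffAt_coordGraphFn (hu : IsGraph e u) {z : Coord (m + 1)}
    (hz : proj z ∈ baseDomain e) : ContDiffAt ℝ ∞ (coordGraphFn u) z := by
  have h1 : ContDiffAt ℝ ∞ u (proj z) := hu.1.contDiffAt ((isOpen_baseDomain e).mem_nhds hz)
  have h2 : ContDiffAt ℝ ∞ (fun z : Coord (m + 1) => z (Fin.last m)) z :=
    (EuclideanSpace.proj (𝕜 := ℝ) (Fin.last m) : Coord (m + 1) →L[ℝ] ℝ).contDiff.contDiffAt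
  exact (h1.comp z contDiff_proj.contDiffAt).sub h2

lemma graphFn_symm_eventuallyEq {z : Coord (m + 1)} (hz : z ∈ e.target) :
    (fun z => graphFn e u (e.symm z)) =ᶠ[𝓝 z] coordGraphFn u := by
  filter_upwards [e.open_target.mem_nhds hz] with y hy
  simp only [graphFn, coordGraphFn, e.right_inv hy]

variable [IsManifold (𝓡 (m + 1)) ∞ M] {g : CoMetric m M} {dv : VolumeForm m M}

lemma IsNonsingularGraph.pos (he : e ∈ IsManifold.maximalAtlas (𝓡 (m + 1)) ∞ M) (hu : IsGraph e u)
    (hu' : IsNonsingularGraph g e u) {x : Coord m} (hx : x ∈ baseDomain e) :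
    0 < fderiv ℝ (coordGraphFn u) (append x (u x)) (coordMetric g e (append x (u x))
      (fderiv ℝ (coordGraphFn u) (append x (u x)))) := by
  have hz : append x (u x) ∈ e.target := hu.2 x hx
  have hev := graphFn_symm_eventuallyEq (u := u) hz
  have hφ : ContDiffAt ℝ ∞ (fun z => graphFn e u (e.symm z)) (append x (u x)) :=
    (hu.contDiffAt_coordGraphFn (by rwa [proj_append])).congr_of_eventuallyEq hev
  have hm := mdifferentiableAt_of_comp_symm he hz (hφ.differentiableAt (by simp))
  have h := hu' x hx
  rw [CoMetric.norm, graphPoint, dAt_symm_eq he hz hm, hev.fderiv_eq,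
    ← apply_coordMetric he g hz] at h
  exact Real.sqrt_pos.1 (lt_of_le_of_ne (Real.sqrt_nonneg _) (Ne.symm h))

lemma IsNonsingularGraph.graphCurv_eq (he : e ∈ IsManifold.maximalAtlas (𝓡 (m + 1)) ∞ M)
    (hu : IsGraph e u) (hu' : IsNonsingularGraph g e u) (p : ℝ) {x : Coord m}
    (hx : x ∈ baseDomain e) :
    graphCurv g dv e p u x = (coordDensity dv e (append x (u x)))⁻¹ *
      LinearMap.trace ℝ (Coord (m + 1))
        (fderiv ℝ (fun z => flux (coordDensity dv e) (coordMetric g e) p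
          (z, fderiv ℝ (coordGraphFn u) z)) (append x (u x)) :
            Coord (m + 1) →L[ℝ] Coord (m + 1)) := by
  have hz : append x (u x) ∈ e.target := hu.2 x hx
  have hev := graphFn_symm_eventuallyEq (u := u) hz
  have hc := hu.contDiffAt_coordGraphFn (z := append x (u x)) (by rwa [proj_append])
  have hφ : ContDiffAt ℝ ∞ (fun z => graphFn e u (e.symm z)) (append x (u x)) :=
    hc.congr_of_eventuallyEq hev
  have hV := (contDiffAt_flux_fderiv (p := p)
    ((contDiffOn_coordDensity he dv).contDiffAt (e.open_target.mem_nhds hz))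
    ((contDiffOn_coordMetric he g).contDiffAt (e.open_target.mem_nhds hz)) hc
    (hu'.pos he hu hx)).differentiableAt (by simp)
  have hev2 : (fun z => flux (coordDensity dv e) (coordMetric g e) p
      (z, fderiv ℝ (fun z => graphFn e u (e.symm z)) z)) =ᶠ[𝓝 (append x (u x))]
      fun z => flux (coordDensity dv e) (coordMetric g e) p (z, fderiv ℝ (coordGraphFn u) z) := by
    filter_upwards [hev.fderiv (𝕜 := ℝ)] with y hy
    rw [hy]
  rw [graphCurv, graphPoint, meanCurv_symm he g dv hz hφ (hV.congr_of_eventuallyEq hev2),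
    hev2.fderiv_eq]

variable {p₀ : M} {U : Set M} {δ : ℝ} {Ψ : ℝ → M → M} {S : Set M}

/-- Near the origin a nonsingular graph through the origin has, in translation-isometric
coordinates, a nondegenerate defining function whose weighted divergence at any point is the
curvature of the graph below it. -/
lemma eventually_graphCurv_proj (hΨ : IsIsometricTranslations g dv p₀ U δ Ψ)
    (he : IsTranslationIsometricCoords dv p₀ U δ Ψ S e) (hu : IsGraph e u)
    (hu' : IsNonsingularGraph g e u) (hu0 : u 0 = 0) (p : ℝ) :
    ∀ᶠ z in 𝓝 (0 : Coord (m + 1)), z ∈ e.target ∧ proj z ∈ baseDomain e ∧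
      0 < fderiv ℝ (coordGraphFn u) z (coordMetric g e z (fderiv ℝ (coordGraphFn u) z)) ∧
      graphCurv g dv e p u (proj z) = (coordDensity dv e z)⁻¹ *
        LinearMap.trace ℝ (Coord (m + 1))
          (fderiv ℝ (fun z => flux (coordDensity dv e) (coordMetric g e) p
            (z, fderiv ℝ (coordGraphFn u) z)) z : Coord (m + 1) →L[ℝ] Coord (m + 1)) := by
  obtain ⟨ε, hε, hinv⟩ := exists_translation_invariant hΨ he
  have h0t : (0 : Coord (m + 1)) ∈ e.target := he.origin ▸ e.map_source he.mem
  have h0b : proj (0 : Coord (m + 1)) ∈ baseDomain e := by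
    rw [proj_zero]
    change append (0 : Coord m) 0 ∈ e.target
    rwa [append_zero_zero]
  have hcont : ContinuousAt (coordGraphFn u) 0 := (hu.contDiffAt_coordGraphFn h0b).continuousAt
  have h00 : coordGraphFn u 0 = 0 := by simp [coordGraphFn, proj_zero, hu0]
  have hsmall : ∀ᶠ z in 𝓝 (0 : Coord (m + 1)), |coordGraphFn u z| < ε := by
    have := hcont.tendsto.abs
    rw [h00, abs_zero] at this
    exact this.eventually (gt_mem_nhds hε)
  filter_upwards [e.open_target.mem_nhds h0t, Metric.ball_mem_nhds _ hε, hsmall,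
    contDiff_proj.continuous.continuousAt.eventually ((isOpen_baseDomain e).mem_nhds h0b)]
    with z hz hzε ht hzb
  -- The graph point on the vertical line of `z` is a translate of `z` by `coordGraphFn u z`. This
  -- amount is small near the origin, and it is held fixed while `y` varies near `z` below.
  have happ : append (proj z) (u (proj z)) = z + coordGraphFn u z • lastVec m := append_proj z _
  have hpos := hu'.pos he.mem_atlas hu hzb
  have hcurv := hu'.graphCurv_eq (dv := dv) he.mem_atlas hu p hzb
  obtain ⟨-, hG, hA⟩ := hinv z hzε _ ht
  rw [happ, fderiv_coordGraphFn_add, hG] at hpos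
  refine ⟨hz, hzb, hpos, ?_⟩
  rw [hcurv, happ, hA, fderiv_flux_translate]
  · filter_upwards [Metric.isOpen_ball.mem_nhds hzε] with y hy using (hinv y hy _ ht).2.2
  · filter_upwards [Metric.isOpen_ball.mem_nhds hzε] with y hy using (hinv y hy _ ht).2.1
  · exact fun y => fderiv_coordGraphFn_add u y _

end Graphs

end SubRiem

end

/-! ### Exterior normals and horizontal fields tangent to level sets. -/

section HorizontalFields

open Filter

variable {E : Type*} [NormedAddCommGroup E] [InnerProductSpace ℝ E]

/-- A closed set whose exterior normals vanish near one of its points is a neighbourhood of it. -/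
lemma mem_nhds_of_normal_trivial [ProperSpace E] {F N : Set E} {x₀ : E} (hF : IsClosed F)
    (hx : x₀ ∈ F) (hN : N ∈ 𝓝 x₀)
    (h : ∀ y ∈ F ∩ N, ∀ c, (∀ z ∈ F, ‖c - y‖ ≤ ‖c - z‖) → c = y) : F ∈ 𝓝 x₀ := by
  obtain ⟨r, hr, hball⟩ := Metric.mem_nhds_iff.1 hN
  -- Half the radius keeps the nearest point of `x` inside `N`, as it is at most twice as far from
  -- `x₀` as `x`.
  filter_upwards [Metric.ball_mem_nhds x₀ (half_pos hr)] with x hxr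
  obtain ⟨y, hyF, hy⟩ := hF.exists_infDist_eq_dist ⟨x₀, hx⟩ x
  have hmin : ∀ z ∈ F, ‖x - y‖ ≤ ‖x - z‖ := by
    intro z hz
    rw [← dist_eq_norm, ← dist_eq_norm, ← hy]
    exact Metric.infDist_le_dist_of_mem hz
  have hyN : y ∈ N := by
    refine hball ?_
    have h1 := hmin x₀ hx
    rw [← dist_eq_norm, ← dist_eq_norm] at h1
    rw [Metric.mem_ball] at hxr ⊢
    have h2 := dist_triangle_left y x₀ x
    linarith
  rw [h y ⟨hyF, hyN⟩ x hmin]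
  exact hyF

/-- `S` has codimension at most one and lies in the kernel of `θ`, while `a` does not, so together
they span `E`. -/
lemma eq_zero_of_inner_eq_zero [FiniteDimensional ℝ E] {S : Submodule ℝ E} {θ : E →L[ℝ] ℝ} {a ν : E}
    (hS : ∀ x ∈ S, θ x = 0) (ha : θ a ≠ 0) (hdim : Module.finrank ℝ E ≤ Module.finrank ℝ S + 1)
    (hν : ∀ x ∈ S, inner ℝ x ν = 0) (haν : inner ℝ a ν = 0) : ν = 0 := by
  have hlt : S < S ⊔ Submodule.span ℝ {a} := by
    refine lt_of_le_of_ne le_sup_left fun h => ha (hS a ?_)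
    rw [h]
    exact Submodule.mem_sup_right (Submodule.mem_span_singleton_self a)
  have htop : S ⊔ Submodule.span ℝ {a} = ⊤ :=
    Submodule.eq_top_of_finrank_eq (le_antisymm (Submodule.finrank_le _)
      (hdim.trans (Submodule.finrank_lt_finrank_of_lt hlt)))
  have hmem : ν ∈ S ⊔ Submodule.span ℝ {a} := htop ▸ Submodule.mem_top
  obtain ⟨s, hs, t, ht, hst⟩ := Submodule.mem_sup.1 hmem
  obtain ⟨c, rfl⟩ := Submodule.mem_span_singleton.1 ht
  have : inner ℝ ν ν = 0 := by
    nth_rewrite 1 [← hst]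
    rw [inner_add_left, hν s hs, inner_smul_left, haν]
    simp
  exact inner_self_eq_zero.1 this

/-- Differentiate `dφ(X) = 0` along `Y` and `dφ(Y) = 0` along `X`; the Hessian terms cancel by
symmetry. -/
lemma fderiv_apply_lieBracket_eq_zero {N : Set E} (hN : IsOpen N) {φ : E → ℝ} {X Y : E → E}
    (hφ : ContDiffOn ℝ ∞ φ N) (hX : ContDiffOn ℝ ∞ X N) (hY : ContDiffOn ℝ ∞ Y N)
    (hφX : ∀ z ∈ N, fderiv ℝ φ z (X z) = 0) (hφY : ∀ z ∈ N, fderiv ℝ φ z (Y z) = 0) {z : E}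
    (hz : z ∈ N) : fderiv ℝ φ z (VectorField.lieBracket ℝ X Y z) = 0 := by
  have hφz : ContDiffAt ℝ ∞ φ z := hφ.contDiffAt (hN.mem_nhds hz)
  have hd : ContDiffAt ℝ ∞ (fderiv ℝ φ) z := hφz.fderiv_right (by norm_cast)
  have hd' := (hd.differentiableAt (by simp)).hasFDerivAt
  have hsymm : IsSymmSndFDerivAt ℝ φ z :=
    hφz.isSymmSndFDerivAt (by
      rw [minSmoothness_of_isRCLikeNormedField]; exact WithTop.coe_le_coe.2 le_top)
  have key : ∀ V : E → E, ContDiffOn ℝ ∞ V N → (∀ z ∈ N, fderiv ℝ φ z (V z) = 0) → ∀ w,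
      fderiv ℝ φ z (fderiv ℝ V z w) + fderiv ℝ (fderiv ℝ φ) z w (V z) = 0 := by
    intro V hV hφV w
    have hVz := ((hV.contDiffAt (hN.mem_nhds hz)).differentiableAt (by simp)).hasFDerivAt
    have h1 := hd'.clm_apply hVz
    have h2 : HasFDerivAt (fun z => fderiv ℝ φ z (V z)) (0 : E →L[ℝ] ℝ) z := by
      refine (hasFDerivAt_const (0 : ℝ) z).congr_of_eventuallyEq ?_
      filter_upwards [hN.mem_nhds hz] with y hy using hφV y hy
    have h3 := congrArg (fun L : E →L[ℝ] ℝ => L w) (h1.unique h2)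
    simpa using h3
  have h1 := key Y hY hφY (X z)
  have h2 := key X hX hφX (Y z)
  have h3 := hsymm.eq (X z) (Y z)
  rw [VectorField.lieBracket, map_sub]
  linarith

/-- The field `z ↦ G_z η` made tangent to the level sets of a function with differential `θ`. -/
noncomputable def horizField (G : E → (E →L[ℝ] ℝ) →L[ℝ] E) (θ : E → E →L[ℝ] ℝ) (η : E →L[ℝ] ℝ)
    (z : E) : E :=
  G z (η - (η (G z (θ z)) / θ z (G z (θ z))) • θ z)

lemma horizField_covec_apply {G : E → (E →L[ℝ] ℝ) →L[ℝ] E} {θ : E → E →L[ℝ] ℝ} (η : E →L[ℝ] ℝ) {z : E}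
    (hθ : 0 < θ z (G z (θ z))) :
    (η - (η (G z (θ z)) / θ z (G z (θ z))) • θ z) (G z (θ z)) = 0 := by
  rw [sub_apply, smul_apply, smul_eq_mul, div_mul_cancel₀ _ hθ.ne', sub_self]

lemma contDiffOn_horizField {G : E → (E →L[ℝ] ℝ) →L[ℝ] E} {θ : E → E →L[ℝ] ℝ} (η : E →L[ℝ] ℝ)
    {N : Set E} (hG : ContDiffOn ℝ ∞ G N) (hθ : ContDiffOn ℝ ∞ θ N)
    (hpos : ∀ z ∈ N, 0 < θ z (G z (θ z))) : ContDiffOn ℝ ∞ (horizField G θ η) N := by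
  have h1 : ContDiffOn ℝ ∞ (fun z => G z (θ z)) N := hG.clm_apply hθ
  have h2 : ContDiffOn ℝ ∞ (fun z => θ z (G z (θ z))) N := hθ.clm_apply h1
  have h3 : ContDiffOn ℝ ∞ (fun z => η (G z (θ z))) N := contDiffOn_const.clm_apply h1
  have h4 := (h3.div h2 fun z hz => (hpos z hz).ne').smul hθ
  exact hG.clm_apply (contDiffOn_const.sub h4)

/-- The values of these fields at `z`, together with `G θ`, span the range of `G`, so projecting off
`θ` loses at most one dimension. -/
lemma exists_linearIndependent_horizField [FiniteDimensional ℝ E] (G : E → (E →L[ℝ] ℝ) →L[ℝ] E)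
    (θ : E → E →L[ℝ] ℝ) (z : E) {k : ℕ} (hk : k ≤ Module.finrank ℝ (LinearMap.range (G z).toLinearMap) - 1) :
    ∃ η : Fin k → E →L[ℝ] ℝ, LinearIndependent ℝ (fun i => horizField G θ (η i) z) := by
  let L : (E →L[ℝ] ℝ) →ₗ[ℝ] E :=
    { toFun := fun η => horizField G θ η z
      map_add' := fun η ζ => by
        simp only [horizField, add_apply, add_div, add_smul, map_add, map_sub]; abel
      map_smul' := fun c η => by
        simp only [horizField, smul_apply, smul_eq_mul, map_sub, map_smul, smul_sub, mul_div_assoc,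
          mul_smul, RingHom.id_apply] }
  have hle : LinearMap.range (G z).toLinearMap ≤
      LinearMap.range L ⊔ Submodule.span ℝ {G z (θ z)} := by
    rintro _ ⟨η, rfl⟩
    refine Submodule.mem_sup.2 ⟨L η, ⟨η, rfl⟩, (η (G z (θ z)) / θ z (G z (θ z))) • G z (θ z),
      Submodule.smul_mem _ _ (Submodule.mem_span_singleton_self _), ?_⟩
    simp [L, horizField]
  have hdim : k ≤ Module.finrank ℝ (LinearMap.range L) := by
    have h1 := Submodule.finrank_mono hle
    have h2 := Submodule.finrank_add_le_finrank_add_finrank (LinearMap.range L)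
      (Submodule.span ℝ {G z (θ z)})
    have h3 := finrank_span_le_card (R := ℝ) ({G z (θ z)} : Set E)
    rw [Set.toFinset_singleton, Finset.card_singleton] at h3
    omega
  let b := Module.finBasis ℝ (LinearMap.range L)
  choose η hη using fun i => (b i).2
  refine ⟨fun i => η (Fin.castLE hdim i), ?_⟩
  have h1 : LinearIndependent ℝ (fun i => ((b i : LinearMap.range L) : E)) :=
    b.linearIndependent.map' (LinearMap.range L).subtype (Submodule.ker_subtype _)
  have h2 := h1.comp (Fin.castLE hdim) (Fin.castLE_injective hdim)
  have h3 : (fun i => horizField G θ (η (Fin.castLE hdim i)) z) =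
      (fun i => ((b i : LinearMap.range L) : E)) ∘ Fin.castLE hdim :=
    funext fun i => hη (Fin.castLE hdim i)
  rwa [h3]

end HorizontalFields

section Tangency

open Filter

variable {E : Type*} [NormedAddCommGroup E] [InnerProductSpace ℝ E]

/-- First variation of the squared distance: when `F` contains a segment through `y` in direction
`a`, both signs of `t` are allowed. -/
lemma inner_eq_zero_of_eventually_norm_le {a ν : E} (h : ∀ᶠ t in 𝓝 (0 : ℝ), ‖ν‖ ≤ ‖ν - t • a‖) :
    inner ℝ a ν = 0 := by
  have h1 : HasDerivAt (fun t : ℝ => ν - t • a) (-a) 0 := by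
    simpa using ((hasDerivAt_id (0 : ℝ)).smul_const a).const_sub ν
  have hmin : IsLocalMin (fun t : ℝ => ‖ν - t • a‖ ^ 2) 0 := by
    filter_upwards [h] with t ht
    simpa using pow_le_pow_left₀ (norm_nonneg _) ht 2
  have h2 := hmin.hasDerivAt_eq_zero h1.norm_sq
  rw [zero_smul, sub_zero, inner_neg_right, real_inner_comm] at h2
  linarith

/-- The coincidence set of two ordered functions with ordered weighted divergences is invariant
under the fields of the degenerate operator tangent to the level sets. -/
lemma isTangentOn_horizField [FiniteDimensional ℝ E] {B F : Set E} (hB : IsOpen B) {A : E → ℝ}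
    {G : E → (E →L[ℝ] ℝ) →L[ℝ] E} {p : ℝ} (hp : 0 ≤ p) {φ w : E → ℝ} {C : ℝ} (hC : 0 ≤ C)
    (hA : ContDiffOn ℝ ∞ A B) (hA0 : ∀ x ∈ B, A x ≠ 0) (hG : ContDiffOn ℝ ∞ G B)
    (hs : ∀ x ∈ B, ∀ θ η : E →L[ℝ] ℝ, θ (G x η) = η (G x θ))
    (hpos : ∀ x ∈ B, ∀ θ : E →L[ℝ] ℝ, 0 ≤ θ (G x θ)) (hφ : ContDiffOn ℝ ∞ φ B)
    (hφpos : ∀ x ∈ B, 0 < fderiv ℝ φ x (G x (fderiv ℝ φ x))) (hw : ContDiffOn ℝ ∞ w B)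
    (hw0 : ∀ x ∈ B, 0 ≤ w x)
    (hineq : ∀ x ∈ B, LinearMap.trace ℝ E
      (((A x)⁻¹ • (fderiv ℝ (flux A G p) (x, fderiv ℝ φ x) ∘L
        ContinuousLinearMap.inr ℝ E (E →L[ℝ] ℝ))) ∘L fderiv ℝ (fderiv ℝ w) x : E →L[ℝ] E) ≤
      C * ‖fderiv ℝ w x‖)
    (hF : ∀ x ∈ B, w x = 0 ↔ x ∈ F) (η : E →L[ℝ] ℝ) :
    IsTangentOn F B (horizField G (fderiv ℝ φ) η) := by
  have hAx : ∀ x ∈ B, ContDiffAt ℝ ∞ A x := fun x hx => hA.contDiffAt (hB.mem_nhds hx)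
  have hGx : ∀ x ∈ B, ContDiffAt ℝ ∞ G x := fun x hx => hG.contDiffAt (hB.mem_nhds hx)
  rintro y ⟨hyF, hyB⟩ c hc
  have hTc : ContinuousOn (fun x => (A x)⁻¹ • (fderiv ℝ (flux A G p) (x, fderiv ℝ φ x) ∘L
      ContinuousLinearMap.inr ℝ E (E →L[ℝ] ℝ))) B := by
    intro x hx
    refine ContinuousAt.continuousWithinAt ?_
    have h1 : ContDiffAt ℝ ∞ (fderiv ℝ φ) x :=
      (hφ.contDiffAt (hB.mem_nhds hx)).fderiv_right (by norm_cast)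
    have h2 : ContDiffAt ℝ ∞ (fderiv ℝ (flux A G p)) (x, fderiv ℝ φ x) :=
      (contDiffAt_flux (hAx x hx) (hGx x hx) (hφpos x hx)).fderiv_right (by norm_cast)
    have h3 : ContinuousAt (fun x => (x, fderiv ℝ φ x)) x := continuousAt_id.prodMk h1.continuousAt
    have h4 : ContinuousAt (fun x => fderiv ℝ (flux A G p) (x, fderiv ℝ φ x)) x :=
      ContinuousAt.comp (g := fderiv ℝ (flux A G p)) (f := fun x => (x, fderiv ℝ φ x))
        h2.continuousAt h3
    exact ((hAx x hx).continuousAt.inv₀ (hA0 x hx)).smul (h4.clm_comp continuousAt_const)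
  have key := normal_characteristic hB (hw.of_le (WithTop.coe_le_coe.2 le_top)) hw0
    (fun x hx η => apply_fderiv_flux_nonneg hp (hAx x hx) (hA0 x hx) (hGx x hx) (hs x hx)
      (hpos x hx) (hφpos x hx) η) hTc hC hineq (fun x hx => (hF x hx).1) hyB ((hF y hyB).2 hyF) hc
  have h := apply_eq_zero_of_apply_fderiv_flux_eq_zero hp (hAx y hyB) (hA0 y hyB) (hGx y hyB)
    (hs y hyB) (hpos y hyB) (hφpos y hyB) key
    (horizField_covec_apply (G := G) (θ := fderiv ℝ φ) η (hφpos y hyB))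
  rw [real_inner_comm]
  exact h

end Tangency

/-! ### Propagation of tangency through the generated Lie module. -/

noncomputable section

namespace SubRiem

section LieSpan

open Filter

variable {m : ℕ} {M : Type*} [TopologicalSpace M] [ChartedSpace (Coord (m + 1)) M]
  {e : OpenPartialHomeomorph M (Coord (m + 1))}

lemma finrank_le_finrank_map_coordDeriv (he : e ∈ IsManifold.maximalAtlas (𝓡 (m + 1)) ∞ M)
    {z : Coord (m + 1)} (hz : z ∈ e.target) (K : Submodule ℝ (Tan m (e.symm z))) :
    Module.finrank ℝ K ≤ Module.finrank ℝ (K.map (coordDeriv e (e.symm z)).toLinearMap) := by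
  have h : (K.map (coordDeriv e (e.symm z)).toLinearMap).map (coordInv e z).toLinearMap = K := by
    ext v
    simp only [Submodule.mem_map]
    constructor
    · rintro ⟨_, ⟨w, hw, rfl⟩, rfl⟩
      exact (coordInv_coordDeriv he hz w).symm ▸ hw
    · exact fun hv => ⟨_, ⟨v, hv, rfl⟩, coordInv_coordDeriv he hz v⟩
  have h1 := Submodule.finrank_map_le (coordInv e z).toLinearMap
    (K.map (coordDeriv e (e.symm z)).toLinearMap)
  rwa [h] at h1

lemma finrank_horizontal_le (he : e ∈ IsManifold.maximalAtlas (𝓡 (m + 1)) ∞ M) (g : CoMetric m M)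
    {z : Coord (m + 1)} (hz : z ∈ e.target) :
    Module.finrank ℝ (g.horizontal (e.symm z)) ≤
      Module.finrank ℝ (LinearMap.range (coordMetric g e z).toLinearMap) := by
  refine (finrank_le_finrank_map_coordDeriv he hz _).trans (Submodule.finrank_mono ?_)
  rintro _ ⟨_, ⟨θ, rfl⟩, rfl⟩
  refine ⟨θ ∘L coordInv e z, ?_⟩
  have h1 : (θ ∘L coordInv e z) ∘L coordDeriv e (e.symm z) = θ := by
    ext1 v
    exact congrArg θ (coordInv_coordDeriv he hz v)
  have h2 := coordDeriv_sharp he g hz (θ ∘L coordInv e z)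
  rw [h1] at h2
  exact h2.symm

variable [IsManifold (𝓡 (m + 1)) ∞ M]

lemma fieldOfCoord_mem_horizontal (he : e ∈ IsManifold.maximalAtlas (𝓡 (m + 1)) ∞ M) (g : CoMetric m M)
    {Y : Coord (m + 1) → Coord (m + 1)} {z : Coord (m + 1)} (hz : z ∈ e.target)
    (hY : ∃ η, coordMetric g e z η = Y z) : fieldOfCoord e Y (e.symm z) ∈ g.horizontal (e.symm z) := by
  obtain ⟨η, hη⟩ := hY
  rw [fieldOfCoord_symm he Y hz, ← hη, ← coordDeriv_sharp he g hz, coordInv_coordDeriv he hz]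
  exact ⟨_, rfl⟩

/-- Smoothness, tangency to `F` and tangency to the level sets of `φ` are carried together, since
the bracket step for either tangency uses smoothness of both fields. -/
lemma LieSpan.induction_coord (he : e ∈ IsManifold.maximalAtlas (𝓡 (m + 1)) ∞ M) {W : Set M}
    (hW : IsOpen W) {k : ℕ} {X : Fin k → ∀ x : M, Tan m x} (hX : ∀ i, SmoothFieldOn (X i) W)
    {F : Set (Coord (m + 1))} (hF : IsClosed F) {φ : Coord (m + 1) → ℝ}
    (hφ : ContDiffOn ℝ ∞ φ (e.target ∩ e.symm ⁻¹' W))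
    (hXt : ∀ i, IsTangentOn F (e.target ∩ e.symm ⁻¹' W) (coordField e (X i)))
    (hXφ : ∀ i, ∀ z ∈ e.target ∩ e.symm ⁻¹' W, fderiv ℝ φ z (coordField e (X i) z) = 0)
    {Z : ∀ x : M, Tan m x} (hZ : LieSpan W X Z) :
    SmoothFieldOn Z W ∧ IsTangentOn F (e.target ∩ e.symm ⁻¹' W) (coordField e Z) ∧
      ∀ z ∈ e.target ∩ e.symm ⁻¹' W, fderiv ℝ φ z (coordField e Z z) = 0 := by
  have hN : IsOpen (e.target ∩ e.symm ⁻¹' W) := e.isOpen_inter_preimage_symm hW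
  induction hZ with
  | gen i => exact ⟨hX i, hXt i, hXφ i⟩
  | zero =>
    have h0 : ∀ z, coordField e (fun _ : M => (0 : Coord (m + 1))) z = 0 := fun z =>
      map_zero (coordDeriv e (e.symm z))
    refine ⟨(Bundle.contMDiff_zeroSection ℝ (TangentSpace (𝓡 (m + 1)) : M → Type)).contMDiffOn,
      fun y _ c _ => ?_, fun z _ => ?_⟩
    · exact (congrArg (fun x => inner ℝ x (c - y)) (h0 y)).trans (inner_zero_left _)
    · exact (congrArg (fderiv ℝ φ z) (h0 z)).trans (map_zero _)
  | add Y Z _ _ ihY ihZ =>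
    have h0 : ∀ z, coordField e (fun x => Y x + Z x) z = coordField e Y z + coordField e Z z :=
      fun z => map_add (coordDeriv e (e.symm z)) _ _
    refine ⟨ihY.1.add_section ihZ.1, fun y hy c hc => ?_, fun z hz => ?_⟩
    · rw [h0, inner_add_left, ihY.2.1 y hy c hc, ihZ.2.1 y hy c hc, add_zero]
    · rw [h0, map_add, ihY.2.2 z hz, ihZ.2.2 z hz, add_zero]
  | smul f Z hf _ ih =>
    have h0 : ∀ z, coordField e (fun x => f x • Z x) z = f (e.symm z) • coordField e Z z :=
      fun z => map_smul (coordDeriv e (e.symm z)) _ _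
    refine ⟨ContMDiffOn.smul_section hf ih.1, fun y hy c hc => ?_, fun z hz => ?_⟩
    · rw [h0, inner_smul_left, ih.2.1 y hy c hc, mul_zero]
    · rw [h0, map_smul, ih.2.2 z hz, smul_zero]
  | bracket Y Z _ _ ihY ihZ =>
    have hYc := ihY.1.contDiffOn_coordField he hW
    have hZc := ihZ.1.contDiffOn_coordField he hW
    have h0 : ∀ z ∈ e.target ∩ e.symm ⁻¹' W,
        coordField e (VectorField.mlieBracket (𝓡 (m + 1)) Y Z) z =
          VectorField.lieBracket ℝ (coordField e Y) (coordField e Z) z :=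
      fun z hz => coordField_mlieBracket he hW ihY.1 ihZ.1 hz.1 hz.2
    refine ⟨ihY.1.mlieBracket hW ihZ.1, fun y hy c hc => ?_, fun z hz => ?_⟩
    · rw [h0 y hy.2]
      exact ihY.2.1.lieBracket hF hN hYc hZc ihZ.2.1 y hy c hc
    · rw [h0 z hz]
      exact fderiv_apply_lieBracket_eq_zero hN hφ hYc hZc ihY.2.2 ihZ.2.2 hz

end LieSpan

end SubRiem

end

noncomputable section

namespace SubRiem

section Propagation

open Filter

variable {m l : ℕ} {M : Type*} [TopologicalSpace M] [ChartedSpace (Coord (m + 1)) M]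
  [IsManifold (𝓡 (m + 1)) ∞ M] {e : OpenPartialHomeomorph M (Coord (m + 1))} {g : CoMetric m M}
  {p₀ : M}

/-- Under the rank condition, a closed set that is invariant under the horizontal fields tangent to
the level sets of `φ` and under a direction transversal to them is a neighbourhood of each of its
points close to `p₀`. -/
lemma RankCondition.mem_nhds_of_isTangentOn (hrank : RankCondition g p₀ l)
    (hl : HasDegeneracy g p₀ l) (he : e ∈ IsManifold.maximalAtlas (𝓡 (m + 1)) ∞ M)
    (hp₀ : p₀ ∈ e.source) {B F : Set (Coord (m + 1))} (hB : IsOpen B) (hBe : B ⊆ e.target)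
    (h0B : e p₀ ∈ B) (hF : IsClosed F) (h0F : e p₀ ∈ F) {φ : Coord (m + 1) → ℝ}
    (hφ : ContDiffOn ℝ ∞ φ B)
    (hpos : ∀ z ∈ B, 0 < fderiv ℝ φ z (coordMetric g e z (fderiv ℝ φ z)))
    (htan : ∀ η, IsTangentOn F B (horizField (coordMetric g e) (fderiv ℝ φ) η))
    {a : Coord (m + 1)} (ha : ∀ z ∈ B, fderiv ℝ φ z a ≠ 0) (hta : IsTangentOn F B (fun _ => a)) :
    F ∈ 𝓝 (e p₀) := by
  obtain ⟨O, hO, hpO, hrank⟩ := hrank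
  have hG : ContDiffOn ℝ ∞ (coordMetric g e) B := (contDiffOn_coordMetric he g).mono hBe
  have hθ : ContDiffOn ℝ ∞ (fderiv ℝ φ) B := hφ.fderiv_of_isOpen hB (by norm_cast)
  -- The horizontal space has dimension `m + 1 - l` at `p₀`, and one dimension is given up for
  -- tangency to the level sets.
  have hk : m - l ≤
      Module.finrank ℝ (LinearMap.range (coordMetric g e (e p₀)).toLinearMap) - 1 := by
    have h1 := hl.self_of_nhds
    have h2 := finrank_horizontal_le he g (e.map_source hp₀)
    rw [e.left_inv hp₀] at h2
    omega
  obtain ⟨η, hη⟩ := exists_linearIndependent_horizField (coordMetric g e) (fderiv ℝ φ) (e p₀) hk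
  set Y : Fin (m - l) → Coord (m + 1) → Coord (m + 1) :=
    fun i => horizField (coordMetric g e) (fderiv ℝ φ) (η i) with hY
  have hYs : ∀ i, ContDiffOn ℝ ∞ (Y i) B := fun i => contDiffOn_horizField (η i) hG hθ hpos
  have hYc : ContinuousAt (fun z => fun i => Y i z) (e p₀) :=
    continuousAt_pi.2 fun i => (hYs i).continuousOn.continuousAt (hB.mem_nhds h0B)
  -- Independence at the single point `p₀` persists nearby; shrinking to `W` yields a frame to which
  -- the rank condition applies.
  have hind : ∀ᶠ z in 𝓝 (e p₀), LinearIndependent ℝ (fun i => Y i z) :=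
    hYc.eventually hη.eventually
  obtain ⟨N, hNsub, hN, h0N⟩ := mem_nhds_iff.1 (Filter.inter_mem hind (hB.mem_nhds h0B))
  set W : Set M := (e.source ∩ e ⁻¹' N) ∩ O with hWdef
  have hW : IsOpen W := (e.isOpen_inter_preimage hN).inter hO
  have hN' : e.target ∩ e.symm ⁻¹' W ⊆ N := by
    rintro z ⟨hz, ⟨-, hzN⟩, -⟩
    have : e (e.symm z) ∈ N := hzN
    rwa [e.right_inv hz] at this
  have hN'B : e.target ∩ e.symm ⁻¹' W ⊆ B := fun z hz => (hNsub (hN' hz)).2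
  set X : Fin (m - l) → ∀ x : M, Tan m x := fun i => fieldOfCoord e (Y i) with hX
  have hXs : ∀ i, SmoothFieldOn (X i) W := fun i =>
    smoothFieldOn_fieldOfCoord he hN ((hYs i).mono fun z hz => (hNsub hz).2)
      (fun q hq => hq.1.1) fun q hq => hq.1.2
  have hXY : ∀ i, ∀ z ∈ e.target, coordField e (X i) z = Y i z := fun i z hz =>
    coordField_fieldOfCoord he (Y i) hz
  have hlift : ∀ q ∈ W, ∃ z ∈ e.target, z ∈ N ∧ e.symm z = q := fun q hq =>
    ⟨e q, e.map_source hq.1.1, hq.1.2, e.left_inv hq.1.1⟩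
  have hXh : ∀ i, ∀ q ∈ W, X i q ∈ g.horizontal q := by
    intro i q hq
    obtain ⟨z, hz, -, rfl⟩ := hlift q hq
    exact fieldOfCoord_mem_horizontal he g hz ⟨_, rfl⟩
  have hXi : ∀ q ∈ W, LinearIndependent ℝ (fun i => X i q) := by
    intro q hq
    obtain ⟨z, hz, hzN, rfl⟩ := hlift q hq
    refine LinearIndependent.of_comp (coordDeriv e (e.symm z)).toLinearMap ?_
    have : ((coordDeriv e (e.symm z)).toLinearMap ∘ fun i => X i (e.symm z)) = fun i => Y i z :=
      funext fun i => hXY i z hz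
    rw [this]
    exact (hNsub hzN).1
  have hspan := hrank W Set.inter_subset_right hW X hXs hXh hXi
  have hind := fun Z (hZ : LieSpan W X Z) => hZ.induction_coord he hW hXs hF (hφ.mono hN'B)
    (fun i y hy c hc => by
      rw [hXY i y hy.2.1]
      exact htan (η i) y ⟨hy.1, hN'B hy.2⟩ c hc)
    (fun i z hz => by
      rw [hXY i z hz.1]
      have h1 := coordMetric_symm he g hz.1 (fderiv ℝ φ z) (η i -
        (η i (coordMetric g e z (fderiv ℝ φ z)) /
          fderiv ℝ φ z (coordMetric g e z (fderiv ℝ φ z))) • fderiv ℝ φ z)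
      exact h1.trans (horizField_covec_apply (G := coordMetric g e) (θ := fderiv ℝ φ) (η i)
        (hpos z (hN'B hz))))
  refine mem_nhds_of_normal_trivial (N := e.target ∩ e.symm ⁻¹' W) hF h0F
    ((e.isOpen_inter_preimage_symm hW).mem_nhds
      ⟨e.map_source hp₀, by
        rw [Set.mem_preimage, e.left_inv hp₀]; exact ⟨⟨hp₀, h0N⟩, hpO⟩⟩) ?_
  rintro y ⟨hyF, hyN⟩ c hc
  set K : Submodule ℝ (Tan m (e.symm y)) :=
    Submodule.span ℝ {w | ∃ Z, LieSpan W X Z ∧ Z (e.symm y) = w} with hK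
  have hKm : m ≤ Module.finrank ℝ K := hspan (e.symm y) hyN.2
  have hS : ∀ L : Coord (m + 1) →L[ℝ] ℝ, (∀ Z, LieSpan W X Z → L (coordField e Z y) = 0) →
      ∀ x ∈ K.map (coordDeriv e (e.symm y)).toLinearMap, L x = 0 := by
    rintro L hL _ ⟨w, hw, rfl⟩
    refine Submodule.span_induction (p := fun w _ => L (coordDeriv e (e.symm y) w) = 0)
      ?_ ?_ ?_ ?_ hw
    · rintro _ ⟨Z, hZ, rfl⟩
      exact hL Z hZ
    · simp
    · intro w w' _ _ h h'
      rw [map_add, map_add, h, h', add_zero]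
    · intro t w _ h
      rw [map_smul, map_smul, h, smul_zero]
  -- The generated fields fill at least `m` of the `m + 1` dimensions inside the kernel of `dφ`, and
  -- `a` is transversal to it. The normal `c - y` is orthogonal to all of them.
  refine sub_eq_zero.1 (eq_zero_of_inner_eq_zero
    (S := K.map (coordDeriv e (e.symm y)).toLinearMap)
    (hS (fderiv ℝ φ y) fun Z hZ => (hind Z hZ).2.2 y hyN) (ha y (hN'B hyN)) ?_ ?_
    (hta y ⟨hyF, hN'B hyN⟩ c hc))
  · rw [finrank_euclideanSpace_fin]
    exact Nat.succ_le_succ (hKm.trans (finrank_le_finrank_map_coordDeriv he hyN.1 K))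
  · intro x hx
    rw [real_inner_comm]
    refine hS (innerCovec (c - y)) (fun Z hZ => ?_) x hx
    rw [innerCovec_apply, real_inner_comm]
    exact (hind Z hZ).2.1 y ⟨hyF, hyN⟩ c hc

end Propagation

end SubRiem

end

/-! ### The strong maximum principle. -/

open SubRiem in
theorem mainTheorem2 {m l : ℕ} {M : Type*} [TopologicalSpace M] [T2Space M]
    [ChartedSpace (Coord (m + 1)) M] [IsManifold (𝓡 (m + 1)) ∞ M]
    (g : CoMetric m M) (dv : VolumeForm m M) (p₀ : M)
    (hl : HasDegeneracy g p₀ l)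
    (U : Set M) (δ : ℝ) (Ψ : ℝ → M → M) (hΨ : IsIsometricTranslations g dv p₀ U δ Ψ)
    (S : Set M) (hS : IsHypersurface m S) (hpS : p₀ ∈ S) (htrans : IsTransversal m Ψ S U)
    (e : OpenPartialHomeomorph M (Coord (m + 1)))
    (he : IsTranslationIsometricCoords dv p₀ U δ Ψ S e)
    (u v : Coord m → ℝ) (hu : IsGraph e u) (hv : IsGraph e v)
    (hu' : IsNonsingularGraph g e u) (hv' : IsNonsingularGraph g e v)
    (hle : ∀ x ∈ baseDomain e, u x ≤ v x) (hu0 : u 0 = 0) (hv0 : v 0 = 0)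
    (p : ℝ) (hp : 0 ≤ p)
    (hH : ∀ x ∈ baseDomain e, graphCurv g dv e p v x ≤ graphCurv g dv e p u x)
    (hrank : RankCondition g p₀ l) :
    ∀ᶠ x in 𝓝 (0 : Coord m), v x = u x := by
  have hat := he.mem_atlas
  have h0t : (0 : Coord (m + 1)) ∈ e.target := he.origin ▸ e.map_source he.mem
  have hev := eventually_graphCurv_proj hΨ he hv hv' hv0 p
  have heu := eventually_graphCurv_proj hΨ he hu hu' hu0 p
  obtain ⟨-, h0b, hpos0, -⟩ := hev.self_of_nhds
  obtain ⟨-, -, hpos0u, -⟩ := heu.self_of_nhds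
  have hA := contDiffOn_coordDensity hat dv
  have hG := contDiffOn_coordMetric hat g
  set w : Coord (m + 1) → ℝ := fun z => coordGraphFn v z - coordGraphFn u z with hw
  have hweq : ∀ z, w z = v (proj z) - u (proj z) := fun z => by simp [hw, coordGraphFn]
  have hw0 : ∀ z, proj z ∈ baseDomain e → 0 ≤ w z := fun z hz => by
    rw [hweq]; exact sub_nonneg.2 (hle _ hz)
  -- The contact point is a minimum of `w`, so the two first jets agree there, as the linearization
  -- requires.
  have hd : fderiv ℝ (coordGraphFn v) 0 = fderiv ℝ (coordGraphFn u) 0 := by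
    have hmin : IsLocalMin w 0 := by
      filter_upwards [hev] with z hz
      rw [hweq 0, proj_zero, hu0, hv0, sub_zero]
      exact hw0 z hz.2.1
    have h1 := hmin.fderiv_eq_zero
    rw [hw, fderiv_fun_sub ((hv.contDiffAt_coordGraphFn h0b).differentiableAt (by simp))
      ((hu.contDiffAt_coordGraphFn h0b).differentiableAt (by simp))] at h1
    exact sub_eq_zero.1 h1
  obtain ⟨C, hC, hineq⟩ := exists_linearized_inequality
    (hv.contDiffAt_coordGraphFn h0b) (hu.contDiffAt_coordGraphFn h0b) hd
    (contDiffAt_flux (p := p) (hA.contDiffAt (e.open_target.mem_nhds h0t))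
      (hG.contDiffAt (e.open_target.mem_nhds h0t)) hpos0u)
    (hA.contDiffAt (e.open_target.mem_nhds h0t)) (coordDensity_ne_zero hat dv h0t)
    (by
      filter_upwards [hev, heu] with z hz hz'
      rw [← hz.2.2.2, ← hz'.2.2.2]
      exact hH _ hz.2.1)
  obtain ⟨ρ, hρ, hball⟩ := Metric.nhds_basis_closedBall.mem_iff.1 (hev.and hineq)
  have hball' : Metric.ball (0 : Coord (m + 1)) ρ ⊆ _ := Metric.ball_subset_closedBall.trans hball
  have hws : ∀ z ∈ Metric.closedBall (0 : Coord (m + 1)) ρ, ContDiffAt ℝ ∞ w z := fun z hz =>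
    (hv.contDiffAt_coordGraphFn (hball hz).1.2.1).sub
      (hu.contDiffAt_coordGraphFn (hball hz).1.2.1)
  -- Cutting with a closed ball makes the zero set closed; tangency is only needed in the open ball,
  -- where the cut is invisible.
  set F : Set (Coord (m + 1)) := Metric.closedBall 0 ρ ∩ w ⁻¹' {0} with hFdef
  have hF : IsClosed F := ContinuousOn.preimage_isClosed_of_isClosed
    (fun z hz => (hws z hz).continuousAt.continuousWithinAt) Metric.isClosed_closedBall
    isClosed_singleton
  have hFmem : ∀ z ∈ Metric.ball (0 : Coord (m + 1)) ρ, w z = 0 ↔ z ∈ F := fun z hz =>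
    ⟨fun h => ⟨Metric.ball_subset_closedBall hz, h⟩, fun h => h.2⟩
  have h0F : (0 : Coord (m + 1)) ∈ F := by
    refine (hFmem 0 (Metric.mem_ball_self hρ)).1 ?_
    rw [hweq, proj_zero, hu0, hv0, sub_zero]
  -- `w` depends only on the first `m` coordinates, so `F` contains short vertical segments through
  -- its points.
  have hlast : IsTangentOn F (Metric.ball 0 ρ) (fun _ => lastVec m) := by
    rintro y ⟨hyF, hyB⟩ c hc
    refine inner_eq_zero_of_eventually_norm_le ?_
    have h1 : ContinuousAt (fun t : ℝ => y + t • lastVec m) 0 := by fun_prop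
    have h2 : ∀ᶠ t in 𝓝 (0 : ℝ), y + t • lastVec m ∈ Metric.ball (0 : Coord (m + 1)) ρ :=
      h1.eventually (Metric.isOpen_ball.mem_nhds (by simpa using hyB))
    filter_upwards [h2] with t ht
    rw [sub_sub]
    refine hc _ ((hFmem _ ht).1 ?_)
    rw [hweq, proj_add_smul_lastVec, ← hweq]
    exact hyF.2
  have hφ : ContDiffOn ℝ ∞ (coordGraphFn v) (Metric.ball 0 ρ) := fun z hz =>
    (hv.contDiffAt_coordGraphFn (hball' hz).1.2.1).contDiffWithinAt
  have hBt : Metric.ball (0 : Coord (m + 1)) ρ ⊆ e.target := fun z hz => (hball' hz).1.1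
  have hnhds : F ∈ 𝓝 (e p₀) := by
    refine hrank.mem_nhds_of_isTangentOn hl hat he.mem Metric.isOpen_ball hBt ?_ hF ?_ hφ
      (fun z hz => (hball' hz).1.2.2.1) (fun η => ?_)
      (fun z hz => ?_) hlast
    · rw [he.origin]; exact Metric.mem_ball_self hρ
    · rwa [he.origin]
    · exact isTangentOn_horizField Metric.isOpen_ball hp hC (hA.mono hBt)
        (fun z hz => coordDensity_ne_zero hat dv (hBt hz)) (hG.mono hBt)
        (fun z hz => coordMetric_symm hat g (hBt hz))
        (fun z hz => coordMetric_nonneg hat g (hBt hz)) hφ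
        (fun z hz => (hball' hz).1.2.2.1)
        (fun z hz => (hws z (Metric.ball_subset_closedBall hz)).contDiffWithinAt)
        (fun z hz => hw0 z (hball' hz).1.2.1) (fun z hz => (hball' hz).2) hFmem η
    · rw [fderiv_coordGraphFn_lastVec
        ((hv.contDiffAt_coordGraphFn (hball' hz).1.2.1).differentiableAt (by simp))]
      norm_num
  rw [he.origin, ← append_zero_zero] at hnhds
  filter_upwards [continuous_append_zero.continuousAt.eventually hnhds] with x hx
  have h := hx.2
  rw [Set.mem_preimage, hweq, proj_append] at h
  exact sub_eq_zero.1 h
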